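/- Let $n\ge 2$, write $y=(y',y_n)\in\mathbb R^{n-1}\times\mathbb R$, and put $\mathbb B^+_r=\{y\in\mathbb R^n : |y|<r,\ y_n>0\}$ and ${\bf B}_r=\{(y',0) : y'\in\mathbb R^{n-1},\ |y'|<r\}$. For all $\theta,M,K>0$ there exist constants $C>0$, $\beta>0$ and $\kappa\in(0,1)$, depending only on $n,\theta,M,K$, such that the following holds. Let $\alpha,\lambda\in\mathbb R$ with $|\alpha|\ge 1$ or $|\lambda|\ge 1$. Let $a_{ij}\in C^1(\mathbb B^+_{1/2})$ satisfy $\|a_{ij}\|_{C^1(\mathbb B^+_{1/2})}\le M$ and $\sum_{i,j}a_{ij}(y)\xi_i\xi_j\ge\theta|\xi|^2$ for all $y\in\mathbb B^+_{1/2}$ and $\xi\in\mathbb R^n$, and let $b=(b_1,\dots,b_n)$ and $c$ satisfy $$\|b_i\|_{W^{1,\infty}(\mathbb B^+_{1/2})}\le K(|\alpha|+1),\qquad \|c\|_{W^{1,\infty}(\mathbb B^+_{1/2})}\le K(\alpha^2+|\lambda|).$$ Let $u\in L^2(\mathbb B^+_{1/2})$ be a real function that is $C^\infty$ up to the flat boundary,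 i.e. on $\{|y|<1/2,\ y_n\ge 0\}$, and satisfies $$-\sum_{i,j}a_{ij}D_{ij}u+\sum_i b_iD_iu+cu=0\quad\text{a.e. in }\mathbb B^+_{1/2}.$$ Then $$\|u\|_{L^2(\mathbb B^+_{1/256})}\le e^{C(|\alpha|+\sqrt{|\lambda|})}\,\|u\|_{L^2(\mathbb B^+_{1/2})}^{\kappa}\Big(\|u\|_{H^1({\bf B}_{1/3})}+\Big\|\frac{\partial u}{\partial\nu}\Big\|_{L^2({\bf B}_{1/3})}\Big)^{1-\kappa},$$ where $\partial u/\partial\nu=-D_nu$ and $\|u\|_{H^1({\bf B}_{1/3})}^2=\|u\|^2_{L^2({\bf B}_{1/3})}+\|\nabla' u\|^2_{L^2({\bf B}_{1/3})}$ with $\nabla'$ the gradient in $y'$. Moreover, if $\|u\|_{L^2(\mathbb B^+_{1/2})}\le 1$ and $\|u\|_{H^1({\bf B}_{1/3})}+\|\partial u/\partial\nu\|_{L^2({\bf B}_{1/3})}\le\epsilon$ for some $\epsilon>0$, then $$\|u\|_{L^2(\mathbb B^+_{1/256})}\le e^{C(|\alpha|+\sqrt{|\lambda|})}\,\epsilon^{\beta}.$$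 -/

import Mathlib

open MeasureTheory
open scoped ENNReal ContDiff

noncomputable section

/-- Points `y = (y', y_n)` of `ℝⁿ`, `n = d + 1`; the last coordinate is the normal one. -/
abbrev Rn (d : ℕ) : Type := EuclideanSpace ℝ (Fin (d + 1))

/-- Points `y'` of `ℝⁿ⁻¹`, `n = d + 1`. -/
abbrev Rn' (d : ℕ) : Type := EuclideanSpace ℝ (Fin d)

/-- The open half ball `{|y| < r, y_n > 0}`. -/
def halfBall (d : ℕ) (r : ℝ) : Set (Rn d) := {y | ‖y‖ < r ∧ 0 < y (Fin.last d)}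

/-- The half ball together with its flat face, `{|y| < r, y_n ≥ 0}`. -/
def flatHalfBall (d : ℕ) (r : ℝ) : Set (Rn d) := {y | ‖y‖ < r ∧ 0 ≤ y (Fin.last d)}

/-- The point `(y', 0)`. -/
def flatPoint {d : ℕ} (y' : Rn' d) : Rn d :=
  WithLp.toLp 2 (Fin.snoc (α := fun _ => ℝ) (fun i => y' i) 0)

/-- The partial derivative `D_i f`. -/
def partialD {d : ℕ} (i : Fin (d + 1)) (f : Rn d → ℝ) : Rn d → ℝ :=
  fun y => fderiv ℝ f y (EuclideanSpace.single i 1)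

/-- `g` is the weak derivative `D_i f` in the open set `U`. -/
def IsWeakPartialD {d : ℕ} (U : Set (Rn d)) (i : Fin (d + 1)) (f g : Rn d → ℝ) : Prop :=
  ∀ φ : Rn d → ℝ, ContDiff ℝ ∞ φ → HasCompactSupport φ → tsupport φ ⊆ U →
    ∫ y in U, f y * partialD i φ y = - ∫ y in U, g y * φ y

/-- `f ∈ W^{1,∞}(U)` and `‖f‖_{W^{1,∞}(U)} ≤ N`, where the norm is the largest of the
`L^∞(U)` norms of `f` and of its weak first derivatives. -/
def W1InftyNormLE {d : ℕ} (U : Set (Rn d)) (f : Rn d → ℝ) (N : ℝ) : Prop :=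
  MemLp f ∞ (volume.restrict U) ∧ eLpNorm f ∞ (volume.restrict U) ≤ ENNReal.ofReal N ∧
    ∀ i, ∃ g : Rn d → ℝ, IsWeakPartialD U i f g ∧
      MemLp g ∞ (volume.restrict U) ∧ eLpNorm g ∞ (volume.restrict U) ≤ ENNReal.ofReal N

/-- `f ∈ C¹(U)` and `‖f‖_{C¹(U)} ≤ N`, for an open set `U`. -/
def C1NormLE {d : ℕ} (U : Set (Rn d)) (f : Rn d → ℝ) (N : ℝ) : Prop :=
  ContDiffOn ℝ 1 f U ∧ ∀ y ∈ U, |f y| ≤ N ∧ ‖fderiv ℝ f y‖ ≤ N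

/-- Uniform ellipticity in `U` with constant `θ`. The upper bound is part of the bound on the
coefficients. -/
def UniformlyElliptic {d : ℕ} (U : Set (Rn d)) (a : Fin (d + 1) → Fin (d + 1) → Rn d → ℝ)
    (θ : ℝ) : Prop :=
  ∀ y ∈ U, ∀ ξ : Rn d, θ * ‖ξ‖ ^ 2 ≤ ∑ i, ∑ j, a i j y * ξ i * ξ j

/-- The operator `-a_{ij} D_{ij} u + b_i D_i u + c u`. -/
def ellipticOp {d : ℕ} (a : Fin (d + 1) → Fin (d + 1) → Rn d → ℝ)
    (b : Fin (d + 1) → Rn d → ℝ) (c : Rn d → ℝ) (u : Rn d → ℝ) : Rn d → ℝ :=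
  fun y => -(∑ i, ∑ j, a i j y * partialD i (partialD j u) y)
    + ∑ i, b i y * partialD i u y + c y * u y

/-- `‖u‖_{L²(B⁺_r)}`. -/
def halfBallL2 {d : ℕ} (r : ℝ) (u : Rn d → ℝ) : ℝ≥0∞ :=
  eLpNorm u 2 (volume.restrict (halfBall d r))

/-- The `H¹` norm on the `(n-1)`-dimensional ball `|y'| < r` of a function that is `C¹` there:
`(‖g‖² + ‖∇g‖²)^{1/2}` with `L²` norms. -/
def ballH1 {d : ℕ} (r : ℝ) (g : Rn' d → ℝ) : ℝ≥0∞ :=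
  (eLpNorm g 2 (volume.restrict (Metric.ball 0 r)) ^ 2
    + eLpNorm (fderiv ℝ g) 2 (volume.restrict (Metric.ball 0 r)) ^ 2) ^ (1 / 2 : ℝ)

/-- The outer normal derivative `∂u/∂ν = -D_n u` at `(y', 0)`, for `u` differentiable up to the
flat face of the half ball of radius `R`. -/
def normalD {d : ℕ} (R : ℝ) (u : Rn d → ℝ) : Rn' d → ℝ :=
  fun y' => -(fderivWithin ℝ u (flatHalfBall d R) (flatPoint y')
    (EuclideanSpace.single (Fin.last d) 1))

/-- The boundary data `‖u‖_{H¹} + ‖∂u/∂ν‖_{L²}` on `{(y', 0) : |y'| < r}`, for `u` defined in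
the half ball of radius `R > r`. -/
def cauchyData {d : ℕ} (R r : ℝ) (u : Rn d → ℝ) : ℝ≥0∞ :=
  ballH1 r (fun y' : Rn' d => u (flatPoint y'))
    + eLpNorm (normalD R u) 2 (volume.restrict (Metric.ball 0 r))

end

/-! The theorem is quantitative unique continuation from Cauchy data, and it rests on a Carleman
inequality on the half ball that keeps its boundary terms. The phase ψ = -(|y|² + 2y_n) equals 1 -
|y + e_n|²: its level sets are spheres centred at -e_n, outside the half ball, it attains its
maximum over the closed half space at the origin only, and its gradient has norm between 2 and 3 on
the half ball of radius 1/3. With the weight exp(τ e^{μψ}) the local frequency is T = τ μ e^{μψ};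
convexification by a large μ makes the commutator positive (`carleman_pointwise`, integrated in
`carleman`).

The point is the exponent, which is linear in S = |α| + √|λ|. If c were treated as a perturbation,
its square would have to be absorbed by T³, which costs τ ~ |λ|^{2/3}. Instead b is made part of the
vector field X of the multiplier, and c part of the potential Q. The divergence then contains first
derivatives of b and c, which is where the W^{1,∞} bounds enter, but all that is needed is that b
and ∇b are small against T, and c and ∇c against T². This amounts to τ ≥ C S.

The inequality is applied to a cutoff of u. The commutator with the cutoff lives at |y| ≥ 1/4, where
the weight is exponentially smaller than on |y| < 1/256, and the gradient of u occurring there is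
controlled by `caccioppoli`. The outcome is `core_estimate`: for every τ ≥ C S, the squared norm on
the small half ball is at most C (e^{-gτ} U + e^{3τ} D), with U the squared norm on the larger half
ball and D the squared data together with a residual of the equation. Balancing the two exponentials
in τ gives κ = 3/(3+g) (`le_of_forall_exp_le`).

The Carleman argument needs C¹ coefficients, whereas b and c are only W^{1,∞}, and u is controlled
only up to the flat face. So `shifted_estimate` translates by δ e_n, which leaves room to mollify b
and c; the residual tends to 0 in L². Then `face_estimate` lets δ tend to 0. -/

open scoped InnerProductSpace

/-! ### Fubini and the divergence theorem in the half space. -/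

/-- The open upper half space `{y_n > 0}`. -/
def upperHalf (d : ℕ) : Set (Rn d) := {y | 0 < y (Fin.last d)}

lemma measurableSet_upperHalf (d : ℕ) : MeasurableSet (upperHalf d) :=
  measurableSet_lt measurable_const (by fun_prop)

/-- The inward unit normal `e_n`. -/
noncomputable def eN (d : ℕ) : Rn d := EuclideanSpace.single (Fin.last d) 1

/-- The point of `ℝⁿ` with `k`-th coordinate `t` and remaining coordinates `z`. -/
def insertCoord {d : ℕ} (k : Fin (d + 1)) (t : ℝ) (z : Fin d → ℝ) : Rn d :=
  WithLp.toLp 2 (Fin.insertNth (α := fun _ => ℝ) k t z)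

lemma insertCoord_eq_add {d : ℕ} (k : Fin (d + 1)) (t : ℝ) (z : Fin d → ℝ) :
    insertCoord k t z = insertCoord k 0 z + t • EuclideanSpace.single k 1 := by
  ext i
  rcases Fin.eq_self_or_eq_succAbove k i with rfl | ⟨j, rfl⟩
  · simp [insertCoord]
  · simp [insertCoord, Fin.succAbove_ne]

lemma measurePreserving_insertCoord {d : ℕ} (k : Fin (d + 1)) :
    MeasurePreserving (fun x : ℝ × (Fin d → ℝ) => insertCoord k x.1 x.2) :=
  (PiLp.volume_preserving_toLp (Fin (d + 1))).comp
    (volume_preserving_piFinSuccAbove (fun _ => ℝ) k).symm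

lemma measurableEmbedding_insertCoord {d : ℕ} (k : Fin (d + 1)) :
    MeasurableEmbedding (fun x : ℝ × (Fin d → ℝ) => insertCoord k x.1 x.2) :=
  ((MeasurableEquiv.piFinSuccAbove (fun _ => ℝ) k).symm.trans
    (MeasurableEquiv.toLp 2 (Fin (d + 1) → ℝ))).measurableEmbedding

lemma integral_eq_integral_insertCoord {d : ℕ} (k : Fin (d + 1)) {g : Rn d → ℝ}
    (hg : Integrable g) : ∫ y, g y = ∫ z, ∫ t, g (insertCoord k t z) := by
  rw [← (measurePreserving_insertCoord k).integral_comp (measurableEmbedding_insertCoord k)]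
  exact integral_prod_symm _
    (((measurePreserving_insertCoord k).integrable_comp_emb
      (measurableEmbedding_insertCoord k)).2 hg)

lemma flatPoint_eq_insertCoord {d : ℕ} (y' : Rn' d) :
    flatPoint y' = insertCoord (Fin.last d) 0 (fun i => y' i) := by
  simp [flatPoint, insertCoord, Fin.insertNth_last']

lemma integral_flatPoint {d : ℕ} (f : Rn d → ℝ) :
    ∫ y' : Rn' d, f (flatPoint y') = ∫ z, f (insertCoord (Fin.last d) 0 z) := by
  rw [← (PiLp.volume_preserving_ofLp (Fin d)).integral_comp
    (MeasurableEquiv.toLp 2 (Fin d → ℝ)).symm.measurableEmbedding]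
  simp only [flatPoint_eq_insertCoord]

lemma contDiff_insertCoord {d : ℕ} {f : Rn d → ℝ} (hf : ContDiff ℝ 1 f)
    (k : Fin (d + 1)) (z : Fin d → ℝ) : ContDiff ℝ 1 (fun t => f (insertCoord k t z)) := by
  have h : (fun t => f (insertCoord k t z))
      = fun t : ℝ => f (insertCoord k 0 z + t • EuclideanSpace.single k (1 : ℝ)) :=
    funext fun t => by rw [insertCoord_eq_add]
  rw [h]
  fun_prop

lemma deriv_insertCoord {d : ℕ} {f : Rn d → ℝ} (hf : ContDiff ℝ 1 f)
    (k : Fin (d + 1)) (z : Fin d → ℝ) (t : ℝ) : deriv (fun t => f (insertCoord k t z)) t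
    = fderiv ℝ f (insertCoord k t z) (EuclideanSpace.single k 1) := by
  have h1 : HasDerivAt (fun t : ℝ => insertCoord k t z) (EuclideanSpace.single k (1 : ℝ)) t := by
    rw [funext fun t => insertCoord_eq_add k t z]
    simpa using ((hasDerivAt_id t).smul_const (EuclideanSpace.single k (1 : ℝ))).const_add
      (insertCoord k 0 z)
  exact (((hf.differentiable one_ne_zero _).hasFDerivAt).comp_hasDerivAt t h1).deriv

lemma hasCompactSupport_insertCoord {d : ℕ} {f : Rn d → ℝ} (hc : HasCompactSupport f)
    (k : Fin (d + 1)) (z : Fin d → ℝ) : HasCompactSupport (fun t => f (insertCoord k t z)) := by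
  apply hc.comp_isClosedEmbedding (g := fun t => insertCoord k t z)
  have : Isometry (fun t => insertCoord k t z) := by
    intro s t
    simp only
    rw [insertCoord_eq_add k s, insertCoord_eq_add k t, edist_add_left,
      edist_eq_enorm_sub, ← sub_smul, enorm_smul, edist_eq_enorm_sub]
    simp [← ofReal_norm]
  exact this.isClosedEmbedding

/-- Fubini along the `k`-th direction. A line parallel to e_n meets the half space in a half line,
so the inner integral is minus the value on the face. A line in any other coordinate direction lies
inside or outside entirely, and a compactly supported derivative integrates to zero along it. -/
lemma integral_upperHalf_fderiv {d : ℕ} {f : Rn d → ℝ} (hf : ContDiff ℝ 1 f)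
    (hc : HasCompactSupport f) (k : Fin (d + 1)) :
    ∫ y in upperHalf d, fderiv ℝ f y (EuclideanSpace.single k 1)
      = if k = Fin.last d then - ∫ y' : Rn' d, f (flatPoint y') else 0 := by
  have hint : Integrable (fun y => fderiv ℝ f y (EuclideanSpace.single k 1)) :=
    ((hf.continuous_fderiv one_ne_zero).clm_apply continuous_const).integrable_of_hasCompactSupport
      (hc.fderiv_apply (𝕜 := ℝ) _)
  rw [← integral_indicator (measurableSet_upperHalf d),
    integral_eq_integral_insertCoord k (hint.indicator (measurableSet_upperHalf d))]
  split_ifs with h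
  · subst h
    rw [integral_flatPoint, ← integral_neg]
    congr 1 with z
    rw [← (hasCompactSupport_insertCoord hc (Fin.last d) z).integral_Ioi_deriv_eq
      (contDiff_insertCoord hf _ z) 0, ← integral_indicator measurableSet_Ioi]
    congr 1 with t
    simp only [Set.indicator, upperHalf, Set.mem_ofPred_eq, Set.mem_Ioi, deriv_insertCoord hf]
    simp [insertCoord]
  · rw [← integral_zero (Fin d → ℝ) ℝ]
    congr 1 with z
    obtain ⟨j, hj⟩ := Fin.exists_succAbove_eq (Ne.symm h)
    have h0 : ∫ t, deriv (fun t => f (insertCoord k t z)) t = 0 := by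
      have hcs := hasCompactSupport_insertCoord hc k z
      have hC := contDiff_insertCoord hf k z
      refine integral_eq_zero_of_hasDerivAt_of_integrable
        (fun t => (hC.differentiable one_ne_zero t).hasDerivAt) ?_ ?_
      · exact (hC.continuous_deriv le_rfl).integrable_of_hasCompactSupport hcs.deriv
      · exact hC.continuous.integrable_of_hasCompactSupport hcs
    have hl : ∀ t, insertCoord k t z ∈ upperHalf d ↔ 0 < z j := by
      intro t
      simp only [upperHalf, Set.mem_ofPred_eq, insertCoord, ← hj]
      simp
    by_cases hz : 0 < z j
    · simp only [Set.indicator, hl, hz, if_true, ← deriv_insertCoord hf]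
      exact h0
    · simp [Set.indicator, hl, hz]

/-- The trace of an endomorphism of `ℝⁿ`. -/
noncomputable def tr {d : ℕ} (L : Rn d →L[ℝ] Rn d) : ℝ :=
  ∑ k, L (EuclideanSpace.single k 1) k

lemma tr_add {d : ℕ} (L N : Rn d →L[ℝ] Rn d) : tr (L + N) = tr L + tr N := by
  simp [tr, Finset.sum_add_distrib]

lemma tr_smul {d : ℕ} (c : ℝ) (L : Rn d →L[ℝ] Rn d) : tr (c • L) = c * tr L := by
  simp [tr, Finset.mul_sum]

lemma tr_smulRight {d : ℕ} (g : Rn d →L[ℝ] ℝ) (v : Rn d) : tr (g.smulRight v) = g v := by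
  have h : v = ∑ k, v k • EuclideanSpace.single k (1 : ℝ) := by
    ext i
    simp [Finset.sum_apply, Pi.single_apply]
  conv_rhs => rw [h]
  simp [tr, mul_comm]

lemma abs_tr_le {d : ℕ} (L : Rn d →L[ℝ] Rn d) : |tr L| ≤ (d + 1) * ‖L‖ := by
  calc |tr L| ≤ ∑ k, |L (EuclideanSpace.single k 1) k| := Finset.abs_sum_le_sum_abs _ _
    _ ≤ ∑ _k : Fin (d + 1), ‖L‖ := by
        gcongr with k
        calc |L (EuclideanSpace.single k 1) k| ≤ ‖L (EuclideanSpace.single k 1)‖ :=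
              PiLp.norm_apply_le (L (EuclideanSpace.single k 1)) k
          _ ≤ ‖L‖ * ‖EuclideanSpace.single k (1 : ℝ)‖ := L.le_opNorm _
          _ = ‖L‖ := by simp
    _ = (d + 1) * ‖L‖ := by simp

lemma tr_fderiv_smul {d : ℕ} {g : Rn d → ℝ} {V : Rn d → Rn d} {y : Rn d}
    {g' : Rn d →L[ℝ] ℝ} {V' : Rn d →L[ℝ] Rn d}
    (hg : HasFDerivAt g g' y) (hV : HasFDerivAt V V' y) :
    tr (fderiv ℝ (fun x => g x • V x) y) = g y * tr V' + g' (V y) := by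
  have h : fderiv ℝ (fun x => g x • V x) y = _ := (hg.smul hV).fderiv
  rw [h, tr_add, tr_smul, tr_smulRight]

/-- The divergence theorem in the half space. -/
theorem integral_upperHalf_tr_fderiv {d : ℕ} {F : Rn d → Rn d} (hF : ContDiff ℝ 1 F)
    (hc : HasCompactSupport F) :
    ∫ y in upperHalf d, tr (fderiv ℝ F y) = - ∫ y' : Rn' d, F (flatPoint y') (Fin.last d) := by
  have hFk : ∀ k, ContDiff ℝ 1 (fun y => F y k) := fun k => by fun_prop
  have hck : ∀ k, HasCompactSupport (fun y => F y k) := fun k =>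
    hc.comp_left (g := fun v : Rn d => v k) rfl
  have hd : ∀ k y v, fderiv ℝ F y v k = fderiv ℝ (fun y => F y k) y v := by
    intro k y v
    have h := (EuclideanSpace.proj (𝕜 := ℝ) k).hasFDerivAt.comp y
      (hF.differentiable one_ne_zero y).hasFDerivAt
    have h2 : fderiv ℝ (fun y => F y k) y = _ := h.fderiv
    rw [h2]; rfl
  simp only [tr, hd]
  rw [integral_finsetSum]
  · simp only [integral_upperHalf_fderiv (hFk _) (hck _)]
    simp
  · intro k _
    exact (((hFk k).continuous_fderiv one_ne_zero).clm_apply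
      continuous_const).integrable_of_hasCompactSupport
      ((hck k).fderiv_apply (𝕜 := ℝ) _) |>.integrableOn

lemma norm_flatPoint {d : ℕ} (y' : Rn' d) : ‖flatPoint y'‖ = ‖y'‖ := by
  simp [EuclideanSpace.norm_eq, Fin.sum_univ_castSucc, flatPoint]

/-- The embedding `y' ↦ (y', 0)` as a linear isometry. -/
def flatEmb (d : ℕ) : Rn' d →ₗᵢ[ℝ] Rn d where
  toFun := flatPoint
  map_add' x y := by
    ext i
    refine Fin.lastCases ?_ (fun j => ?_) i <;> simp [flatPoint]
  map_smul' c x := by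
    ext i
    refine Fin.lastCases ?_ (fun j => ?_) i <;> simp [flatPoint]
  norm_map' := norm_flatPoint

lemma continuous_flatPoint {d : ℕ} : Continuous (flatPoint (d := d)) := (flatEmb d).continuous

lemma flatPoint_last {d : ℕ} (y' : Rn' d) : flatPoint y' (Fin.last d) = 0 := by simp [flatPoint]

/-! ### The multiplier identity and the pointwise positivity. -/

/-- The field whose divergence is controlled in the Carleman estimate. -/
noncomputable def flux {d : ℕ} (A : Rn d → Rn d →L[ℝ] Rn d) (X : Rn d → Rn d) (Q ρ w : Rn d → ℝ)
    (p : Rn d → Rn d) : Rn d → Rn d := fun x =>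
  (2 * ⟪X x, p x⟫_ℝ + 2 * (ρ x * w x)) • A x (p x) + (Q x * w x ^ 2 - ⟪A x (p x), p x⟫_ℝ) • X x

/-- A Rellich-type identity with multiplier ⟨X, p⟩ + ρ w, where p = ∇w. The second derivatives of w
survive only through tr(A H): the terms ⟨A p, H X⟩ coming from the two halves of the flux cancel by
symmetry of A and H. The term -2ρQw² compensates for completing the second factor to div(A p) + Q w.
-/
lemma tr_fderiv_flux {d : ℕ} {A : Rn d → Rn d →L[ℝ] Rn d} {X p : Rn d → Rn d} {Q ρ w : Rn d → ℝ}
    {A' : Rn d →L[ℝ] Rn d →L[ℝ] Rn d} {X' H : Rn d →L[ℝ] Rn d} {Q' ρ' : Rn d →L[ℝ] ℝ} {y : Rn d}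
    (hA : HasFDerivAt A A' y) (hX : HasFDerivAt X X' y) (hQ : HasFDerivAt Q Q' y)
    (hρ : HasFDerivAt ρ ρ' y) (hw : HasFDerivAt w (innerSL ℝ (p y)) y) (hp : HasFDerivAt p H y)
    (hAs : ∀ x z, ⟪A y x, z⟫_ℝ = ⟪x, A y z⟫_ℝ) (hHs : ∀ x z, ⟪H x, z⟫_ℝ = ⟪x, H z⟫_ℝ) :
    tr (fderiv ℝ (flux A X Q ρ w p) y)
      = 2 * (⟪X y, p y⟫_ℝ + ρ y * w y) * (tr ((A y).comp H) + tr (A'.flip (p y)) + Q y * w y)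
        - 2 * ρ y * Q y * w y ^ 2 + 2 * ⟪X' (A y (p y)), p y⟫_ℝ
        + (2 * ρ y - tr X') * ⟪A y (p y), p y⟫_ℝ - ⟪A' (X y) (p y), p y⟫_ℝ
        + (Q' (X y) + Q y * tr X') * w y ^ 2 + 2 * w y * ρ' (A y (p y)) := by
  have hAp := hA.clm_apply hp
  have h1 := ((hX.inner ℝ hp).const_mul 2).add ((hρ.mul hw).const_mul 2)
  have h2 := (hQ.mul (hw.pow 2)).sub (hAp.inner ℝ hp)
  have hF := (h1.smul hAp).add (h2.smul hX)
  have hF' : fderiv ℝ (flux A X Q ρ w p) y = _ := hF.fderiv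
  rw [hF', tr_add, tr_add, tr_add, tr_smul, tr_smul, tr_smulRight, tr_smulRight, tr_add]
  have e1 : ⟪H (A y (p y)), X y⟫_ℝ = ⟪A y (p y), H (X y)⟫_ℝ := hHs _ _
  have e2 : ⟪A y (H (X y)), p y⟫_ℝ = ⟪A y (p y), H (X y)⟫_ℝ := by
    rw [hAs, real_inner_comm]
  have e3 : ⟪X y, H (A y (p y))⟫_ℝ = ⟪A y (p y), H (X y)⟫_ℝ := by
    rw [real_inner_comm, e1]
  have e4 : ⟪p y, X y⟫_ℝ = ⟪X y, p y⟫_ℝ := real_inner_comm _ _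
  have e5 : ⟪p y, A y (p y)⟫_ℝ = ⟪A y (p y), p y⟫_ℝ := real_inner_comm _ _
  simp [inner_add_left, e2, e3, e4, e5]
  ring

lemma abs_inner_apply_le {d : ℕ} (L : Rn d →L[ℝ] Rn d) (x z : Rn d) :
    |⟪L x, z⟫_ℝ| ≤ ‖L‖ * ‖x‖ * ‖z‖ :=
  (abs_real_inner_le_norm _ _).trans (by gcongr; exact L.le_opNorm x)

set_option maxHeartbeats 1000000 in
/-- Pointwise lower bound behind the Carleman estimate. The vector `n` is the gradient of the phase
`ψ` (with `D²ψ = -2`), `T` the local frequency, with `∇T = μ T n`. -/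
theorem carleman_pointwise {d : ℕ} {θ M μ T : ℝ} (hθ : 0 < θ) (hM : 1 ≤ M) (hμ : 1 ≤ μ)
    (hμM : 2000 * (d + 1) ^ 2 * M ^ 2 ≤ θ ^ 2 * μ) (hT : μ ^ 2 ≤ T)
    {A : Rn d →L[ℝ] Rn d} {A' : Rn d →L[ℝ] Rn d →L[ℝ] Rn d} {n b p : Rn d}
    {H b' : Rn d →L[ℝ] Rn d} {c w g : ℝ} {c' : Rn d →L[ℝ] ℝ}
    (hA : ‖A‖ ≤ M) (hA' : ‖A'‖ ≤ M) (hAs : ∀ x z, ⟪A x, z⟫_ℝ = ⟪x, A z⟫_ℝ)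
    (hell : ∀ x, θ * ‖x‖ ^ 2 ≤ ⟪A x, x⟫_ℝ) (hn : 2 ≤ ‖n‖) (hn' : ‖n‖ ≤ 3)
    (hb : μ * ‖b‖ ≤ T) (hb' : μ * ‖b'‖ ≤ T) (hc : μ * |c| ≤ T ^ 2) (hc' : μ * ‖c'‖ ≤ T ^ 2)
    {X : Rn d} {X' : Rn d →L[ℝ] Rn d} {q Q ρ : ℝ} {q' Q' ρ' : Rn d →L[ℝ] ℝ}
    (hq : q = ⟪A n, n⟫_ℝ) (hX : X = (2 * T) • A n + b)
    (hQ : Q = T ^ 2 * q + T * ⟪b, n⟫_ℝ - c) (hρ : ρ = 2 * μ * T * q)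
    (hX' : X' = (2 * μ * T) • (innerSL ℝ n).smulRight (A n)
      + ((2 * T) • A'.flip n - (4 * T) • A + b'))
    (hq' : ∀ z, q' z = ⟪A' z n, n⟫_ℝ - 4 * ⟪A n, z⟫_ℝ)
    (hQ' : ∀ z, Q' z = (2 * μ * T ^ 2 * q + μ * T * ⟪b, n⟫_ℝ) * ⟪n, z⟫_ℝ
      + (T ^ 2 * q' z + T * ⟪b' z, n⟫_ℝ - 2 * T * ⟪b, z⟫_ℝ - c' z))
    (hρ' : ∀ z, ρ' z = 2 * μ ^ 2 * T * q * ⟪n, z⟫_ℝ + 2 * μ * T * q' z)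
    (heq : tr (A.comp H) = ⟪X, p⟫_ℝ - Q * w + (μ * T * q - 2 * T * tr A) * w - g) :
    θ ^ 2 * μ * (T * ‖p‖ ^ 2 + T ^ 3 * w ^ 2) - 6 * g ^ 2 ≤
      2 * (⟪X, p⟫_ℝ + ρ * w) * (tr (A.comp H) + tr (A'.flip p) + Q * w)
        - 2 * ρ * Q * w ^ 2 + 2 * ⟪X' (A p), p⟫_ℝ
        + (2 * ρ - tr X') * ⟪A p, p⟫_ℝ - ⟪A' X p, p⟫_ℝ
        + (Q' X + Q * tr X') * w ^ 2 + 2 * w * ρ' (A p) := by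
  set N : ℝ := d + 1 with hN
  have hN1 : 1 ≤ N := by simp [hN]
  have hTμ : μ ≤ T := (le_self_pow₀ hμ two_ne_zero).trans hT
  have hT1 : 1 ≤ T := hμ.trans hTμ
  have hT0 : 0 < T := one_pos.trans_le hT1
  have hμ0 : 0 < μ := one_pos.trans_le hμ
  have hM0 : 0 ≤ M := by linarith
  have hbT : ‖b‖ ≤ T := (le_mul_of_one_le_left (norm_nonneg b) hμ).trans hb
  have hbT' : ‖b'‖ ≤ T := (le_mul_of_one_le_left (norm_nonneg b') hμ).trans hb'
  have hcT' : ‖c'‖ ≤ T ^ 2 := (le_mul_of_one_le_left (norm_nonneg c') hμ).trans hc'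
  have hMT : T ≤ M * T := le_mul_of_one_le_left hT0.le hM
  set R : Rn d →L[ℝ] Rn d := (2 * T) • A'.flip n - (4 * T) • A + b' with hR
  have hAp : ∀ x, ‖A x‖ ≤ M * ‖x‖ := fun x => (A.le_opNorm x).trans (by gcongr)
  have hAn : ‖A n‖ ≤ 3 * M := (hAp n).trans
    ((mul_le_mul_of_nonneg_left hn' hM0).trans_eq (mul_comm _ _))
  have hA'z : ∀ z x, ‖A' z x‖ ≤ M * ‖z‖ * ‖x‖ := fun z x =>
    (A'.le_opNorm₂ z x).trans (by gcongr)
  have hRn : ‖R‖ ≤ 11 * M * T := by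
    have h1 : ‖A'.flip n‖ ≤ M * 3 := by
      refine ((A'.flip).le_opNorm n).trans ?_
      rw [ContinuousLinearMap.opNorm_flip]
      gcongr
    calc ‖R‖ ≤ ‖(2 * T) • A'.flip n‖ + ‖(4 * T) • A‖ + ‖b'‖ :=
          (norm_add_le _ _).trans (by gcongr; exact norm_sub_le _ _)
      _ = 2 * T * ‖A'.flip n‖ + 4 * T * ‖A‖ + ‖b'‖ := by
          rw [norm_smul, norm_smul, Real.norm_of_nonneg (by positivity),
            Real.norm_of_nonneg (by positivity)]
      _ ≤ 2 * T * (M * 3) + 4 * T * M + T := by gcongr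
      _ ≤ 11 * M * T := by linarith
  have htrR : |tr R| ≤ 11 * N * M * T := (abs_tr_le R).trans (by
    calc ((d : ℝ) + 1) * ‖R‖ ≤ N * (11 * M * T) := by gcongr
      _ = 11 * N * M * T := by ring)
  have htrX : tr X' = 2 * μ * T * q + tr R := by
    rw [hX', tr_add, tr_smul, tr_smulRight, innerSL_apply_apply, hq, real_inner_comm]
  have hqlo : 4 * θ ≤ q := by
    rw [hq]; refine le_trans ?_ (hell n)
    have : (2 : ℝ) ^ 2 ≤ ‖n‖ ^ 2 := by gcongr
    calc 4 * θ = θ * 2 ^ 2 := by ring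
      _ ≤ θ * ‖n‖ ^ 2 := by gcongr
  have hqhi : q ≤ 9 * M := by
    rw [hq]; refine (real_inner_le_norm _ _).trans ?_
    calc ‖A n‖ * ‖n‖ ≤ 3 * M * 3 := by gcongr
      _ = 9 * M := by ring
  have hq0 : 0 < q := by linarith
  have hXn : ‖X‖ ≤ 7 * M * T := by
    rw [hX]
    calc ‖(2 * T) • A n + b‖ ≤ 2 * T * ‖A n‖ + ‖b‖ := by
          refine (norm_add_le _ _).trans ?_
          rw [norm_smul, Real.norm_of_nonneg (by positivity)]
      _ ≤ 2 * T * (3 * M) + T := by gcongr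
      _ ≤ 7 * M * T := by linarith
  have hq'b : ∀ z, |q' z| ≤ 21 * M * ‖z‖ := fun z => by
    rw [hq']
    calc |⟪A' z n, n⟫_ℝ - 4 * ⟪A n, z⟫_ℝ| ≤ |⟪A' z n, n⟫_ℝ| + 4 * |⟪A n, z⟫_ℝ| := by
          refine (abs_sub _ _).trans ?_
          rw [abs_mul]; norm_num
      _ ≤ M * ‖z‖ * 3 * 3 + 4 * (3 * M * ‖z‖) := by
          gcongr
          · refine (abs_real_inner_le_norm _ _).trans ?_
            gcongr
            exact (hA'z z n).trans (by gcongr)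
          · exact (abs_real_inner_le_norm _ _).trans (by gcongr)
      _ = 21 * M * ‖z‖ := by ring
  -- the quadratic terms in `p`
  have hXAp : ⟪X' (A p), p⟫_ℝ = 2 * μ * T * ⟪A n, p⟫_ℝ ^ 2 + ⟪R (A p), p⟫_ℝ := by
    rw [hX', add_apply, inner_add_left, smul_apply, ContinuousLinearMap.smulRight_apply,
      innerSL_apply_apply, real_inner_smul_left, real_inner_smul_left, ← hAs n p]
    ring
  have hRAp : |⟪R (A p), p⟫_ℝ| ≤ 11 * M ^ 2 * T * ‖p‖ ^ 2 := by
    refine (abs_inner_apply_le R _ _).trans ?_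
    calc ‖R‖ * ‖A p‖ * ‖p‖ ≤ (11 * M * T) * (M * ‖p‖) * ‖p‖ := by gcongr; exact hAp p
      _ = 11 * M ^ 2 * T * ‖p‖ ^ 2 := by ring
  have hA'X : |⟪A' X p, p⟫_ℝ| ≤ 7 * M ^ 2 * T * ‖p‖ ^ 2 := by
    refine (abs_real_inner_le_norm _ _).trans ?_
    calc ‖A' X p‖ * ‖p‖ ≤ (M * (7 * M * T) * ‖p‖) * ‖p‖ := by
          gcongr; exact (hA'z X p).trans (by gcongr)
      _ = 7 * M ^ 2 * T * ‖p‖ ^ 2 := by ring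
  have hApp : ⟪A p, p⟫_ℝ ≤ M * ‖p‖ ^ 2 := by
    refine (real_inner_le_norm _ _).trans ?_
    calc ‖A p‖ * ‖p‖ ≤ (M * ‖p‖) * ‖p‖ := by gcongr; exact hAp p
      _ = M * ‖p‖ ^ 2 := by ring
  have hApp0 : 0 ≤ ⟪A p, p⟫_ℝ := le_trans (by positivity) (hell p)
  -- Choice of ρ: for ρ = r μ T q the leading coefficients of ⟨A p, p⟩ and of w² are (2r - 2) μ T q
  -- and (6 - 2r) μ T³ q². Both are positive for 1 < r < 3, and r = 2 is the midpoint.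
  have hgrad : 8 * θ ^ 2 * μ * T * ‖p‖ ^ 2 - 40 * N * M ^ 2 * T * ‖p‖ ^ 2
      ≤ 2 * ⟪X' (A p), p⟫_ℝ + (2 * ρ - tr X') * ⟪A p, p⟫_ℝ - ⟪A' X p, p⟫_ℝ := by
    have h1 : 4 * θ * (θ * ‖p‖ ^ 2) ≤ q * ⟪A p, p⟫_ℝ :=
      mul_le_mul hqlo (hell p) (by positivity) hq0.le
    have h2 : 2 * μ * T * (4 * θ * (θ * ‖p‖ ^ 2)) ≤ 2 * μ * T * (q * ⟪A p, p⟫_ℝ) := by gcongr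
    have h3 : tr R * ⟪A p, p⟫_ℝ ≤ 11 * N * M * T * (M * ‖p‖ ^ 2) :=
      mul_le_mul ((le_abs_self _).trans htrR) hApp hApp0 (by positivity)
    have h4 : 0 ≤ μ * T * ⟪A n, p⟫_ℝ ^ 2 := by positivity
    have h5 : M ^ 2 * T * ‖p‖ ^ 2 ≤ N * (M ^ 2 * T * ‖p‖ ^ 2) :=
      le_mul_of_one_le_left (by positivity) hN1
    rw [hXAp, htrX, hρ]
    linarith [(abs_le.1 hRAp).1, (abs_le.1 hA'X).2]
  -- the zeroth order terms
  have hbn : |⟪b, n⟫_ℝ| ≤ 3 * ‖b‖ :=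
    (abs_real_inner_le_norm _ _).trans (by rw [mul_comm]; gcongr)
  have hμbn : μ * |⟪b, n⟫_ℝ| ≤ 3 * T := by
    calc μ * |⟪b, n⟫_ℝ| ≤ μ * (3 * ‖b‖) := by gcongr
      _ ≤ 3 * T := by linarith
  have hbnT : |⟪b, n⟫_ℝ| ≤ 3 * T := by linarith
  set e5 := T * ⟪b, n⟫_ℝ - c with he5
  -- The factor μ on the left matters: `e5` gets multiplied by tr X' and ρ, both of order μ T, and
  -- the product must stay of order T³, one factor μ below the main term.
  have hμe5 : μ * |e5| ≤ 4 * T ^ 2 := by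
    have : |e5| ≤ T * |⟪b, n⟫_ℝ| + |c| := by
      refine (abs_sub _ _).trans ?_
      rw [abs_mul, abs_of_pos hT0]
    calc μ * |e5| ≤ μ * (T * |⟪b, n⟫_ℝ| + |c|) := by gcongr
      _ = T * (μ * |⟪b, n⟫_ℝ|) + μ * |c| := by ring
      _ ≤ T * (3 * T) + T ^ 2 := by gcongr
      _ = 4 * T ^ 2 := by ring
  have he5T : |e5| ≤ 4 * T ^ 2 := (le_mul_of_one_le_left (abs_nonneg e5) hμ).trans hμe5
  have hQe : Q = T ^ 2 * q + e5 := by rw [hQ, he5]; ring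
  have hQb : |Q| ≤ 13 * M * T ^ 2 := by
    rw [hQe]
    refine (abs_add_le _ _).trans ?_
    rw [abs_of_pos (by positivity)]
    linarith [mul_le_mul_of_nonneg_left hqhi (sq_nonneg T),
      mul_le_mul_of_nonneg_right hM (sq_nonneg T)]
  set r2 := T ^ 2 * q' X + T * ⟪b' X, n⟫_ℝ - 2 * T * ⟪b, X⟫_ℝ - c' X with hr2
  have hr2b : |r2| ≤ 189 * M ^ 2 * T ^ 3 := by
    have h1 : |⟪b' X, n⟫_ℝ| ≤ T * ‖X‖ * 3 := (abs_inner_apply_le b' X n).trans (by gcongr)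
    have h2 : |⟪b, X⟫_ℝ| ≤ T * ‖X‖ := (abs_real_inner_le_norm _ _).trans (by gcongr)
    have h3 : |c' X| ≤ T ^ 2 * ‖X‖ := (c'.le_opNorm X).trans (by gcongr)
    have h4 : |r2| ≤ T ^ 2 * |q' X| + T * |⟪b' X, n⟫_ℝ| + 2 * T * |⟪b, X⟫_ℝ| + |c' X| := by
      refine (abs_sub _ _).trans (add_le_add_left ((abs_sub _ _).trans
        (add_le_add ((abs_add_le _ _).trans (add_le_add ?_ ?_)) ?_)) _)
      · rw [abs_mul, abs_of_pos (by positivity)]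
      · rw [abs_mul, abs_of_pos (by positivity)]
      · rw [abs_mul, abs_of_pos (by positivity)]
    calc |r2| ≤ T ^ 2 * (21 * M * ‖X‖) + T * (T * ‖X‖ * 3) + 2 * T * (T * ‖X‖) + T ^ 2 * ‖X‖ := by
          refine h4.trans ?_
          gcongr
          exact hq'b X
      _ = (21 * M + 6) * T ^ 2 * ‖X‖ := by ring
      _ ≤ (21 * M + 6 * M) * T ^ 2 * (7 * M * T) := by gcongr; linarith
      _ = 189 * M ^ 2 * T ^ 3 := by ring
  have hnX : ⟪n, X⟫_ℝ = 2 * T * q + ⟪b, n⟫_ℝ := by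
    rw [hX, inner_add_right, inner_smul_right, hq, real_inner_comm n (A n), real_inner_comm b n]
  have hQX : Q' X = 4 * μ * T ^ 3 * q ^ 2
      + (4 * T ^ 2 * q * (μ * ⟪b, n⟫_ℝ) + T * ⟪b, n⟫_ℝ * (μ * ⟪b, n⟫_ℝ) + r2) := by
    rw [hQ', hnX]; ring
  have hμbn' : |μ * ⟪b, n⟫_ℝ| ≤ 3 * T := by rwa [abs_mul, abs_of_pos hμ0]
  have he4 : |4 * T ^ 2 * q * (μ * ⟪b, n⟫_ℝ) + T * ⟪b, n⟫_ℝ * (μ * ⟪b, n⟫_ℝ) + r2|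
      ≤ 306 * M ^ 2 * T ^ 3 := by
    have h1 : |4 * T ^ 2 * q * (μ * ⟪b, n⟫_ℝ)| ≤ 4 * T ^ 2 * (9 * M) * (3 * T) := by
      rw [abs_mul, abs_of_pos (show 0 < 4 * T ^ 2 * q by positivity)]; gcongr
    have h2 : |T * ⟪b, n⟫_ℝ * (μ * ⟪b, n⟫_ℝ)| ≤ T * (3 * T) * (3 * T) := by
      rw [abs_mul, abs_mul, abs_of_pos hT0]; gcongr
    have h3 := (abs_add_three (4 * T ^ 2 * q * (μ * ⟪b, n⟫_ℝ))
      (T * ⟪b, n⟫_ℝ * (μ * ⟪b, n⟫_ℝ)) r2)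
    have h4 : M * T ^ 3 ≤ M ^ 2 * T ^ 3 := by gcongr; exact le_self_pow₀ hM two_ne_zero
    have h5 : T ^ 3 ≤ M ^ 2 * T ^ 3 := le_mul_of_one_le_left (by positivity) (one_le_pow₀ hM)
    linarith
  have hzero : 32 * θ ^ 2 * μ * T ^ 3 * w ^ 2 - 521 * N * M ^ 2 * T ^ 3 * w ^ 2
      ≤ (Q' X + Q * tr X') * w ^ 2 - 2 * ρ * Q * w ^ 2 := by
    have h1 : (4 * θ) ^ 2 ≤ q ^ 2 := by gcongr
    have h2 : 2 * μ * T ^ 3 * (4 * θ) ^ 2 ≤ 2 * μ * T ^ 3 * q ^ 2 := by gcongr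
    have h3 : |2 * T * q * (μ * e5)| ≤ 2 * T * (9 * M) * (4 * T ^ 2) := by
      rw [abs_mul, abs_of_pos (show 0 < 2 * T * q by positivity), abs_mul, abs_of_pos hμ0]
      gcongr
    have h4 : |Q * tr R| ≤ 13 * M * T ^ 2 * (11 * N * M * T) := by
      rw [abs_mul]; gcongr
    have h5 : M * T ^ 3 ≤ M ^ 2 * T ^ 3 := by gcongr; exact le_self_pow₀ hM two_ne_zero
    have h6 : M ^ 2 * T ^ 3 ≤ N * (M ^ 2 * T ^ 3) := le_mul_of_one_le_left (by positivity) hN1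
    have key : 32 * θ ^ 2 * μ * T ^ 3 - 521 * N * M ^ 2 * T ^ 3 ≤ Q' X + Q * tr X' - 2 * ρ * Q := by
      have : Q' X + Q * tr X' - 2 * ρ * Q = 2 * μ * T ^ 3 * q ^ 2
          + (4 * T ^ 2 * q * (μ * ⟪b, n⟫_ℝ) + T * ⟪b, n⟫_ℝ * (μ * ⟪b, n⟫_ℝ) + r2)
          - 2 * T * q * (μ * e5) + Q * tr R := by
        rw [hQX, htrX, hρ]
        linear_combination (-2 * μ * T * q) * hQe
      rw [this]
      linarith [(abs_le.1 he4).1, (abs_le.1 h3).2, (abs_le.1 h4).1]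
    linarith [mul_le_mul_of_nonneg_right key (sq_nonneg w)]
  -- the mixed term
  have hmix : - (96 * M ^ 2 * (T * ‖p‖ ^ 2 + T ^ 3 * w ^ 2)) ≤ 2 * w * ρ' (A p) := by
    have h1 : |ρ' (A p)| ≤ 96 * M ^ 2 * μ ^ 2 * T * ‖p‖ := by
      have hin : |⟪n, A p⟫_ℝ| ≤ 3 * (M * ‖p‖) :=
        (abs_real_inner_le_norm _ _).trans (by gcongr; exact hAp p)
      have hqq : |q' (A p)| ≤ 21 * M * (M * ‖p‖) := (hq'b _).trans (by gcongr; exact hAp p)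
      rw [hρ']
      calc |2 * μ ^ 2 * T * q * ⟪n, A p⟫_ℝ + 2 * μ * T * q' (A p)|
          ≤ 2 * μ ^ 2 * T * q * |⟪n, A p⟫_ℝ| + 2 * μ * T * |q' (A p)| := by
            refine (abs_add_le _ _).trans ?_
            rw [abs_mul (2 * μ ^ 2 * T * q), abs_mul (2 * μ * T),
              abs_of_pos (show 0 < 2 * μ ^ 2 * T * q by positivity),
              abs_of_pos (show 0 < 2 * μ * T by positivity)]
        _ ≤ 2 * μ ^ 2 * T * (9 * M) * (3 * (M * ‖p‖)) + 2 * μ ^ 2 * T * (21 * M * (M * ‖p‖)) := by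
            have : μ ≤ μ ^ 2 := le_self_pow₀ hμ two_ne_zero
            gcongr
        _ = 96 * M ^ 2 * μ ^ 2 * T * ‖p‖ := by ring
    have h2 : |w| * |ρ' (A p)| ≤ |w| * (96 * M ^ 2 * μ ^ 2 * T * ‖p‖) := by gcongr
    have h3 : 2 * (μ ^ 2 * |w|) * ‖p‖ ≤ μ ^ 4 * w ^ 2 + ‖p‖ ^ 2 := by
      have := two_mul_le_add_sq (μ ^ 2 * |w|) ‖p‖
      have h : (μ ^ 2 * |w|) ^ 2 = μ ^ 4 * w ^ 2 := by rw [mul_pow, sq_abs]; ring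
      linarith
    have h4 : μ ^ 4 * w ^ 2 ≤ T ^ 2 * w ^ 2 := by
      have : μ ^ 4 ≤ T ^ 2 := by
        calc μ ^ 4 = (μ ^ 2) ^ 2 := by ring
          _ ≤ T ^ 2 := by gcongr
      gcongr
    have h5 : 96 * M ^ 2 * T * (2 * (μ ^ 2 * |w|) * ‖p‖)
        ≤ 96 * M ^ 2 * T * (T ^ 2 * w ^ 2 + ‖p‖ ^ 2) := by gcongr; linarith
    have h6 : -(|w| * |ρ' (A p)|) ≤ w * ρ' (A p) := by
      rw [← abs_mul]; exact neg_abs_le _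
    linarith
  -- the equation
  set k1 := μ * T * q - 2 * T * tr A with hk1
  set k2 := tr (A'.flip p) with hk2
  have htrA : |tr A| ≤ N * M := (abs_tr_le A).trans (by gcongr)
  have hk1b : |k1| ≤ 11 * N * M * μ * T := by
    calc |k1| ≤ μ * T * q + 2 * T * |tr A| := by
          refine (abs_sub _ _).trans ?_
          rw [abs_of_pos (show 0 < μ * T * q by positivity), abs_mul,
            abs_of_pos (show 0 < 2 * T by positivity)]
      _ ≤ μ * T * (9 * M) + 2 * T * (N * M) := by gcongr
      _ ≤ N * (μ * T * (9 * M)) + 2 * T * (N * M) * μ := by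
          exact add_le_add (le_mul_of_one_le_left (by positivity) hN1)
            (le_mul_of_one_le_right (by positivity) hμ)
      _ = 11 * N * M * μ * T := by ring
  have hk2b : |k2| ≤ N * M * ‖p‖ := by
    refine (abs_tr_le _).trans ?_
    have : ‖A'.flip p‖ ≤ M * ‖p‖ := by
      refine ((A'.flip).le_opNorm p).trans ?_
      rw [ContinuousLinearMap.opNorm_flip]
      gcongr
    calc ((d : ℝ) + 1) * ‖A'.flip p‖ ≤ N * (M * ‖p‖) := by gcongr
      _ = N * M * ‖p‖ := by ring
  have hk1sq : k1 ^ 2 ≤ 121 * N ^ 2 * M ^ 2 * T ^ 3 := by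
    calc k1 ^ 2 = |k1| ^ 2 := (sq_abs _).symm
      _ ≤ (11 * N * M * μ * T) ^ 2 := by gcongr
      _ = 121 * N ^ 2 * M ^ 2 * T ^ 2 * μ ^ 2 := by ring
      _ ≤ 121 * N ^ 2 * M ^ 2 * T ^ 2 * T := by gcongr
      _ = 121 * N ^ 2 * M ^ 2 * T ^ 3 := by ring
  have hk2sq : k2 ^ 2 ≤ N ^ 2 * M ^ 2 * T * ‖p‖ ^ 2 := by
    calc k2 ^ 2 = |k2| ^ 2 := (sq_abs _).symm
      _ ≤ (N * M * ‖p‖) ^ 2 := by gcongr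
      _ = N ^ 2 * M ^ 2 * 1 * ‖p‖ ^ 2 := by ring
      _ ≤ N ^ 2 * M ^ 2 * T * ‖p‖ ^ 2 := by gcongr
  have hρsq : ρ ^ 2 ≤ 324 * M ^ 2 * T ^ 3 := by
    calc ρ ^ 2 ≤ (2 * μ * T * (9 * M)) ^ 2 := by rw [hρ]; gcongr
      _ = 324 * M ^ 2 * T ^ 2 * μ ^ 2 := by ring
      _ ≤ 324 * M ^ 2 * T ^ 2 * T := by gcongr
      _ = 324 * M ^ 2 * T ^ 3 := by ring
  -- The conjugated equation contains the same first order term s = ⟨X, p⟩ as the multiplier, with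
  -- the same sign, so the product is 2(s + ρw)(s - f). Adding 2f² + 2(ρw)² makes it a sum of three
  -- squares.
  have heqn : -(6 * g ^ 2) - 726 * N ^ 2 * M ^ 2 * T ^ 3 * w ^ 2 - 6 * N ^ 2 * M ^ 2 * T * ‖p‖ ^ 2
      - 648 * M ^ 2 * T ^ 3 * w ^ 2
      ≤ 2 * (⟪X, p⟫_ℝ + ρ * w) * (tr (A.comp H) + k2 + Q * w) := by
    set s := ⟪X, p⟫_ℝ
    have hs : tr (A.comp H) + k2 + Q * w = s - (g - k1 * w - k2) := by rw [heq]; ring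
    rw [hs]
    have h1 : (g - k1 * w - k2) ^ 2 ≤ 3 * (g ^ 2 + k1 ^ 2 * w ^ 2 + k2 ^ 2) := by
      linarith [sq_nonneg (g + k1 * w), sq_nonneg (g + k2), sq_nonneg (k1 * w - k2)]
    have h2 : -2 * (g - k1 * w - k2) ^ 2 - 2 * (ρ * w) ^ 2
        ≤ 2 * (s + ρ * w) * (s - (g - k1 * w - k2)) := by
      generalize g - k1 * w - k2 = f
      linarith [sq_nonneg (s - f), sq_nonneg (s + ρ * w), sq_nonneg (f - ρ * w)]
    have h3 : k1 ^ 2 * w ^ 2 ≤ 121 * N ^ 2 * M ^ 2 * T ^ 3 * w ^ 2 := by gcongr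
    have h4 : (ρ * w) ^ 2 ≤ 324 * M ^ 2 * T ^ 3 * w ^ 2 := by rw [mul_pow]; gcongr
    linarith
  -- Where 2000 comes from: the errors add up to at most 40 + 96 + 6 = 142 in the gradient and 521 +
  -- 96 + 726 + 648 = 1991 in the zeroth order part, in units of N² M².
  have hfin1 : 2000 * N ^ 2 * M ^ 2 * (T * ‖p‖ ^ 2) ≤ θ ^ 2 * μ * (T * ‖p‖ ^ 2) := by gcongr
  have hfin2 : 2000 * N ^ 2 * M ^ 2 * (T ^ 3 * w ^ 2) ≤ θ ^ 2 * μ * (T ^ 3 * w ^ 2) := by gcongr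
  have hNN : N ≤ N ^ 2 := le_self_pow₀ hN1 two_ne_zero
  have hN2 : 1 ≤ N ^ 2 := one_le_pow₀ hN1
  have a1 : N * (M ^ 2 * (T * ‖p‖ ^ 2)) ≤ N ^ 2 * (M ^ 2 * (T * ‖p‖ ^ 2)) := by gcongr
  have a2 : M ^ 2 * (T * ‖p‖ ^ 2) ≤ N ^ 2 * (M ^ 2 * (T * ‖p‖ ^ 2)) :=
    le_mul_of_one_le_left (by positivity) hN2
  have a3 : N * (M ^ 2 * (T ^ 3 * w ^ 2)) ≤ N ^ 2 * (M ^ 2 * (T ^ 3 * w ^ 2)) := by gcongr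
  have a4 : M ^ 2 * (T ^ 3 * w ^ 2) ≤ N ^ 2 * (M ^ 2 * (T ^ 3 * w ^ 2)) :=
    le_mul_of_one_le_left (by positivity) hN2
  have a5 : 0 ≤ N ^ 2 * (M ^ 2 * (T * ‖p‖ ^ 2)) := by positivity
  have a6 : 0 ≤ N ^ 2 * (M ^ 2 * (T ^ 3 * w ^ 2)) := by positivity
  linarith

/-! ### Gradient, Hessian and product rules for the operator. -/

section calculus

variable {d : ℕ}

lemma ContDiff.hasFDerivAt_innerSL_gradient {u : Rn d → ℝ} (hu : ContDiff ℝ 1 u) (y : Rn d) :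
    HasFDerivAt u (innerSL ℝ (gradient u y)) y :=
  (hu.differentiable one_ne_zero y).hasGradientAt.hasFDerivAt

lemma gradient_eq_of_hasFDerivAt {u : Rn d → ℝ} {y v : Rn d}
    (h : HasFDerivAt u (innerSL ℝ v) y) : gradient u y = v :=
  HasGradientAt.gradient (hasGradientAt_iff_hasFDerivAt.2 h)

lemma norm_gradient (u : Rn d → ℝ) (y : Rn d) : ‖gradient u y‖ = ‖fderiv ℝ u y‖ := by
  simp [gradient]

lemma ContDiff.gradient_contDiff {u : Rn d → ℝ} {m n : WithTop ℕ∞} (hu : ContDiff ℝ n u)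
    (hmn : m + 1 ≤ n) : ContDiff ℝ m (gradient u) :=
  (InnerProductSpace.toDual ℝ (Rn d)).symm.contDiff.comp (hu.fderiv_right hmn)

/-- The Hessian, as an endomorphism. -/
noncomputable def hess (u : Rn d → ℝ) (y : Rn d) : Rn d →L[ℝ] Rn d := fderiv ℝ (gradient u) y

lemma ContDiff.hasFDerivAt_gradient {u : Rn d → ℝ} (hu : ContDiff ℝ 2 u) (y : Rn d) :
    HasFDerivAt (gradient u) (hess u y) y :=
  ((hu.gradient_contDiff (m := 1) (by norm_num)).differentiable one_ne_zero y).hasFDerivAt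

lemma inner_hess (u : Rn d → ℝ) (y x z : Rn d) :
    ⟪hess u y x, z⟫_ℝ = fderiv ℝ (fderiv ℝ u) y x z := by
  have h : gradient u = (InnerProductSpace.toDual ℝ (Rn d)).symm ∘ fderiv ℝ u := rfl
  rw [hess, h, LinearIsometryEquiv.comp_fderiv]
  exact InnerProductSpace.toDual_symm_apply

lemma hess_symm {u : Rn d → ℝ} (hu : ContDiff ℝ 2 u) (y x z : Rn d) :
    ⟪hess u y x, z⟫_ℝ = ⟪x, hess u y z⟫_ℝ := by
  rw [inner_hess, real_inner_comm, inner_hess]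
  exact (hu.contDiffAt.isSymmSndFDerivAt (by simp)).eq x z

/-- The operator `-tr (A D²u) + b · ∇u + c u`. -/
noncomputable def opL (A : Rn d → Rn d →L[ℝ] Rn d) (b : Rn d → Rn d) (c u : Rn d → ℝ) : Rn d → ℝ :=
  fun y => -tr ((A y).comp (hess u y)) + ⟪b y, gradient u y⟫_ℝ + c y * u y

lemma gradient_mul {f g : Rn d → ℝ} (hf : ContDiff ℝ 1 f) (hg : ContDiff ℝ 1 g) (y : Rn d) :
    gradient (fun x => f x * g x) y = f y • gradient g y + g y • gradient f y := by
  apply gradient_eq_of_hasFDerivAt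
  refine ((hf.hasFDerivAt_innerSL_gradient y).mul (hg.hasFDerivAt_innerSL_gradient y)).congr_fderiv
    ?_
  simp

lemma tr_comp_smulRight (A : Rn d →L[ℝ] Rn d) (x z : Rn d) :
    tr (A.comp ((innerSL ℝ x).smulRight z)) = ⟪x, A z⟫_ℝ := by
  have : A.comp ((innerSL ℝ x).smulRight z) = (innerSL ℝ x).smulRight (A z) := by
    ext v; simp
  rw [this, tr_smulRight, innerSL_apply_apply]

lemma tr_comp_hess_mul {f g : Rn d → ℝ} (hf : ContDiff ℝ 2 f) (hg : ContDiff ℝ 2 g) (y : Rn d)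
    {A : Rn d →L[ℝ] Rn d} (hA : ∀ x z, ⟪A x, z⟫_ℝ = ⟪x, A z⟫_ℝ) :
    tr (A.comp (hess (fun x => f x * g x) y)) = f y * tr (A.comp (hess g y))
      + g y * tr (A.comp (hess f y)) + 2 * ⟪A (gradient f y), gradient g y⟫_ℝ := by
  have hf1 : ContDiff ℝ 1 f := hf.of_le (by norm_num)
  have hg1 : ContDiff ℝ 1 g := hg.of_le (by norm_num)
  have e : gradient (fun x => f x * g x) = f • gradient g + g • gradient f :=
    funext (gradient_mul hf1 hg1)
  have h := ((hf1.hasFDerivAt_innerSL_gradient y).smul (hg.hasFDerivAt_gradient y)).add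
    ((hg1.hasFDerivAt_innerSL_gradient y).smul (hf.hasFDerivAt_gradient y))
  rw [hess, e, HasFDerivAt.fderiv h]
  simp only [ContinuousLinearMap.comp_add, ContinuousLinearMap.comp_smul, tr_add, tr_smul,
    tr_comp_smulRight]
  rw [← hA (gradient f y), real_inner_comm (A (gradient f y)) (gradient g y)]
  ring

end calculus

/-! ### The phase, the local frequency and the weight. -/

section weight

variable {d : ℕ}

/-- The phase `-(|y|² + 2 y_n)`. -/
noncomputable def phase (y : Rn d) : ℝ := -(‖y‖ ^ 2 + 2 * ⟪eN d, y⟫_ℝ)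

/-- The gradient of the phase. -/
noncomputable def phaseGrad (y : Rn d) : Rn d := (-2 : ℝ) • (y + eN d)

/-- The local frequency `τ μ e^{μψ}`. -/
noncomputable def freq (μ τ : ℝ) (y : Rn d) : ℝ := τ * μ * Real.exp (μ * phase y)

/-- The Carleman weight `exp (τ e^{μψ})`. -/
noncomputable def weight (μ τ : ℝ) (y : Rn d) : ℝ := Real.exp (τ * Real.exp (μ * phase y))

lemma contDiff_phase {n : WithTop ℕ∞} : ContDiff ℝ n (phase (d := d)) := by
  unfold phase
  exact ((contDiff_norm_sq ℝ).add (contDiff_const.mul (contDiff_const.inner ℝ contDiff_id))).neg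

lemma contDiff_freq {n : WithTop ℕ∞} (μ τ : ℝ) : ContDiff ℝ n (freq (d := d) μ τ) := by
  unfold freq
  have := contDiff_phase (d := d) (n := n)
  fun_prop

lemma contDiff_weight {n : WithTop ℕ∞} (μ τ : ℝ) : ContDiff ℝ n (weight (d := d) μ τ) := by
  unfold weight
  have := contDiff_phase (d := d) (n := n)
  fun_prop

lemma contDiff_phaseGrad {n : WithTop ℕ∞} : ContDiff ℝ n (phaseGrad (d := d)) := by
  unfold phaseGrad
  fun_prop

lemma hasFDerivAt_phaseGrad (y : Rn d) :
    HasFDerivAt phaseGrad ((-2 : ℝ) • ContinuousLinearMap.id ℝ (Rn d)) y :=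
  ((hasFDerivAt_id y).add_const (eN d)).const_smul (-2 : ℝ)

lemma hasFDerivAt_phase (y : Rn d) : HasFDerivAt phase (innerSL ℝ (phaseGrad y)) y := by
  have h := (((hasStrictFDerivAt_norm_sq y).hasFDerivAt).add
    (((innerSL ℝ (eN d)).hasFDerivAt (x := y)).const_mul (2 : ℝ))).neg
  refine h.congr_fderiv ?_
  ext z
  simp [phaseGrad]
  ring

lemma hasFDerivAt_freq (μ τ : ℝ) (y : Rn d) :
    HasFDerivAt (freq μ τ) ((μ * freq μ τ y) • innerSL ℝ (phaseGrad y)) y := by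
  refine ((((hasFDerivAt_phase y).const_mul μ).exp).const_mul (τ * μ)).congr_fderiv ?_
  ext z
  simp [freq]
  ring

lemma hasFDerivAt_weight (μ τ : ℝ) (y : Rn d) :
    HasFDerivAt (weight μ τ) ((freq μ τ y * weight μ τ y) • innerSL ℝ (phaseGrad y)) y := by
  refine ((((hasFDerivAt_phase y).const_mul μ).exp).const_mul τ).exp.congr_fderiv ?_
  ext z
  simp [freq, weight]
  ring

lemma gradient_weight (μ τ : ℝ) (y : Rn d) :
    gradient (weight μ τ) y = (freq μ τ y * weight μ τ y) • phaseGrad y := by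
  apply gradient_eq_of_hasFDerivAt
  simpa using hasFDerivAt_weight μ τ y

/-- With n = ∇ψ, W the weight and T the frequency, one has ∇W = T W n, ∇T = μ T n and Dn = -2, hence
D²W = W ((μT + T²) n ⊗ n - 2T). -/
lemma tr_comp_hess_weight (μ τ : ℝ) (y : Rn d) {A : Rn d →L[ℝ] Rn d} :
    tr (A.comp (hess (weight μ τ) y)) = weight μ τ y
      * ((μ * freq μ τ y + freq μ τ y ^ 2) * ⟪A (phaseGrad y), phaseGrad y⟫_ℝ
        - 2 * freq μ τ y * tr A) := by
  have e : gradient (weight (d := d) μ τ) 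
      = (freq (d := d) μ τ * weight (d := d) μ τ) • (phaseGrad (d := d)) :=
    funext fun y => gradient_weight μ τ y
  have h := ((hasFDerivAt_freq μ τ y).mul (hasFDerivAt_weight μ τ y)).smul
    (hasFDerivAt_phaseGrad y)
  have h2 : hess (weight μ τ) y = (-2 * freq μ τ y * weight μ τ y) • ContinuousLinearMap.id ℝ (Rn d)
      + (weight μ τ y * (μ * freq μ τ y + freq μ τ y ^ 2)) •
        (innerSL ℝ (phaseGrad y)).smulRight (phaseGrad y) := by
    rw [hess, e, HasFDerivAt.fderiv h]
    ext z i
    simp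
    ring
  rw [h2]
  simp only [ContinuousLinearMap.comp_add, ContinuousLinearMap.comp_smul, tr_add, tr_smul,
    tr_comp_smulRight, ContinuousLinearMap.comp_id,
    real_inner_comm (A (phaseGrad y)) (phaseGrad y)]
  ring

lemma phase_eq (y : Rn d) : phase y = -(‖y‖ ^ 2 + 2 * y (Fin.last d)) := by
  simp [phase, eN, EuclideanSpace.inner_single_left]

lemma norm_phaseGrad_le {y : Rn d} (h : ‖y‖ ≤ 1 / 3) : ‖phaseGrad y‖ ≤ 3 := by
  rw [phaseGrad, norm_smul]
  have : ‖y + eN d‖ ≤ 1 / 3 + 1 := (norm_add_le _ _).trans (by gcongr; simp [eN])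
  norm_num
  linarith

/-- The pole -e_n of the phase is at distance at least 1 from the half space, so the phase has no
critical point there. -/
lemma le_norm_phaseGrad {y : Rn d} (h : 0 ≤ y (Fin.last d)) : 2 ≤ ‖phaseGrad y‖ := by
  rw [phaseGrad, norm_smul]
  have h1 : ‖(y + eN d) (Fin.last d)‖ ≤ ‖y + eN d‖ := PiLp.norm_apply_le _ _
  have h2 : ‖(y + eN d) (Fin.last d)‖ = y (Fin.last d) + 1 := by
    simp [eN, Real.norm_eq_abs]
    linarith
  norm_num
  linarith

end weight

/-! ### The Carleman estimate with boundary terms. -/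

/-- The closed half ball `{|y| ≤ r, y_n ≥ 0}`. -/
def closedHalfBall (d : ℕ) (r : ℝ) : Set (Rn d) := {y | ‖y‖ ≤ r ∧ 0 ≤ y (Fin.last d)}

section carleman

variable {d : ℕ}

/-- The quadratic form `⟨A n, n⟩` on the gradient of the phase. -/
noncomputable def phaseForm (A : Rn d → Rn d →L[ℝ] Rn d) (y : Rn d) : ℝ :=
  ⟪A y (phaseGrad y), phaseGrad y⟫_ℝ

/-- The vector field of the multiplier. -/
noncomputable def carlemanField (μ τ : ℝ) (A : Rn d → Rn d →L[ℝ] Rn d) (b : Rn d → Rn d) (y : Rn d) :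
    Rn d := (2 * freq μ τ y) • A y (phaseGrad y) + b y

/-- The potential of the conjugated operator. -/
noncomputable def carlemanPot (μ τ : ℝ) (A : Rn d → Rn d →L[ℝ] Rn d) (b : Rn d → Rn d)
    (c : Rn d → ℝ) (y : Rn d) : ℝ :=
  freq μ τ y ^ 2 * phaseForm A y + freq μ τ y * ⟪b y, phaseGrad y⟫_ℝ - c y

/-- The zeroth order part of the multiplier. -/
noncomputable def carlemanMult (μ τ : ℝ) (A : Rn d → Rn d →L[ℝ] Rn d) (y : Rn d) : ℝ :=
  2 * μ * freq μ τ y * phaseForm A y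

variable {A : Rn d → Rn d →L[ℝ] Rn d} {b : Rn d → Rn d} {c v : Rn d → ℝ} {μ τ : ℝ}

lemma contDiff_phaseForm (hA : ContDiff ℝ 1 A) : ContDiff ℝ 1 (phaseForm A) :=
  (hA.clm_apply contDiff_phaseGrad).inner ℝ contDiff_phaseGrad

lemma contDiff_carlemanField (hA : ContDiff ℝ 1 A) (hb : ContDiff ℝ 1 b) :
    ContDiff ℝ 1 (carlemanField μ τ A b) :=
  ((contDiff_const.mul (contDiff_freq μ τ)).smul (hA.clm_apply contDiff_phaseGrad)).add hb

lemma contDiff_carlemanPot (hA : ContDiff ℝ 1 A) (hb : ContDiff ℝ 1 b) (hc : ContDiff ℝ 1 c) :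
    ContDiff ℝ 1 (carlemanPot μ τ A b c) :=
  ((((contDiff_freq μ τ).pow 2).mul (contDiff_phaseForm hA)).add
    ((contDiff_freq μ τ).mul (hb.inner ℝ contDiff_phaseGrad))).sub hc

lemma contDiff_carlemanMult (hA : ContDiff ℝ 1 A) : ContDiff ℝ 1 (carlemanMult μ τ A) :=
  (contDiff_const.mul (contDiff_freq μ τ)).mul (contDiff_phaseForm hA)

lemma hasFDerivAt_carlemanField {y : Rn d} {A' : Rn d →L[ℝ] Rn d →L[ℝ] Rn d}
    {b' : Rn d →L[ℝ] Rn d} (hA : HasFDerivAt A A' y) (hb : HasFDerivAt b b' y) :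
    HasFDerivAt (carlemanField μ τ A b)
      ((2 * μ * freq μ τ y) • (innerSL ℝ (phaseGrad y)).smulRight (A y (phaseGrad y))
        + ((2 * freq μ τ y) • A'.flip (phaseGrad y) - (4 * freq μ τ y) • A y + b')) y := by
  refine ((((hasFDerivAt_freq μ τ y).const_mul 2).smul
    (hA.clm_apply (hasFDerivAt_phaseGrad y))).add hb).congr_fderiv ?_
  ext z i
  simp
  ring

lemma hasFDerivAt_phaseForm {y : Rn d} {A' : Rn d →L[ℝ] Rn d →L[ℝ] Rn d}
    (hAs : ∀ x z, ⟪A y x, z⟫_ℝ = ⟪x, A y z⟫_ℝ) (hA : HasFDerivAt A A' y) :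
    ∃ q' : Rn d →L[ℝ] ℝ, HasFDerivAt (phaseForm A) q' y ∧ ∀ z, q' z
      = ⟪A' z (phaseGrad y), phaseGrad y⟫_ℝ - 4 * ⟪A y (phaseGrad y), z⟫_ℝ := by
  refine ⟨_, (hA.clm_apply (hasFDerivAt_phaseGrad y)).inner ℝ (hasFDerivAt_phaseGrad y), ?_⟩
  intro z
  have h : ⟪A y z, phaseGrad y⟫_ℝ = ⟪A y (phaseGrad y), z⟫_ℝ := by rw [hAs, real_inner_comm]
  simp [two_smul, inner_add_left, inner_add_right, h]
  ring

lemma hasFDerivAt_carlemanPot {y : Rn d} {b' : Rn d →L[ℝ] Rn d} {c' q' : Rn d →L[ℝ] ℝ}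
    (hb : HasFDerivAt b b' y) (hc : HasFDerivAt c c' y) (hq : HasFDerivAt (phaseForm A) q' y) :
    ∃ Q' : Rn d →L[ℝ] ℝ, HasFDerivAt (carlemanPot μ τ A b c) Q' y ∧ ∀ z, Q' z
      = (2 * μ * freq μ τ y ^ 2 * phaseForm A y + μ * freq μ τ y * ⟪b y, phaseGrad y⟫_ℝ)
          * ⟪phaseGrad y, z⟫_ℝ
        + (freq μ τ y ^ 2 * q' z + freq μ τ y * ⟪b' z, phaseGrad y⟫_ℝ
          - 2 * freq μ τ y * ⟪b y, z⟫_ℝ - c' z) := by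
  refine ⟨_, ((((hasFDerivAt_freq μ τ y).pow 2).mul hq).add
    ((hasFDerivAt_freq μ τ y).mul (hb.inner ℝ (hasFDerivAt_phaseGrad y)))).sub hc, ?_⟩
  intro z
  simp [inner_smul_right]
  ring

lemma hasFDerivAt_carlemanMult {y : Rn d} {q' : Rn d →L[ℝ] ℝ}
    (hq : HasFDerivAt (phaseForm A) q' y) :
    ∃ ρ' : Rn d →L[ℝ] ℝ, HasFDerivAt (carlemanMult μ τ A) ρ' y ∧ ∀ z, ρ' z
      = 2 * μ ^ 2 * freq μ τ y * phaseForm A y * ⟪phaseGrad y, z⟫_ℝ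
        + 2 * μ * freq μ τ y * q' z := by
  refine ⟨_, ((hasFDerivAt_freq μ τ y).const_mul (2 * μ)).mul hq, ?_⟩
  intro z
  simp
  ring

/-- The equation satisfied by the conjugated function `e^{τφ} v`. -/
lemma tr_comp_hess_weight_mul (hv : ContDiff ℝ 2 v) (y : Rn d)
    (hAs : ∀ x z, ⟪A y x, z⟫_ℝ = ⟪x, A y z⟫_ℝ) :
    tr ((A y).comp (hess (fun x => weight μ τ x * v x) y))
      = ⟪carlemanField μ τ A b y, gradient (fun x => weight μ τ x * v x) y⟫_ℝ
        - carlemanPot μ τ A b c y * (weight μ τ y * v y)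
        + (μ * freq μ τ y * phaseForm A y - 2 * freq μ τ y * tr (A y)) * (weight μ τ y * v y)
        - weight μ τ y * opL A b c v y := by
  rw [tr_comp_hess_mul (contDiff_weight μ τ) hv y hAs,
    gradient_mul (contDiff_weight μ τ) (hv.of_le (by norm_num)), tr_comp_hess_weight,
    gradient_weight]
  simp only [carlemanField, carlemanPot, opL, phaseForm, map_smul, inner_add_left, inner_add_right,
    real_inner_smul_left, real_inner_smul_right]
  ring

/-- Bounds on the coefficients relative to the local frequency at a point. -/
structure CarlemanBounds (θ M μ T : ℝ) (A : Rn d → Rn d →L[ℝ] Rn d) (b : Rn d → Rn d)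
    (c : Rn d → ℝ) (y : Rn d) : Prop where
  freq_le : μ ^ 2 ≤ T
  normA : ‖A y‖ ≤ M
  normA' : ‖fderiv ℝ A y‖ ≤ M
  symm : ∀ x z, ⟪A y x, z⟫_ℝ = ⟪x, A y z⟫_ℝ
  ell : ∀ x, θ * ‖x‖ ^ 2 ≤ ⟪A y x, x⟫_ℝ
  normb : μ * ‖b y‖ ≤ T
  normb' : μ * ‖fderiv ℝ b y‖ ≤ T
  normc : μ * |c y| ≤ T ^ 2
  normc' : μ * ‖fderiv ℝ c y‖ ≤ T ^ 2

/-- Meant for the flat face, where the flux is the boundary integrand. It has no sign there, so it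
is estimated by its size, and the full gradient of w appears as data. -/
lemma norm_flux_le {θ M : ℝ} (hM : 1 ≤ M) (hμ : 1 ≤ μ) {y : Rn d} {w : Rn d → ℝ} {p : Rn d → Rn d}
    (hy : ‖y‖ ≤ 1 / 3) (h : CarlemanBounds θ M μ (freq μ τ y) A b c y) :
    ‖flux A (carlemanField μ τ A b) (carlemanPot μ τ A b c) (carlemanMult μ τ A) w p y‖
      ≤ 109 * M ^ 2 * (freq μ τ y * ‖p y‖ ^ 2 + freq μ τ y ^ 3 * w y ^ 2) := by
  set T := freq μ τ y
  set n := phaseGrad y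
  have hn' : ‖n‖ ≤ 3 := norm_phaseGrad_le hy
  have hTμ : μ ≤ T := (le_self_pow₀ hμ two_ne_zero).trans h.freq_le
  have hT1 : 1 ≤ T := hμ.trans hTμ
  have hT0 : 0 < T := one_pos.trans_le hT1
  have hM0 : 0 ≤ M := by linarith
  have hbT : ‖b y‖ ≤ T := (le_mul_of_one_le_left (norm_nonneg _) hμ).trans h.normb
  have hcT : |c y| ≤ T ^ 2 := (le_mul_of_one_le_left (abs_nonneg _) hμ).trans h.normc
  have hAp : ∀ x, ‖A y x‖ ≤ M * ‖x‖ := fun x => ((A y).le_opNorm x).trans (by gcongr; exact h.normA)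
  have hAn : ‖A y n‖ ≤ M * 3 := (hAp n).trans (by gcongr)
  have hq : |phaseForm A y| ≤ 9 * M := by
    refine (abs_real_inner_le_norm _ _).trans ?_
    calc ‖A y n‖ * ‖n‖ ≤ M * 3 * 3 := by gcongr
      _ = 9 * M := by ring
  have hX : ‖carlemanField μ τ A b y‖ ≤ 7 * M * T := by
    calc ‖(2 * T) • A y n + b y‖ ≤ 2 * T * ‖A y n‖ + ‖b y‖ := by
          refine (norm_add_le _ _).trans ?_
          rw [norm_smul, Real.norm_of_nonneg (by positivity)]
      _ ≤ 2 * T * (M * 3) + M * T := by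
          gcongr; exact hbT.trans (le_mul_of_one_le_left hT0.le hM)
      _ = 7 * M * T := by ring
  have hQ : |carlemanPot μ τ A b c y| ≤ 13 * M * T ^ 2 := by
    calc |T ^ 2 * phaseForm A y + T * ⟪b y, n⟫_ℝ - c y|
        ≤ T ^ 2 * |phaseForm A y| + T * |⟪b y, n⟫_ℝ| + |c y| := by
          refine (abs_sub _ _).trans (add_le_add_left ((abs_add_le _ _).trans_eq ?_) _)
          rw [abs_mul, abs_mul, abs_of_pos hT0, abs_of_pos (by positivity)]
      _ ≤ T ^ 2 * (9 * M) + T * (T * 3) + T ^ 2 := by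
          gcongr
          exact (abs_real_inner_le_norm _ _).trans (by gcongr)
      _ = (9 * M + 4 * 1) * T ^ 2 := by ring
      _ ≤ (9 * M + 4 * M) * T ^ 2 := by gcongr
      _ = 13 * M * T ^ 2 := by ring
  have hρ : |carlemanMult μ τ A y| ≤ 18 * M * μ * T := by
    calc |2 * μ * T * phaseForm A y| = 2 * μ * T * |phaseForm A y| := by
          rw [abs_mul, abs_of_pos (by positivity)]
      _ ≤ 2 * μ * T * (9 * M) := by gcongr
      _ = 18 * M * μ * T := by ring
  set P := ‖p y‖
  have h1 : |2 * ⟪carlemanField μ τ A b y, p y⟫_ℝ + 2 * (carlemanMult μ τ A y * w y)|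
      ≤ 2 * (7 * M * T * P) + 2 * (18 * M * μ * T * |w y|) := by
    refine (abs_add_le _ _).trans ?_
    rw [abs_mul, abs_mul 2, abs_mul (carlemanMult μ τ A y), abs_two]
    gcongr
    exact (abs_real_inner_le_norm _ _).trans (by gcongr)
  have h2 : |carlemanPot μ τ A b c y * w y ^ 2 - ⟪A y (p y), p y⟫_ℝ|
      ≤ 13 * M * T ^ 2 * w y ^ 2 + M * P * P := by
    refine (abs_sub _ _).trans ?_
    rw [abs_mul, abs_of_nonneg (sq_nonneg (w y))]
    gcongr
    exact (abs_real_inner_le_norm _ _).trans (by gcongr; exact hAp _)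
  have h3 : 2 * (μ * |w y| * P) ≤ T ^ 2 * w y ^ 2 + P ^ 2 := by
    have h4 := two_mul_le_add_sq (μ * |w y|) P
    have h5 : (μ * |w y|) ^ 2 ≤ T ^ 2 * w y ^ 2 := by
      rw [mul_pow, sq_abs]; gcongr
    linarith
  calc _ ≤ (2 * (7 * M * T * P) + 2 * (18 * M * μ * T * |w y|)) * (M * P)
        + (13 * M * T ^ 2 * w y ^ 2 + M * P * P) * (7 * M * T) := by
        refine (norm_add_le _ _).trans ?_
        rw [norm_smul, norm_smul, Real.norm_eq_abs, Real.norm_eq_abs]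
        gcongr
        exact hAp _
    _ = M ^ 2 * T * (21 * P ^ 2 + 91 * (T ^ 2 * w y ^ 2) + 18 * (2 * (μ * |w y| * P))) := by ring
    _ ≤ M ^ 2 * T * (21 * P ^ 2 + 91 * (T ^ 2 * w y ^ 2) + 18 * (T ^ 2 * w y ^ 2 + P ^ 2)) := by
        gcongr
    _ ≤ M ^ 2 * T * (109 * (P ^ 2 + T ^ 2 * w y ^ 2)) := by
        gcongr; nlinarith [sq_nonneg P]
    _ = _ := by ring

/-- The Carleman estimate up to the flat boundary. -/
theorem carleman {θ M : ℝ} (hθ : 0 < θ) (hM : 1 ≤ M) (hμ : 1 ≤ μ)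
    (hμM : 2000 * (d + 1) ^ 2 * M ^ 2 ≤ θ ^ 2 * μ)
    (hA : ContDiff ℝ 1 A) (hb : ContDiff ℝ 1 b) (hc : ContDiff ℝ 1 c) (hv : ContDiff ℝ 2 v)
    (hvs : tsupport v ⊆ Metric.closedBall 0 (1 / 3))
    (hbd : ∀ y ∈ closedHalfBall d (1 / 3), CarlemanBounds θ M μ (freq μ τ y) A b c y) :
    θ ^ 2 * μ * ∫ y in upperHalf d, freq μ τ y ^ 3 * (weight μ τ y * v y) ^ 2
      ≤ 6 * (∫ y in upperHalf d, (weight μ τ y * opL A b c v y) ^ 2)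
        + 109 * M ^ 2 * ∫ y' : Rn' d, (freq μ τ (flatPoint y')
            * ‖gradient (fun x => weight μ τ x * v x) (flatPoint y')‖ ^ 2
          + freq μ τ (flatPoint y') ^ 3 * (weight μ τ (flatPoint y') * v (flatPoint y')) ^ 2) := by
  set w : Rn d → ℝ := fun x => weight μ τ x * v x with hw
  set p := gradient w with hp
  set F := flux A (carlemanField μ τ A b) (carlemanPot μ τ A b c) (carlemanMult μ τ A) w p with hF
  have hvc : HasCompactSupport v :=
    (isCompact_closedBall (0 : Rn d) (1 / 3)).of_isClosed_subset (isClosed_tsupport v) hvs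
  have hwC : ContDiff ℝ 2 w := (contDiff_weight μ τ).mul hv
  have hpC : ContDiff ℝ 1 p := hwC.gradient_contDiff (by norm_num)
  have hwts : tsupport w ⊆ tsupport v := closure_mono (by
    intro x hx; simp only [hw, Function.mem_support] at hx ⊢; exact right_ne_zero_of_mul hx)
  have hw0 : ∀ y ∉ tsupport v, w =ᶠ[nhds y] fun _ => 0 := fun y hy =>
    notMem_tsupport_iff_eventuallyEq.1 (fun h => hy (hwts h))
  have hp0 : ∀ y ∉ tsupport v, p y = 0 := fun y hy => by
    rw [hp, (hw0 y hy).gradient_eq, gradient_fun_const]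
  have hF0 : ∀ y ∉ tsupport v, F y = 0 := fun y hy => by
    simp [hF, flux, hp0 y hy, (hw0 y hy).self_of_nhds]
  have hFc : HasCompactSupport F := HasCompactSupport.intro hvc hF0
  have hFC : ContDiff ℝ 1 F := by
    have h1 := contDiff_carlemanField (μ := μ) (τ := τ) hA hb
    have h2 := contDiff_carlemanPot (μ := μ) (τ := τ) hA hb hc
    have h3 := contDiff_carlemanMult (μ := μ) (τ := τ) hA
    have h4 : ContDiff ℝ 1 w := hwC.of_le (by norm_num)
    exact (((contDiff_const.mul (h1.inner ℝ hpC)).add (contDiff_const.mul (h3.mul h4))).smul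
      (hA.clm_apply hpC)).add (((h2.mul (h4.pow 2)).sub ((hA.clm_apply hpC).inner ℝ hpC)).smul h1)
  have hT0 : ∀ y ∈ closedHalfBall d (1 / 3), 0 ≤ freq μ τ y := fun y hy =>
    le_trans (by positivity) (hbd y hy).freq_le
  have hpt : ∀ y ∈ upperHalf d, θ ^ 2 * μ * (freq μ τ y ^ 3 * w y ^ 2)
      - 6 * (weight μ τ y * opL A b c v y) ^ 2 ≤ tr (fderiv ℝ F y) := by
    intro y hy
    by_cases hyv : y ∈ tsupport v
    · have hyb : ‖y‖ ≤ 1 / 3 := by simpa using hvs hyv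
      have hyK : y ∈ closedHalfBall d (1 / 3) := ⟨hyb, le_of_lt hy⟩
      have B := hbd y hyK
      have hA1 := (hA.differentiable one_ne_zero y).hasFDerivAt
      have hb1 := (hb.differentiable one_ne_zero y).hasFDerivAt
      have hc1 := (hc.differentiable one_ne_zero y).hasFDerivAt
      obtain ⟨q', hq1, hq2⟩ := hasFDerivAt_phaseForm B.symm hA1
      obtain ⟨Q', hQ1, hQ2⟩ := hasFDerivAt_carlemanPot (μ := μ) (τ := τ) hb1 hc1 hq1
      obtain ⟨ρ', hρ1, hρ2⟩ := hasFDerivAt_carlemanMult (μ := μ) (τ := τ) hq1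
      rw [tr_fderiv_flux hA1 (hasFDerivAt_carlemanField hA1 hb1) hQ1 hρ1
        ((hwC.of_le (by norm_num)).hasFDerivAt_innerSL_gradient y) (hwC.hasFDerivAt_gradient y)
        B.symm (hess_symm hwC y)]
      refine le_trans ?_ (carleman_pointwise hθ hM hμ hμM B.freq_le B.normA B.normA' B.symm B.ell
        (le_norm_phaseGrad hyK.2) (norm_phaseGrad_le hyb) B.normb B.normb' B.normc B.normc'
        (q := phaseForm A y) rfl rfl rfl rfl rfl hq2 hQ2 hρ2
        (tr_comp_hess_weight_mul hv y B.symm))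
      -- The gradient part of the lower bound is discarded; only the zeroth order part is kept on
      -- the left.
      have : 0 ≤ θ ^ 2 * μ * (freq μ τ y * ‖gradient w y‖ ^ 2) := by
        have := hT0 y hyK
        positivity
      linarith
    · have h0 : w y = 0 := (hw0 y hyv).self_of_nhds
      have hFe : F =ᶠ[nhds y] fun _ => 0 := by
        filter_upwards [(isClosed_tsupport v).isOpen_compl.mem_nhds hyv] with z hz using hF0 z hz
      rw [hFe.fderiv_eq, h0]
      simp [tr]
      positivity
  have hwc : HasCompactSupport w := HasCompactSupport.intro hvc fun y hy => (hw0 y hy).self_of_nhds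
  have hTc : Continuous (freq (d := d) μ τ) := (contDiff_freq (n := 0) μ τ).continuous
  have i1 : Integrable (fun y => freq μ τ y ^ 3 * w y ^ 2) := by
    refine Continuous.integrable_of_hasCompactSupport
      ((hTc.pow 3).mul (hwC.continuous.pow 2)) ?_
    exact HasCompactSupport.intro hvc fun y hy => by simp [(hw0 y hy).self_of_nhds]
  have hLc : Continuous (opL A b c v) := by
    have h1 : Continuous (gradient v) := (hv.gradient_contDiff (m := 1) (by norm_num)).continuous
    have h2 : Continuous (hess v) :=
      (hv.gradient_contDiff (m := 1) (by norm_num)).continuous_fderiv one_ne_zero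
    have h3 : Continuous (fun y => tr ((A y).comp (hess v y))) := by
      unfold tr
      refine continuous_finsetSum _ fun k _ => ?_
      have : Continuous fun y => ((A y).comp (hess v y)) (EuclideanSpace.single k 1) :=
        (hA.continuous.clm_comp h2).clm_apply continuous_const
      fun_prop
    exact (h3.neg.add (hb.continuous.inner h1)).add (hc.continuous.mul hv.continuous)
  have hL0 : ∀ y ∉ tsupport v, opL A b c v y = 0 := fun y hy => by
    have h1 : v =ᶠ[nhds y] fun _ => 0 := notMem_tsupport_iff_eventuallyEq.1 hy
    have h2 : gradient v =ᶠ[nhds y] fun _ => 0 := by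
      have := h1.gradient
      simpa [gradient_fun_const'] using this
    simp only [opL, hess, h2.fderiv_eq, h2.self_of_nhds, h1.self_of_nhds]
    simp [tr]
  have i2 : Integrable (fun y => (weight μ τ y * opL A b c v y) ^ 2) := by
    refine Continuous.integrable_of_hasCompactSupport
      ((((contDiff_weight (n := 0) μ τ).continuous).mul hLc).pow 2) ?_
    exact HasCompactSupport.intro hvc fun y hy => by simp [hL0 y hy]
  have i3 : Integrable (fun y => tr (fderiv ℝ F y)) := by
    refine Continuous.integrable_of_hasCompactSupport ?_ ?_
    · unfold tr
      refine continuous_finsetSum _ fun k _ => ?_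
      have : Continuous fun y => fderiv ℝ F y (EuclideanSpace.single k 1) :=
        (hFC.continuous_fderiv one_ne_zero).clm_apply continuous_const
      fun_prop
    · refine (hFc.fderiv (𝕜 := ℝ)).comp_left (g := tr) ?_
      simp [tr]
  have key := setIntegral_mono_on
    ((i1.const_mul (θ ^ 2 * μ)).sub (i2.const_mul 6)).integrableOn i3.integrableOn
    (measurableSet_upperHalf d) hpt
  rw [integral_upperHalf_tr_fderiv hFC hFc] at key
  simp only [Pi.sub_apply] at key
  rw [integral_sub (i1.const_mul _).integrableOn (i2.const_mul _).integrableOn,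
    integral_const_mul, integral_const_mul] at key
  have hfl : Continuous (flatPoint (d := d)) := continuous_flatPoint
  -- Only the normal component of the flux crosses the face; it is bounded by the norm of the flux,
  -- and everything vanishes beyond radius 1/3.
  have hb2 : -∫ y' : Rn' d, F (flatPoint y') (Fin.last d) ≤ 109 * M ^ 2 * ∫ y' : Rn' d,
      (freq μ τ (flatPoint y') * ‖p (flatPoint y')‖ ^ 2
        + freq μ τ (flatPoint y') ^ 3 * w (flatPoint y') ^ 2) := by
    have hcpt : IsCompact (Metric.closedBall (0 : Rn' d) (1 / 3)) := isCompact_closedBall _ _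
    have hout : ∀ y' ∉ Metric.closedBall (0 : Rn' d) (1 / 3), flatPoint y' ∉ tsupport v := by
      intro y' hy' h
      apply hy'
      have := hvs h
      simpa [norm_flatPoint] using this
    rw [← integral_neg, ← integral_const_mul]
    refine integral_mono ?_ ?_ fun y' => ?_
    · refine (Continuous.integrable_of_hasCompactSupport
        ((by have := hFC.continuous; fun_prop : Continuous fun y' => F (flatPoint y') (Fin.last d)))
        (HasCompactSupport.intro hcpt fun y' hy' => ?_)).neg
      rw [hF0 _ (hout y' hy')]; rfl
    · refine (Continuous.integrable_of_hasCompactSupport ?_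
        (HasCompactSupport.intro hcpt fun y' hy' => ?_)).const_mul _
      · have := hpC.continuous
        have := hwC.continuous
        fun_prop
      · simp [hp0 _ (hout y' hy'), (hw0 _ (hout y' hy')).self_of_nhds]
    · simp only
      by_cases hy' : y' ∈ Metric.closedBall (0 : Rn' d) (1 / 3)
      · have hK : flatPoint y' ∈ closedHalfBall d (1 / 3) :=
          ⟨by rw [norm_flatPoint]; simpa using hy', (flatPoint_last y').ge⟩
        refine le_trans ?_ (norm_flux_le hM hμ hK.1 (hbd _ hK))
        refine le_trans (neg_le_abs _) ?_
        exact PiLp.norm_apply_le (F (flatPoint y')) (Fin.last d)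
      · rw [hF0 _ (hout y' hy'), hp0 _ (hout y' hy'), (hw0 _ (hout y' hy')).self_of_nhds]
        simp
  linarith

end carleman

lemma isOpen_halfBall (d : ℕ) (r : ℝ) : IsOpen (halfBall d r) := by
  have h : IsOpen ({y : Rn d | ‖y‖ < r} ∩ {y : Rn d | 0 < y (Fin.last d)}) :=
    (isOpen_lt continuous_norm continuous_const).inter (isOpen_lt continuous_const (by fun_prop))
  exact h

/-! ### Caccioppoli's inequality up to the face. -/

section caccioppoli

variable {d : ℕ}

/-- Bounds on the coefficients at a point; `S` measures the size of the lower order terms. -/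
structure CoefBounds (θ M B S : ℝ) (A : Rn d → Rn d →L[ℝ] Rn d) (b : Rn d → Rn d)
    (c : Rn d → ℝ) (y : Rn d) : Prop where
  normA : ‖A y‖ ≤ M
  normA' : ‖fderiv ℝ A y‖ ≤ M
  symm : ∀ x z, ⟪A y x, z⟫_ℝ = ⟪x, A y z⟫_ℝ
  ell : ∀ x, θ * ‖x‖ ^ 2 ≤ ⟪A y x, x⟫_ℝ
  normb : ‖b y‖ ≤ B * S
  normb' : ‖fderiv ℝ b y‖ ≤ B * S
  normc : |c y| ≤ B * S ^ 2
  normc' : ‖fderiv ℝ c y‖ ≤ B * S ^ 2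

variable {A : Rn d → Rn d →L[ℝ] Rn d} {b : Rn d → Rn d} {c u : Rn d → ℝ}

lemma continuous_tr {X : Type*} [TopologicalSpace X] {f : X → Rn d →L[ℝ] Rn d}
    (hf : Continuous f) : Continuous fun x => tr (f x) := by
  unfold tr
  refine continuous_finsetSum _ fun k _ => ?_
  have : Continuous fun x => f x (EuclideanSpace.single k 1) := hf.clm_apply continuous_const
  fun_prop

lemma continuous_opL (hA : Continuous A) (hb : Continuous b) (hc : Continuous c)
    (hu : ContDiff ℝ 2 u) : Continuous (opL A b c u) := by
  have h0 := hu.gradient_contDiff (m := 1) (by norm_num)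
  exact ((continuous_tr (hA.clm_comp (h0.continuous_fderiv one_ne_zero))).neg.add
    (hb.inner h0.continuous)).add (hc.mul hu.continuous)

/-- This is testing the equation with η² u. Since the operator is in nondivergence form, putting A
inside the divergence costs the trace of the derivative of A. -/
lemma tr_fderiv_caccioppoli {η : Rn d → ℝ} (hA : ContDiff ℝ 1 A) (hu : ContDiff ℝ 2 u)
    (hη : ContDiff ℝ 1 η) (y : Rn d) :
    tr (fderiv ℝ (fun x => (η x ^ 2 * u x) • A x (gradient u x)) y)
      = η y ^ 2 * u y * (⟪b y, gradient u y⟫_ℝ + c y * u y - opL A b c u y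
          + tr ((fderiv ℝ A y).flip (gradient u y)))
        + η y ^ 2 * ⟪A y (gradient u y), gradient u y⟫_ℝ
        + 2 * η y * u y * ⟪A y (gradient u y), gradient η y⟫_ℝ := by
  have h1 := ((hη.hasFDerivAt_innerSL_gradient y).pow 2).mul
    ((hu.of_le (by norm_num)).hasFDerivAt_innerSL_gradient y)
  have h2 := (hA.differentiable one_ne_zero y).hasFDerivAt.clm_apply (hu.hasFDerivAt_gradient y)
  have h3 := tr_fderiv_smul h1 h2
  refine h3.trans ?_
  rw [tr_add, opL]
  simp [real_inner_comm (A y (gradient u y))]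
  ring

/-- Here `e`, `U`, `g`, `r`, `p`, `z` stand for η, u, the operator applied to u, the trace of the
derivative of A, ∇u and ∇η. Every cross term carries at least `e * |U| * ‖p‖`, so completing one
square spends half of the ellipticity and leaves S² U². -/
lemma caccioppoli_pointwise {θ M B S Cη : ℝ} (hθ : 0 < θ) (hS : 1 ≤ S) (hM : 1 ≤ M)
    {y : Rn d} (h : CoefBounds θ M B S A b c y) {e U g r : ℝ} {p z : Rn d}
    (he0 : 0 ≤ e) (he1 : e ≤ 1) (hz : ‖z‖ ≤ Cη)
    (hr : |r| ≤ (d + 1) * M * ‖p‖) :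
    θ / 2 * (e ^ 2 * ‖p‖ ^ 2) ≤ (e ^ 2 * U * (⟪b y, p⟫_ℝ + c y * U - g + r)
        + e ^ 2 * ⟪A y p, p⟫_ℝ + 2 * e * U * ⟪A y p, z⟫_ℝ)
      + (((B + (d + 1) * M + 2 * M * Cη) ^ 2 / (2 * θ) + B + 1) * S ^ 2 * U ^ 2 + g ^ 2) := by
  set N : ℝ := d + 1
  have hN : 0 ≤ N := by positivity
  have hC0 : 0 ≤ Cη := (norm_nonneg z).trans hz
  set P := ‖p‖
  have hS2 : 1 ≤ S ^ 2 := one_le_pow₀ hS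
  have he2 : e ^ 2 ≤ 1 := pow_le_one₀ he0 he1
  have e1 : |e ^ 2 * U * ⟪b y, p⟫_ℝ| ≤ e * |U| * (B * S * P) := by
    rw [abs_mul, abs_mul, abs_of_nonneg (sq_nonneg e)]
    gcongr
    · exact pow_le_of_le_one he0 he1 two_ne_zero
    · exact (abs_real_inner_le_norm _ _).trans (by gcongr; exact h.normb)
  have e2 : |e ^ 2 * U * (c y * U)| ≤ B * S ^ 2 * U ^ 2 := by
    calc |e ^ 2 * U * (c y * U)| = e ^ 2 * (|c y| * U ^ 2) := by
          rw [show e ^ 2 * U * (c y * U) = e ^ 2 * (c y * U ^ 2) by ring, abs_mul, abs_mul,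
            abs_of_nonneg (sq_nonneg e), abs_of_nonneg (sq_nonneg U)]
      _ ≤ 1 * (B * S ^ 2 * U ^ 2) := by gcongr; exact h.normc
      _ = _ := one_mul _
  have e3 : |e ^ 2 * U * g| ≤ S ^ 2 * U ^ 2 + g ^ 2 := by
    calc |e ^ 2 * U * g| = e ^ 2 * (|U| * |g|) := by
          rw [mul_assoc, abs_mul, abs_mul, abs_of_nonneg (sq_nonneg e)]
      _ ≤ 1 * (|U| * |g|) := by gcongr
      _ ≤ |U| ^ 2 + |g| ^ 2 := by nlinarith [sq_nonneg (|U| - |g|), sq_nonneg |U|, sq_nonneg |g|]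
      _ = 1 * U ^ 2 + g ^ 2 := by rw [sq_abs, sq_abs, one_mul]
      _ ≤ S ^ 2 * U ^ 2 + g ^ 2 := by gcongr
  have e4 : |e ^ 2 * U * r| ≤ e * |U| * (N * M * P * S) := by
    rw [abs_mul, abs_mul, abs_of_nonneg (sq_nonneg e)]
    have : N * M * P ≤ N * M * P * S := le_mul_of_one_le_right (by positivity) hS
    gcongr
    · exact pow_le_of_le_one he0 he1 two_ne_zero
    · exact hr.trans this
  have e5 : |2 * e * U * ⟪A y p, z⟫_ℝ| ≤ e * |U| * (2 * M * Cη * P * S) := by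
    have h1 : |⟪A y p, z⟫_ℝ| ≤ M * P * Cη := (abs_inner_apply_le _ _ _).trans (by
      gcongr; exact h.normA)
    calc |2 * e * U * ⟪A y p, z⟫_ℝ| = 2 * e * |U| * |⟪A y p, z⟫_ℝ| := by
          rw [abs_mul, abs_mul, abs_of_nonneg (by positivity)]
      _ ≤ 2 * e * |U| * (M * P * Cη * S) := by
          gcongr
          exact h1.trans (le_mul_of_one_le_right (by positivity) hS)
      _ = _ := by ring
  set D := B + N * M + 2 * M * Cη with hD
  have e6 : e * |U| * (B * S * P) + e * |U| * (N * M * P * S) + e * |U| * (2 * M * Cη * P * S)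
      ≤ θ / 2 * (e ^ 2 * P ^ 2) + D ^ 2 / (2 * θ) * S ^ 2 * U ^ 2 := by
    have h1 : e * |U| * (B * S * P) + e * |U| * (N * M * P * S) + e * |U| * (2 * M * Cη * P * S)
        = (e * P) * (D * S * |U|) := by rw [hD]; ring
    have h2 : θ / 2 * (e ^ 2 * P ^ 2) + D ^ 2 / (2 * θ) * S ^ 2 * U ^ 2 - (e * P) * (D * S * |U|)
        = (θ * (e * P) - D * S * |U|) ^ 2 / (2 * θ) := by
      field_simp
      rw [← sq_abs U]
      ring
    rw [h1]
    have : 0 ≤ (θ * (e * P) - D * S * |U|) ^ 2 / (2 * θ) := by positivity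
    linarith
  have e7 : e ^ 2 * (θ * P ^ 2) ≤ e ^ 2 * ⟪A y p, p⟫_ℝ := by gcongr; exact h.ell p
  have a1 := (abs_le.1 e1).1
  have a2 := (abs_le.1 e2).1
  have a3 := (abs_le.1 e3).2
  have a4 := (abs_le.1 e4).1
  have a5 := (abs_le.1 e5).1
  linarith

/-- Caccioppoli's inequality up to the flat boundary. -/
theorem caccioppoli {θ M B : ℝ} (hθ : 0 < θ) (hB : 0 ≤ B) (hM : 1 ≤ M) :
    ∃ C, 0 < C ∧ ∀ (S : ℝ) (A : Rn d → Rn d →L[ℝ] Rn d) (b : Rn d → Rn d) (c u : Rn d → ℝ),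
      1 ≤ S → ContDiff ℝ 1 A → Continuous b → Continuous c → ContDiff ℝ 2 u →
      (∀ y ∈ closedHalfBall d (1 / 3), CoefBounds θ M B S A b c y) →
      ∫ y in halfBall d (3 / 10), ‖gradient u y‖ ^ 2
        ≤ C * (S ^ 2 * (∫ y in halfBall d (1 / 3), u y ^ 2)
          + (∫ y in halfBall d (1 / 3), opL A b c u y ^ 2)
          + ∫ y' in Metric.ball (0 : Rn' d) (1 / 3),
            (u (flatPoint y') ^ 2 + ‖gradient u (flatPoint y')‖ ^ 2)) := by
  let η : ContDiffBump (0 : Rn d) := ⟨3 / 10, 1 / 3, by norm_num, by norm_num⟩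
  have hη : ContDiff ℝ ∞ η := η.contDiff
  have hη1 : ContDiff ℝ 1 η := η.contDiff
  obtain ⟨Cη, hCη⟩ : ∃ Cη, ∀ y, ‖gradient η y‖ ≤ Cη := by
    have := (hη1.continuous_fderiv one_ne_zero).bounded_above_of_compact_support
      (η.hasCompactSupport.fderiv (𝕜 := ℝ))
    simpa only [norm_gradient] using this
  have hCη0 : 0 ≤ Cη := (norm_nonneg _).trans (hCη 0)
  set E := (B + (d + 1) * M + 2 * M * Cη) ^ 2 / (2 * θ) + B + 1 with hE
  have hE0 : 0 < E := by positivity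
  refine ⟨2 / θ * (E + 1 + M), by positivity, ?_⟩
  intro S A b c u hS hA hb hc hu hbd
  set F : Rn d → Rn d := fun x => (η x ^ 2 * u x) • A x (gradient u x) with hF
  have hgC : ContDiff ℝ 1 (gradient u) := hu.gradient_contDiff (by norm_num)
  have hFC : ContDiff ℝ 1 F :=
    ((hη1.pow 2).mul (hu.of_le (by norm_num))).smul (hA.clm_apply hgC)
  have hη0 : ∀ y : Rn d, 1 / 3 ≤ ‖y‖ → η y = 0 := fun y hy =>
    η.zero_of_le_dist (by rw [dist_zero_right]; exact hy)
  have hFc : HasCompactSupport F := HasCompactSupport.intro (isCompact_closedBall (0 : Rn d) (1 / 3))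
    fun y hy => by
      have : 1 / 3 ≤ ‖y‖ := by simp at hy; linarith
      simp [hF, hη0 y this]
  have hLc := continuous_opL hA.continuous hb hc hu
  have hmeas : ∀ r, MeasurableSet (halfBall d r) := fun r =>
    (isOpen_halfBall d r).measurableSet
  have hsub : halfBall d (1 / 3) ⊆ Metric.closedBall 0 (1 / 3) := fun y hy => by
    simpa using hy.1.le
  have hint : ∀ f : Rn d → ℝ, Continuous f → IntegrableOn f (halfBall d (1 / 3)) := fun f hf =>
    (hf.continuousOn.integrableOn_compact (isCompact_closedBall _ _)).mono_set hsub
  have hpt : ∀ y ∈ upperHalf d, θ / 2 * (η y ^ 2 * ‖gradient u y‖ ^ 2) ≤ tr (fderiv ℝ F y)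
      + (halfBall d (1 / 3)).indicator (fun y => E * S ^ 2 * u y ^ 2 + opL A b c u y ^ 2) y := by
    intro y hy
    rw [hF, tr_fderiv_caccioppoli (b := b) (c := c) hA hu hη1]
    by_cases hy3 : ‖y‖ < 1 / 3
    · have hyK : y ∈ closedHalfBall d (1 / 3) := ⟨hy3.le, le_of_lt hy⟩
      rw [Set.indicator_of_mem (show y ∈ halfBall d (1 / 3) from ⟨hy3, hy⟩)]
      refine caccioppoli_pointwise hθ hS hM (hbd y hyK) η.nonneg η.le_one (hCη y) ?_
      refine (abs_tr_le _).trans ?_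
      rw [mul_assoc]
      gcongr
      refine ((fderiv ℝ A y).flip.le_opNorm _).trans ?_
      rw [ContinuousLinearMap.opNorm_flip]
      gcongr
      exact (hbd y hyK).normA'
    · rw [Set.indicator_of_notMem (fun h : y ∈ halfBall d (1 / 3) => hy3 h.1),
        hη0 y (not_lt.1 hy3)]
      simp
  have i1 : Integrable (fun y => η y ^ 2 * ‖gradient u y‖ ^ 2) := by
    refine Continuous.integrable_of_hasCompactSupport
      ((η.continuous.pow 2).mul (hgC.continuous.norm.pow 2)) ?_
    refine HasCompactSupport.intro (isCompact_closedBall (0 : Rn d) (1 / 3)) fun y hy => ?_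
    have : 1 / 3 ≤ ‖y‖ := by simp at hy; linarith
    simp [hη0 y this]
  have i2 : Integrable (fun y => tr (fderiv ℝ F y)) := by
    refine Continuous.integrable_of_hasCompactSupport
      (continuous_tr (hFC.continuous_fderiv one_ne_zero)) ?_
    refine (hFc.fderiv (𝕜 := ℝ)).comp_left (g := tr) ?_
    simp [tr]
  have i3 : IntegrableOn (fun y => E * S ^ 2 * u y ^ 2 + opL A b c u y ^ 2) (halfBall d (1 / 3)) :=
    hint _ ((continuous_const.mul (hu.continuous.pow 2)).add (hLc.pow 2))
  have i4 : IntegrableOn (fun y => E * S ^ 2 * u y ^ 2) (halfBall d (1 / 3)) :=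
    hint _ (continuous_const.mul (hu.continuous.pow 2))
  have i5 : IntegrableOn (fun y => opL A b c u y ^ 2) (halfBall d (1 / 3)) := hint _ (hLc.pow 2)
  have key := setIntegral_mono_on (i1.const_mul (θ / 2)).integrableOn
    (i2.add ((integrable_indicator_iff (hmeas _)).2 i3)).integrableOn
    (measurableSet_upperHalf d) hpt
  rw [integral_const_mul] at key
  simp only [Pi.add_apply] at key
  rw [integral_add i2.integrableOn ((integrable_indicator_iff (hmeas _)).2 i3).integrableOn,
    integral_upperHalf_tr_fderiv hFC hFc, setIntegral_indicator (hmeas _),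
    Set.inter_eq_self_of_subset_right (show halfBall d (1 / 3) ⊆ upperHalf d from fun y hy => hy.2),
    integral_add i4 i5, integral_const_mul] at key
  have hlow : ∫ y in halfBall d (3 / 10), ‖gradient u y‖ ^ 2
      ≤ ∫ y in upperHalf d, η y ^ 2 * ‖gradient u y‖ ^ 2 := by
    calc ∫ y in halfBall d (3 / 10), ‖gradient u y‖ ^ 2
        = ∫ y in halfBall d (3 / 10), η y ^ 2 * ‖gradient u y‖ ^ 2 := by
          refine setIntegral_congr_fun (hmeas _) fun y hy => ?_
          have : η y = 1 := η.one_of_mem_closedBall (by simpa using hy.1.le)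
          simp [this]
      _ ≤ _ := setIntegral_mono_set i1.integrableOn
          (Filter.Eventually.of_forall fun y => by positivity)
          (Filter.Eventually.of_forall fun y hy => hy.2)
  -- No boundary condition is imposed, so the flux η² u A∇u through the face remains and is charged
  -- to the Cauchy data.
  have hflat : -∫ y' : Rn' d, F (flatPoint y') (Fin.last d)
      ≤ M * ∫ y' in Metric.ball (0 : Rn' d) (1 / 3),
            (u (flatPoint y') ^ 2 + ‖gradient u (flatPoint y')‖ ^ 2) := by
    have hcf : Continuous (flatPoint (d := d)) := continuous_flatPoint
    have hFcont := hFC.continuous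
    have hgcont := hgC.continuous
    have hucont := hu.continuous
    rw [← integral_neg, ← integral_const_mul, ← integral_indicator measurableSet_ball]
    refine integral_mono (Integrable.neg ?_) ?_ fun y' => ?_
    · refine Continuous.integrable_of_hasCompactSupport (by fun_prop)
        (HasCompactSupport.intro (isCompact_closedBall (0 : Rn' d) (1 / 3)) fun y' hy' => ?_)
      have : 1 / 3 ≤ ‖flatPoint y'‖ := by rw [norm_flatPoint]; simp at hy'; linarith
      simp [hF, hη0 _ this]
    · rw [integrable_indicator_iff measurableSet_ball]
      refine IntegrableOn.mono_set ?_ Metric.ball_subset_closedBall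
      exact ContinuousOn.integrableOn_compact (isCompact_closedBall _ _)
        (Continuous.continuousOn (by fun_prop))
    · simp only
      by_cases hy' : ‖y'‖ < 1 / 3
      · rw [Set.indicator_of_mem (by simpa using hy')]
        have hK : flatPoint y' ∈ closedHalfBall d (1 / 3) :=
          ⟨by rw [norm_flatPoint]; exact hy'.le, (flatPoint_last y').ge⟩
        refine (neg_le_abs _).trans ((PiLp.norm_apply_le (F (flatPoint y')) (Fin.last d)).trans ?_)
        set z := flatPoint y'
        have h1 : ‖A z (gradient u z)‖ ≤ M * ‖gradient u z‖ :=
          ((A z).le_opNorm _).trans (by gcongr; exact (hbd z hK).normA)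
        have h2 : |η z ^ 2 * u z| ≤ |u z| := by
          rw [abs_mul, abs_of_nonneg (sq_nonneg _)]
          exact mul_le_of_le_one_left (abs_nonneg _) (pow_le_one₀ η.nonneg η.le_one)
        calc ‖F z‖ = |η z ^ 2 * u z| * ‖A z (gradient u z)‖ := by
              rw [hF, norm_smul, Real.norm_eq_abs]
          _ ≤ |u z| * (M * ‖gradient u z‖) := by gcongr
          _ = M * (|u z| * ‖gradient u z‖) := by ring
          _ ≤ M * (u z ^ 2 + ‖gradient u z‖ ^ 2) := by
              gcongr
              nlinarith [sq_nonneg (|u z| - ‖gradient u z‖), sq_abs (u z), sq_nonneg (u z),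
                sq_nonneg ‖gradient u z‖]
      · rw [Set.indicator_of_notMem (by simpa using hy')]
        have : 1 / 3 ≤ ‖flatPoint y'‖ := by rw [norm_flatPoint]; exact not_lt.1 hy'
        simp [hF, hη0 _ this]
  have hU0 : 0 ≤ ∫ y in halfBall d (1 / 3), u y ^ 2 := integral_nonneg fun y => sq_nonneg _
  have hG0 : 0 ≤ ∫ y in halfBall d (1 / 3), opL A b c u y ^ 2 := integral_nonneg fun y => sq_nonneg _
  have hD0 : 0 ≤ ∫ y' in Metric.ball (0 : Rn' d) (1 / 3),
            (u (flatPoint y') ^ 2 + ‖gradient u (flatPoint y')‖ ^ 2) :=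
    integral_nonneg fun y => by positivity
  revert hlow key hflat
  generalize ∫ y in halfBall d (3 / 10), ‖gradient u y‖ ^ 2 = L0
  generalize ∫ y in upperHalf d, η y ^ 2 * ‖gradient u y‖ ^ 2 = L1
  generalize -∫ y' : Rn' d, F (flatPoint y') (Fin.last d) = L2
  revert hU0 hG0 hD0
  generalize ∫ y in halfBall d (1 / 3), u y ^ 2 = U
  generalize ∫ y in halfBall d (1 / 3), opL A b c u y ^ 2 = G
  generalize ∫ y' in Metric.ball (0 : Rn' d) (1 / 3),
            (u (flatPoint y') ^ 2 + ‖gradient u (flatPoint y')‖ ^ 2) = D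
  intro hU0 hG0 hD0 key hlow hflat
  have h1 : θ / 2 * L0 ≤ (E + 1 + M) * (S ^ 2 * U + G + D) := by
    have h2 : θ / 2 * L0 ≤ θ / 2 * L1 := by gcongr
    have h3 : 0 ≤ S ^ 2 * U := by positivity
    have h4 : 0 ≤ E * G := by positivity
    have h5 : 0 ≤ E * D := by positivity
    have h6 : 0 ≤ M * G := by positivity
    have h7 : 0 ≤ M * (S ^ 2 * U) := by positivity
    linarith
  calc L0 = 2 / θ * (θ / 2 * L0) := by field_simp
    _ ≤ 2 / θ * ((E + 1 + M) * (S ^ 2 * U + G + D)) := by gcongr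
    _ = _ := by ring

end caccioppoli

/-! ### Size of the weight, admissible frequencies, and commutator bounds. -/

section core

variable {d : ℕ}

/-- The square of the Cauchy data on the flat ball of radius `1/3`, for a smooth function. -/
noncomputable def flatData (u : Rn d → ℝ) : ℝ :=
  ∫ y' in Metric.ball (0 : Rn' d) (1 / 3),
    (u (flatPoint y') ^ 2 + ‖gradient u (flatPoint y')‖ ^ 2)

lemma phase_nonpos {y : Rn d} (hy : 0 ≤ y (Fin.last d)) : phase y ≤ 0 := by
  rw [phase_eq]; nlinarith [sq_nonneg ‖y‖]

lemma last_le_norm (y : Rn d) : y (Fin.last d) ≤ ‖y‖ :=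
  (le_abs_self _).trans (PiLp.norm_apply_le y (Fin.last d))

lemma neg_one_le_phase {y : Rn d} (hy : ‖y‖ ≤ 1 / 3) : -1 ≤ phase y := by
  rw [phase_eq]
  nlinarith [last_le_norm y, norm_nonneg y]

/-- Together with `phase_le_of_le_norm` this is the gap that drives the proof: the phase exceeds
-1/100 on the small half ball and is below -1/16 where the cutoff varies. -/
lemma le_phase_of_norm_le {y : Rn d} (hy : ‖y‖ ≤ 1 / 256) : -(1 / 100) ≤ phase y := by
  rw [phase_eq]
  nlinarith [last_le_norm y, norm_nonneg y]

lemma phase_le_of_le_norm {y : Rn d} (hy : 1 / 4 ≤ ‖y‖) (h : 0 ≤ y (Fin.last d)) :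
    phase y ≤ -(1 / 16) := by
  rw [phase_eq]
  nlinarith

lemma weight_mono {μ τ s : ℝ} (hμ : 0 ≤ μ) (hτ : 0 ≤ τ) {y : Rn d} (h : phase y ≤ s) :
    weight μ τ y ≤ Real.exp (τ * Real.exp (μ * s)) := by
  unfold weight
  gcongr

lemma le_weight {μ τ s : ℝ} (hμ : 0 ≤ μ) (hτ : 0 ≤ τ) {y : Rn d} (h : s ≤ phase y) :
    Real.exp (τ * Real.exp (μ * s)) ≤ weight μ τ y := by
  unfold weight
  gcongr

lemma weight_pos (μ τ : ℝ) (y : Rn d) : 0 < weight μ τ y := Real.exp_pos _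

lemma le_freq {μ τ : ℝ} (hμ : 0 ≤ μ) (hτ : 0 ≤ τ) {y : Rn d} (hy : ‖y‖ ≤ 1 / 3) :
    τ * μ * Real.exp (-μ) ≤ freq μ τ y := by
  unfold freq
  have := neg_one_le_phase hy
  gcongr
  nlinarith

lemma freq_le {μ τ : ℝ} (hμ : 0 ≤ μ) (hτ : 0 ≤ τ) {y : Rn d} (h : 0 ≤ y (Fin.last d)) :
    freq μ τ y ≤ τ * μ := by
  unfold freq
  refine mul_le_of_le_one_right (by positivity) (Real.exp_le_one_iff.2 ?_)
  exact mul_nonpos_of_nonneg_of_nonpos hμ (phase_nonpos h)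

variable {A : Rn d → Rn d →L[ℝ] Rn d} {b : Rn d → Rn d} {c u : Rn d → ℝ}

/-- On |y| ≤ 1/3 the phase is at least -1, so T ≥ τ μ e^{-μ}. The summands `B`, `μ` and `1` of the
threshold give μBS ≤ T, μ² ≤ T and S ≤ T; the bound for c is the product of the first and the last.
The threshold is linear in S. -/
lemma CoefBounds.carlemanBounds {θ M B S μ τ : ℝ} (hB : 0 ≤ B) (hS : 1 ≤ S) (hμ : 1 ≤ μ)
    (hτ : (B + μ + 1) * Real.exp μ * S ≤ τ) {y : Rn d} (hy : ‖y‖ ≤ 1 / 3)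
    (h : CoefBounds θ M B S A b c y) : CarlemanBounds θ M μ (freq μ τ y) A b c y := by
  have hτ0 : 0 ≤ τ := le_trans (by positivity) hτ
  have hT : (B + μ + 1) * S * μ ≤ freq μ τ y := by
    refine le_trans ?_ (le_freq (by linarith) hτ0 hy)
    calc (B + μ + 1) * S * μ = ((B + μ + 1) * Real.exp μ * S) * μ * Real.exp (-μ) := by
          rw [Real.exp_neg]; field_simp
      _ ≤ τ * μ * Real.exp (-μ) := by gcongr
  generalize freq μ τ y = T at hT
  have h1 : μ ^ 2 ≤ T := by
    refine le_trans ?_ hT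
    calc μ ^ 2 = (0 + μ + 0) * 1 * μ := by ring
      _ ≤ (B + μ + 1) * S * μ := by gcongr; norm_num
  have h2 : μ * (B * S) ≤ T := by
    refine le_trans ?_ hT
    calc μ * (B * S) = (B + 0 + 0) * S * μ := by ring
      _ ≤ (B + μ + 1) * S * μ := by gcongr <;> linarith
  have h3 : μ * (B * S ^ 2) ≤ T ^ 2 := by
    have h4 : S ≤ T := by
      refine le_trans ?_ hT
      calc S = (0 + 0 + 1) * S * 1 := by ring
        _ ≤ (B + μ + 1) * S * μ := by gcongr; linarith
    calc μ * (B * S ^ 2) = (μ * (B * S)) * S := by ring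
      _ ≤ T * T := mul_le_mul h2 h4 (by linarith) (le_trans (by positivity) h1)
      _ = T ^ 2 := by ring
  exact ⟨h1, h.normA, h.normA', h.symm, h.ell,
    (mul_le_mul_of_nonneg_left h.normb (by linarith)).trans h2,
    (mul_le_mul_of_nonneg_left h.normb' (by linarith)).trans h2,
    (mul_le_mul_of_nonneg_left h.normc (by linarith)).trans h3,
    (mul_le_mul_of_nonneg_left h.normc' (by linarith)).trans h3⟩

/-- The bracket is the commutator with χ: it involves only derivatives of χ, and at most first
derivatives of u. -/
lemma opL_mul {χ : Rn d → ℝ} (hχ : ContDiff ℝ 2 χ) (hu : ContDiff ℝ 2 u) {y : Rn d}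
    (hAs : ∀ x z, ⟪A y x, z⟫_ℝ = ⟪x, A y z⟫_ℝ) :
    opL A b c (fun x => χ x * u x) y = χ y * opL A b c u y
      + (⟪b y, gradient χ y⟫_ℝ * u y - tr ((A y).comp (hess χ y)) * u y
        - 2 * ⟪A y (gradient χ y), gradient u y⟫_ℝ) := by
  rw [opL, opL, tr_comp_hess_mul hχ hu y hAs,
    gradient_mul (hχ.of_le (by norm_num)) (hu.of_le (by norm_num))]
  simp only [inner_add_right, real_inner_smul_right]
  ring

/-- Bound for the commutator of the operator with a cutoff. -/
lemma sq_commutator_le {θ M B S Cχ : ℝ} (hB : 0 ≤ B) (hS : 1 ≤ S) (hM : 1 ≤ M) {y : Rn d}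
    (h : CoefBounds θ M B S A b c y) {p z : Rn d} {H : Rn d →L[ℝ] Rn d} {U : ℝ}
    (hz : ‖z‖ ≤ Cχ) (hH : ‖H‖ ≤ Cχ) :
    (⟪b y, z⟫_ℝ * U - tr ((A y).comp H) * U - 2 * ⟪A y z, p⟫_ℝ) ^ 2
      ≤ 12 * (B + (d + 1) * M) ^ 2 * Cχ ^ 2 * S ^ 2 * (U ^ 2 + ‖p‖ ^ 2) := by
  have hC0 : 0 ≤ Cχ := (norm_nonneg z).trans hz
  set W := B + (d + 1) * M with hW
  have hBW : B ≤ W := by rw [hW]; have : 0 ≤ (d + 1) * M := by positivity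
                         linarith
  have hNW : (d + 1) * M ≤ W := by linarith
  have hMW : M ≤ W := le_trans (le_mul_of_one_le_left (by linarith) (by simp)) hNW
  have hW0 : 0 ≤ W := hB.trans hBW
  have h1 : |⟪b y, z⟫_ℝ| ≤ W * Cχ * S := by
    calc |⟪b y, z⟫_ℝ| ≤ ‖b y‖ * ‖z‖ := abs_real_inner_le_norm _ _
      _ ≤ (W * S) * Cχ := by gcongr; exact h.normb.trans (by gcongr)
      _ = _ := by ring
  have h2 : |tr ((A y).comp H)| ≤ W * Cχ * S := by
    calc |tr ((A y).comp H)| ≤ (d + 1) * ‖(A y).comp H‖ := abs_tr_le _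
      _ ≤ (d + 1) * (M * Cχ) := by
          gcongr
          exact ((A y).opNorm_comp_le H).trans (by gcongr; exact h.normA)
      _ = ((d + 1) * M) * Cχ * 1 := by ring
      _ ≤ W * Cχ * S := by gcongr
  have h3 : |⟪A y z, p⟫_ℝ| ≤ W * Cχ * S * ‖p‖ := by
    calc |⟪A y z, p⟫_ℝ| ≤ ‖A y‖ * ‖z‖ * ‖p‖ := abs_inner_apply_le _ _ _
      _ ≤ (W * Cχ * 1) * ‖p‖ := by
          rw [mul_one]; gcongr; exact h.normA.trans hMW
      _ ≤ _ := by gcongr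
  have s1 : ⟪b y, z⟫_ℝ ^ 2 ≤ (W * Cχ * S) ^ 2 := by rw [← sq_abs]; gcongr
  have s2 : tr ((A y).comp H) ^ 2 ≤ (W * Cχ * S) ^ 2 := by rw [← sq_abs]; gcongr
  have s3 : ⟪A y z, p⟫_ℝ ^ 2 ≤ (W * Cχ * S * ‖p‖) ^ 2 := by rw [← sq_abs]; gcongr
  have s1' := mul_le_mul_of_nonneg_right s1 (sq_nonneg U)
  have s2' := mul_le_mul_of_nonneg_right s2 (sq_nonneg U)
  generalize ⟪b y, z⟫_ℝ = k1 at *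
  generalize tr ((A y).comp H) = k2 at *
  generalize ⟪A y z, p⟫_ℝ = k3 at *
  have h5 : (k1 * U - k2 * U - 2 * k3) ^ 2 ≤ 3 * (k1 ^ 2 * U ^ 2 + k2 ^ 2 * U ^ 2 + 4 * k3 ^ 2) := by
    nlinarith [sq_nonneg (k1 * U + k2 * U), sq_nonneg (k1 * U + 2 * k3), sq_nonneg (k2 * U - 2 * k3)]
  have h6 : 0 ≤ (W * Cχ * S) ^ 2 * U ^ 2 := by positivity
  refine h5.trans ?_
  nlinarith

end core

/-! ### The Carleman estimate applied to a cut off function. -/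

section core

variable {d : ℕ} {A : Rn d → Rn d →L[ℝ] Rn d} {b : Rn d → Rn d} {c u : Rn d → ℝ}

/-- The cutoff used in the Carleman estimate. -/
noncomputable def cutoff (d : ℕ) : ContDiffBump (0 : Rn d) :=
  -- The outer radius stays below 3/10, so that ∇u on the support of the commutator is controlled by
  -- `caccioppoli`.
  ⟨1 / 4, 29 / 100, by norm_num, by norm_num⟩

lemma exists_cutoff_bound (d : ℕ) : ∃ C, 0 ≤ C ∧ ∀ y : Rn d,
    ‖gradient (cutoff d) y‖ ≤ C ∧ ‖hess (cutoff d) y‖ ≤ C := by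
  have h2 : ContDiff ℝ 2 (cutoff d) := (cutoff d).contDiff
  have hg : ContDiff ℝ 1 (gradient (cutoff d)) := h2.gradient_contDiff (by norm_num)
  have hgc : HasCompactSupport (gradient (cutoff d)) :=
    ((cutoff d).hasCompactSupport.fderiv (𝕜 := ℝ)).comp_left
      (g := (InnerProductSpace.toDual ℝ (Rn d)).symm) (map_zero _)
  obtain ⟨C1, h1⟩ := hg.continuous.bounded_above_of_compact_support hgc
  obtain ⟨C2, h2⟩ := (hg.continuous_fderiv one_ne_zero).bounded_above_of_compact_support
    (hgc.fderiv (𝕜 := ℝ))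
  exact ⟨max C1 C2, ((norm_nonneg _).trans (h1 0)).trans (le_max_left _ _),
    fun y => ⟨(h1 y).trans (le_max_left _ _), (h2 y).trans (le_max_right _ _)⟩⟩

lemma cutoff_eventuallyEq_one {y : Rn d} (hy : ‖y‖ < 1 / 4) :
    (cutoff d : Rn d → ℝ) =ᶠ[nhds y] fun _ => 1 := by
  filter_upwards [Metric.isOpen_ball.mem_nhds (show y ∈ Metric.ball (0 : Rn d) (1 / 4) by
    simpa using hy)] with z hz
  exact (cutoff d).one_of_mem_closedBall (Metric.ball_subset_closedBall hz)

lemma tsupport_cutoff_mul (u : Rn d → ℝ) :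
    tsupport (fun x => cutoff d x * u x) ⊆ Metric.closedBall 0 (29 / 100) := by
  refine (tsupport_mul_subset_left (f := cutoff d) (g := u)).trans ?_
  rw [(cutoff d).tsupport_eq]
  rfl

lemma opL_eq_zero_of_notMem_tsupport {v : Rn d → ℝ} {y : Rn d} (hy : y ∉ tsupport v) :
    opL A b c v y = 0 := by
  have h1 : v =ᶠ[nhds y] fun _ => 0 := notMem_tsupport_iff_eventuallyEq.1 hy
  have h2 : gradient v =ᶠ[nhds y] fun _ => 0 := by
    have := h1.gradient
    simpa [gradient_fun_const'] using this
  simp only [opL, hess, h2.fderiv_eq, h2.self_of_nhds, h1.self_of_nhds]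
  simp [tr]

/-- The residual of the equation may sit where the weight is largest and pays e^{2τ}. The commutator
vanishes for |y| < 1/4 and pays only the weight at phase -1/16. -/
lemma sq_weight_mul_opL_le {θ M B S C μ τ : ℝ} (hB : 0 ≤ B) (hS : 1 ≤ S) (hM : 1 ≤ M)
    (hμ : 0 ≤ μ) (hτ : 0 ≤ τ) (hu : ContDiff ℝ 2 u)
    (hC : ∀ y : Rn d, ‖gradient (cutoff d) y‖ ≤ C ∧ ‖hess (cutoff d) y‖ ≤ C) {y : Rn d}
    (hy : 0 ≤ y (Fin.last d)) (h : CoefBounds θ M B S A b c y) :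
    (weight μ τ y * opL A b c (fun x => cutoff d x * u x) y) ^ 2
      ≤ 2 * Real.exp (2 * τ) * opL A b c u y ^ 2
        + 24 * (B + (d + 1) * M) ^ 2 * C ^ 2 * S ^ 2
          * Real.exp (2 * (τ * Real.exp (μ * -(1 / 16)))) * (u y ^ 2 + ‖gradient u y‖ ^ 2) := by
  have hexp2 : ∀ x : ℝ, Real.exp x ^ 2 = Real.exp (2 * x) := fun x => by
    rw [← Real.exp_nat_mul]; norm_num
  rw [opL_mul (cutoff d).contDiff hu h.symm]
  set K := ⟪b y, gradient (cutoff d) y⟫_ℝ * u y - tr ((A y).comp (hess (cutoff d) y)) * u y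
        - 2 * ⟪A y (gradient (cutoff d) y), gradient u y⟫_ℝ with hK
  have hw1 : weight μ τ y ≤ Real.exp τ := by
    simpa using weight_mono hμ hτ (phase_nonpos hy)
  have h1 : (weight μ τ y * (cutoff d y * opL A b c u y)) ^ 2
      ≤ Real.exp (2 * τ) * opL A b c u y ^ 2 := by
    rw [← hexp2, ← mul_assoc, mul_pow]
    gcongr
    · exact mul_nonneg (weight_pos μ τ y).le (cutoff d).nonneg
    · calc weight μ τ y * cutoff d y ≤ Real.exp τ * 1 := by
            gcongr
            · exact (cutoff d).nonneg
            · exact (cutoff d).le_one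
        _ = Real.exp τ := mul_one _
  have h2 : (weight μ τ y * K) ^ 2 ≤ 12 * (B + (d + 1) * M) ^ 2 * C ^ 2 * S ^ 2
          * Real.exp (2 * (τ * Real.exp (μ * -(1 / 16)))) * (u y ^ 2 + ‖gradient u y‖ ^ 2) := by
    by_cases hy4 : ‖y‖ < 1 / 4
    · have e1 := cutoff_eventuallyEq_one hy4
      have e2 : gradient (cutoff d) =ᶠ[nhds y] fun _ => 0 := by
        simpa [gradient_fun_const'] using e1.gradient
      have e3 : K = 0 := by
        rw [hK, hess, e2.fderiv_eq, e2.self_of_nhds]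
        simp [tr]
      rw [e3]
      simp
      positivity
    · have hK2 : K ^ 2 ≤ 12 * (B + (d + 1) * M) ^ 2 * C ^ 2 * S ^ 2
          * (u y ^ 2 + ‖gradient u y‖ ^ 2) :=
        sq_commutator_le hB hS hM h (hC y).1 (hC y).2
      have hw2 : weight μ τ y ≤ Real.exp (τ * Real.exp (μ * -(1 / 16))) :=
        weight_mono hμ hτ (phase_le_of_le_norm (not_lt.1 hy4) hy)
      rw [mul_pow]
      calc weight μ τ y ^ 2 * K ^ 2 ≤ Real.exp (τ * Real.exp (μ * -(1 / 16))) ^ 2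
            * (12 * (B + (d + 1) * M) ^ 2 * C ^ 2 * S ^ 2 * (u y ^ 2 + ‖gradient u y‖ ^ 2)) := by
            have := (weight_pos μ τ y).le
            gcongr
        _ = _ := by rw [hexp2]; ring
  have h3 : (weight μ τ y * (cutoff d y * opL A b c u y + K)) ^ 2
      ≤ 2 * (weight μ τ y * (cutoff d y * opL A b c u y)) ^ 2 + 2 * (weight μ τ y * K) ^ 2 := by
    nlinarith [sq_nonneg (weight μ τ y * (cutoff d y * opL A b c u y) - weight μ τ y * K)]
  linarith

/-- The phase is nonpositive on the face, so the weight is at most e^τ and the frequency at most τμ.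
Differentiating the weight produces one factor of the frequency; this gives (τμ)³ e^{2τ}. -/
lemma boundary_term_le {C μ τ : ℝ} (hC0 : 0 ≤ C) (hμ : 0 ≤ μ) (hτ : 0 ≤ τ) (hu : ContDiff ℝ 2 u)
    (hC : ∀ y : Rn d, ‖gradient (cutoff d) y‖ ≤ C ∧ ‖hess (cutoff d) y‖ ≤ C) {y : Rn d}
    (hy : 0 ≤ y (Fin.last d)) (hy3 : ‖y‖ ≤ 1 / 3) (hT1 : 1 ≤ freq μ τ y) :
    freq μ τ y * ‖gradient (fun x => weight μ τ x * (cutoff d x * u x)) y‖ ^ 2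
        + freq μ τ y ^ 3 * (weight μ τ y * (cutoff d y * u y)) ^ 2
      ≤ (τ * μ) ^ 3 * Real.exp (2 * τ) * (2 * (C + 3) ^ 2 + 1)
        * (u y ^ 2 + ‖gradient u y‖ ^ 2) := by
  have hexp2 : Real.exp τ ^ 2 = Real.exp (2 * τ) := by
    rw [← Real.exp_nat_mul]; norm_num
  have hu1 : ContDiff ℝ 1 u := hu.of_le (by norm_num)
  have hc1 : ContDiff ℝ 1 (cutoff d) := (cutoff d).contDiff
  have hw1 : weight μ τ y ≤ Real.exp τ := by
    simpa using weight_mono hμ hτ (phase_nonpos hy)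
  have hw0 := (weight_pos μ τ y).le
  have hTle := freq_le hμ hτ hy
  have hn := norm_phaseGrad_le hy3
  have hχ0 : 0 ≤ cutoff d y := (cutoff d).nonneg
  have hχ1 : cutoff d y ≤ 1 := (cutoff d).le_one
  rw [gradient_mul (contDiff_weight μ τ) (hc1.mul hu1), gradient_mul hc1 hu1, gradient_weight]
  set T := freq μ τ y
  set W := weight μ τ y
  set T1 := τ * μ
  have hT0 : 0 ≤ T := by linarith
  have hT11 : 1 ≤ T1 := hT1.trans hTle
  have hv : |cutoff d y * u y| ≤ |u y| := by
    rw [abs_mul, abs_of_nonneg hχ0]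
    exact mul_le_of_le_one_left (abs_nonneg _) hχ1
  have hgv : ‖cutoff d y • gradient u y + u y • gradient (cutoff d) y‖
      ≤ ‖gradient u y‖ + |u y| * C := by
    refine (norm_add_le _ _).trans ?_
    rw [norm_smul, norm_smul, Real.norm_of_nonneg hχ0, Real.norm_eq_abs]
    gcongr
    · exact mul_le_of_le_one_left (norm_nonneg _) hχ1
    · exact (hC y).1
  have hp : ‖W • (cutoff d y • gradient u y + u y • gradient (cutoff d) y)
      + (cutoff d y * u y) • (T * W) • phaseGrad y‖
      ≤ Real.exp τ * T1 * (‖gradient u y‖ + (C + 3) * |u y|) := by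
    refine (norm_add_le _ _).trans ?_
    rw [norm_smul, norm_smul, norm_smul, Real.norm_of_nonneg hw0,
      Real.norm_of_nonneg (mul_nonneg hT0 hw0), Real.norm_eq_abs]
    calc W * ‖cutoff d y • gradient u y + u y • gradient (cutoff d) y‖
          + |cutoff d y * u y| * (T * W * ‖phaseGrad y‖)
        ≤ Real.exp τ * (‖gradient u y‖ + |u y| * C) + |u y| * (T1 * Real.exp τ * 3) := by gcongr
      _ ≤ Real.exp τ * (‖gradient u y‖ + |u y| * C) * T1 + |u y| * (T1 * Real.exp τ * 3) := by
          exact add_le_add (le_mul_of_one_le_right (by positivity) hT11) le_rfl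
      _ = _ := by ring
  have hp2 := pow_le_pow_left₀ (norm_nonneg _) hp 2
  have hC3 : 1 ≤ (C + 3) ^ 2 := one_le_pow₀ (by linarith)
  have hsum : (‖gradient u y‖ + (C + 3) * |u y|) ^ 2
      ≤ 2 * (C + 3) ^ 2 * (u y ^ 2 + ‖gradient u y‖ ^ 2) := by
    have h1 : (‖gradient u y‖ + (C + 3) * |u y|) ^ 2
        ≤ 2 * ‖gradient u y‖ ^ 2 + 2 * ((C + 3) * |u y|) ^ 2 := by
      nlinarith [sq_nonneg (‖gradient u y‖ - (C + 3) * |u y|)]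
    have h2 : ((C + 3) * |u y|) ^ 2 = (C + 3) ^ 2 * u y ^ 2 := by rw [mul_pow, sq_abs]
    have h3 : ‖gradient u y‖ ^ 2 ≤ (C + 3) ^ 2 * ‖gradient u y‖ ^ 2 :=
      le_mul_of_one_le_left (sq_nonneg _) hC3
    linarith
  calc _ ≤ T1 * (Real.exp τ * T1 * (‖gradient u y‖ + (C + 3) * |u y|)) ^ 2
        + T1 ^ 3 * (Real.exp τ * |u y|) ^ 2 := by
        have h5 : (W * (cutoff d y * u y)) ^ 2 ≤ (Real.exp τ * |u y|) ^ 2 := by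
          rw [← sq_abs, abs_mul, abs_of_nonneg hw0]
          gcongr
        gcongr
    _ = T1 ^ 3 * Real.exp (2 * τ) * ((‖gradient u y‖ + (C + 3) * |u y|) ^ 2 + u y ^ 2) := by
        rw [← hexp2, mul_pow (Real.exp τ) |u y|, sq_abs]; ring
    _ ≤ T1 ^ 3 * Real.exp (2 * τ) * (2 * (C + 3) ^ 2 * (u y ^ 2 + ‖gradient u y‖ ^ 2)
          + (u y ^ 2 + ‖gradient u y‖ ^ 2)) := by
        gcongr
        exact le_add_of_nonneg_right (sq_nonneg _)
    _ = _ := by ring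

/-- The Carleman estimate applied to a cut off function. -/
lemma carleman_cutoff {θ M B S C μ τ : ℝ} (hθ : 0 < θ) (hB : 0 ≤ B) (hS : 1 ≤ S) (hM : 1 ≤ M)
    (hμ : 1 ≤ μ) (hμM : 2000 * (d + 1) ^ 2 * M ^ 2 ≤ θ ^ 2 * μ)
    (hτ : (B + μ + 1) * Real.exp μ * S ≤ τ) (hC0 : 0 ≤ C)
    (hC : ∀ y : Rn d, ‖gradient (cutoff d) y‖ ≤ C ∧ ‖hess (cutoff d) y‖ ≤ C)
    (hA : ContDiff ℝ 1 A) (hb : ContDiff ℝ 1 b) (hc : ContDiff ℝ 1 c) (hu : ContDiff ℝ 2 u)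
    (hbd : ∀ y ∈ closedHalfBall d (1 / 3), CoefBounds θ M B S A b c y) :
    Real.exp (2 * (τ * Real.exp (μ * -(1 / 100)))) * (∫ y in halfBall d (1 / 256), u y ^ 2)
      ≤ 12 * Real.exp (2 * τ) * (∫ y in halfBall d (1 / 3), opL A b c u y ^ 2)
        + 144 * (B + (d + 1) * M) ^ 2 * C ^ 2 * S ^ 2
          * Real.exp (2 * (τ * Real.exp (μ * -(1 / 16))))
          * ((∫ y in halfBall d (1 / 3), u y ^ 2)
            + ∫ y in halfBall d (3 / 10), ‖gradient u y‖ ^ 2)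
        + 109 * M ^ 2 * ((τ * μ) ^ 3 * Real.exp (2 * τ) * (2 * (C + 3) ^ 2 + 1)) * flatData u := by
  have hμ0 : 0 ≤ μ := by linarith
  have hτ0 : 0 ≤ τ := le_trans (by positivity) hτ
  set v : Rn d → ℝ := fun x => cutoff d x * u x with hv
  have hvC : ContDiff ℝ 2 v := (cutoff d).contDiff.mul hu
  have hvs : tsupport v ⊆ Metric.closedBall 0 (29 / 100) := tsupport_cutoff_mul u
  have hcb : ∀ y ∈ closedHalfBall d (1 / 3), CarlemanBounds θ M μ (freq μ τ y) A b c y :=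
    fun y hy => (hbd y hy).carlemanBounds hB hS hμ hτ hy.1
  have hT1 : ∀ y ∈ closedHalfBall d (1 / 3), 1 ≤ freq μ τ y := fun y hy =>
    (one_le_pow₀ hμ).trans (hcb y hy).freq_le
  have key := carleman (τ := τ) hθ hM hμ hμM hA hb hc hvC
    (hvs.trans (Metric.closedBall_subset_closedBall (by norm_num))) hcb
  have hmeas : ∀ r, MeasurableSet (halfBall d r) := fun r => (isOpen_halfBall d r).measurableSet
  have hint : ∀ (f : Rn d → ℝ) (r : ℝ), Continuous f → IntegrableOn f (halfBall d r) := fun f r hf =>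
    (hf.continuousOn.integrableOn_compact (isCompact_closedBall 0 r)).mono_set fun y hy => by
      simpa using hy.1.le
  have hgC : Continuous (gradient u) := (hu.gradient_contDiff (m := 1) (by norm_num)).continuous
  have hLu : Continuous (opL A b c u) := continuous_opL hA.continuous hb.continuous hc.continuous hu
  have hLv : Continuous (opL A b c v) := continuous_opL hA.continuous hb.continuous hc.continuous hvC
  have hwC : Continuous (weight (d := d) μ τ) := (contDiff_weight (n := 0) μ τ).continuous
  have hTC : Continuous (freq (d := d) μ τ) := (contDiff_freq (n := 0) μ τ).continuous
  have hcpt : HasCompactSupport v :=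
    (isCompact_closedBall (0 : Rn d) _).of_isClosed_subset (isClosed_tsupport v) hvs
  -- the left-hand side
  have hleft : Real.exp (2 * (τ * Real.exp (μ * -(1 / 100))))
        * (∫ y in halfBall d (1 / 256), u y ^ 2)
      ≤ θ ^ 2 * μ * ∫ y in upperHalf d, freq μ τ y ^ 3 * (weight μ τ y * v y) ^ 2 := by
    -- Both θ²μ and the cube of the frequency are at least 1, so they can be dropped from the
    -- left-hand side.
    have hone : 1 ≤ θ ^ 2 * μ := le_trans (by
      have h1 : (1 : ℝ) ≤ (d + 1) ^ 2 := one_le_pow₀ (by simp)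
      have h2 : 1 ≤ M ^ 2 := one_le_pow₀ hM
      nlinarith) hμM
    have i1 : Integrable (fun y => freq μ τ y ^ 3 * (weight μ τ y * v y) ^ 2) :=
      Continuous.integrable_of_hasCompactSupport
        ((hTC.pow 3).mul ((hwC.mul hvC.continuous).pow 2))
        (HasCompactSupport.intro hcpt fun y hy => by simp [image_eq_zero_of_notMem_tsupport hy])
    have hTnn : ∀ y : Rn d, 0 ≤ freq μ τ y := fun y => by unfold freq; positivity
    calc _ = ∫ y in halfBall d (1 / 256), Real.exp (2 * (τ * Real.exp (μ * -(1 / 100)))) * u y ^ 2 :=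
          (integral_const_mul _ _).symm
      _ ≤ ∫ y in halfBall d (1 / 256), freq μ τ y ^ 3 * (weight μ τ y * v y) ^ 2 := by
          refine setIntegral_mono_on (hint _ _ (continuous_const.mul (hu.continuous.pow 2)))
            i1.integrableOn (hmeas _) fun y hy => ?_
          have hvy : v y = u y := by
            have : cutoff d y = 1 := (cutoff d).one_of_mem_closedBall
              (Metric.mem_closedBall.2 (by
                rw [dist_zero_right]; exact hy.1.le.trans (by norm_num [cutoff])))
            simp [hv, this]
          have hT : 1 ≤ freq μ τ y ^ 3 :=
            one_le_pow₀ (hT1 y ⟨hy.1.le.trans (by norm_num), hy.2.le⟩)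
          have hW : Real.exp (τ * Real.exp (μ * -(1 / 100))) ≤ weight μ τ y :=
            le_weight hμ0 hτ0 (le_phase_of_norm_le hy.1.le)
          rw [hvy]
          calc Real.exp (2 * (τ * Real.exp (μ * -(1 / 100)))) * u y ^ 2
              = 1 * (Real.exp (τ * Real.exp (μ * -(1 / 100))) ^ 2 * u y ^ 2) := by
                rw [← Real.exp_nat_mul, one_mul]; norm_num
            _ ≤ freq μ τ y ^ 3 * (weight μ τ y ^ 2 * u y ^ 2) := by gcongr
            _ = _ := by ring
      _ ≤ ∫ y in upperHalf d, freq μ τ y ^ 3 * (weight μ τ y * v y) ^ 2 :=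
          setIntegral_mono_set i1.integrableOn
            (Filter.Eventually.of_forall fun y => by have := hTnn y; positivity)
            (Filter.Eventually.of_forall fun y hy => hy.2)
      _ ≤ _ := le_mul_of_one_le_left
          (integral_nonneg fun y => by have := hTnn y; positivity) hone
  -- the interior term
  set W3 := 24 * (B + (d + 1) * M) ^ 2 * C ^ 2 * S ^ 2
          * Real.exp (2 * (τ * Real.exp (μ * -(1 / 16)))) with hW3
  have hright : ∫ y in upperHalf d, (weight μ τ y * opL A b c v y) ^ 2
      ≤ 2 * Real.exp (2 * τ) * (∫ y in halfBall d (1 / 3), opL A b c u y ^ 2)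
        + W3 * ((∫ y in halfBall d (1 / 3), u y ^ 2)
            + ∫ y in halfBall d (3 / 10), ‖gradient u y‖ ^ 2) := by
    have hle : halfBall d (3 / 10) ⊆ halfBall d (1 / 3) := fun y hy =>
      ⟨hy.1.trans (by norm_num), hy.2⟩
    have i1 : Integrable (fun y => (weight μ τ y * opL A b c v y) ^ 2) :=
      Continuous.integrable_of_hasCompactSupport ((hwC.mul hLv).pow 2)
        (HasCompactSupport.intro hcpt fun y hy => by simp [opL_eq_zero_of_notMem_tsupport hy])
    have i2 : IntegrableOn (fun y => 2 * Real.exp (2 * τ) * opL A b c u y ^ 2)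
        (halfBall d (3 / 10)) := hint _ _ (continuous_const.mul (hLu.pow 2))
    have i3 : IntegrableOn (fun y => u y ^ 2) (halfBall d (3 / 10)) :=
      hint _ _ (hu.continuous.pow 2)
    have i4 : IntegrableOn (fun y => ‖gradient u y‖ ^ 2) (halfBall d (3 / 10)) :=
      hint _ _ (hgC.norm.pow 2)
    have i5 : IntegrableOn (fun y => W3 * (u y ^ 2 + ‖gradient u y‖ ^ 2)) (halfBall d (3 / 10)) :=
      (i3.add i4).const_mul W3
    calc ∫ y in upperHalf d, (weight μ τ y * opL A b c v y) ^ 2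
        ≤ ∫ y in upperHalf d, (halfBall d (3 / 10)).indicator (fun y =>
            2 * Real.exp (2 * τ) * opL A b c u y ^ 2 + W3 * (u y ^ 2 + ‖gradient u y‖ ^ 2)) y := by
          refine setIntegral_mono_on i1.integrableOn
            ((integrable_indicator_iff (hmeas _)).2 (i2.add i5)).integrableOn
            (measurableSet_upperHalf d) fun y hy => ?_
          by_cases hyv : y ∈ tsupport v
          · have hy' : ‖y‖ ≤ 29 / 100 := by simpa using hvs hyv
            have hy0 : 0 ≤ y (Fin.last d) := le_of_lt hy
            rw [Set.indicator_of_mem (show y ∈ halfBall d (3 / 10) from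
              ⟨hy'.trans_lt (by norm_num), hy⟩)]
            exact sq_weight_mul_opL_le hB hS hM hμ0 hτ0 hu hC hy0
              (hbd y ⟨hy'.trans (by norm_num), hy0⟩)
          · rw [opL_eq_zero_of_notMem_tsupport hyv, mul_zero, zero_pow two_ne_zero]
            exact Set.indicator_nonneg (fun z _ => by positivity) y
      _ = 2 * Real.exp (2 * τ) * (∫ y in halfBall d (3 / 10), opL A b c u y ^ 2)
        + W3 * ((∫ y in halfBall d (3 / 10), u y ^ 2)
            + ∫ y in halfBall d (3 / 10), ‖gradient u y‖ ^ 2) := by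
          rw [setIntegral_indicator (hmeas _), Set.inter_eq_self_of_subset_right
            (show halfBall d (3 / 10) ⊆ upperHalf d from fun y hy => hy.2),
            integral_add i2 i5, integral_const_mul, integral_const_mul, integral_add i3 i4]
      _ ≤ _ := by
          gcongr ?_ * ?_ + ?_ * (?_ + ?_)
          · exact setIntegral_mono_set (hint _ _ (hLu.pow 2))
              (Filter.Eventually.of_forall fun y => sq_nonneg _) hle.eventuallyLE
          · exact setIntegral_mono_set (hint _ _ (hu.continuous.pow 2))
              (Filter.Eventually.of_forall fun y => sq_nonneg _) hle.eventuallyLE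
          · exact le_rfl
  -- the boundary term
  set W4 := (τ * μ) ^ 3 * Real.exp (2 * τ) * (2 * (C + 3) ^ 2 + 1) with hW4
  have hflat : ∫ y' : Rn' d, (freq μ τ (flatPoint y')
            * ‖gradient (fun x => weight μ τ x * v x) (flatPoint y')‖ ^ 2
          + freq μ τ (flatPoint y') ^ 3 * (weight μ τ (flatPoint y') * v (flatPoint y')) ^ 2)
      ≤ W4 * flatData u := by
    have hcf : Continuous (flatPoint (d := d)) := continuous_flatPoint
    have hucont := hu.continuous
    have hvcont := hvC.continuous
    have hwv : ContDiff ℝ 2 (fun x => weight μ τ x * v x) := (contDiff_weight μ τ).mul hvC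
    have hgw : Continuous (gradient (fun x => weight μ τ x * v x)) :=
      (hwv.gradient_contDiff (m := 1) (by norm_num)).continuous
    have hzero : ∀ y' : Rn' d, 29 / 100 < ‖y'‖ →
        gradient (fun x => weight μ τ x * v x) (flatPoint y') = 0 ∧ v (flatPoint y') = 0 := by
      intro y' hy'
      have hn : flatPoint y' ∉ tsupport v := fun h => by
        have := hvs h
        rw [mem_closedBall_zero_iff, norm_flatPoint] at this
        linarith
      have h1 : v =ᶠ[nhds (flatPoint y')] fun _ => 0 := notMem_tsupport_iff_eventuallyEq.1 hn
      refine ⟨?_, h1.self_of_nhds⟩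
      have h2 : (fun x => weight μ τ x * v x) =ᶠ[nhds (flatPoint y')] fun _ => 0 := by
        filter_upwards [h1] with z hz
        rw [hz, mul_zero]
      rw [h2.gradient_eq, gradient_fun_const]
    rw [flatData, ← integral_const_mul, ← integral_indicator measurableSet_ball]
    refine integral_mono ?_ ?_ fun y' => ?_
    · refine Continuous.integrable_of_hasCompactSupport (by fun_prop)
        (HasCompactSupport.intro (isCompact_closedBall (0 : Rn' d) (1 / 3)) fun y' hy' => ?_)
      have : 29 / 100 < ‖y'‖ := by
        rw [mem_closedBall_zero_iff, not_le] at hy'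
        exact lt_trans (by norm_num) hy'
      simp [(hzero y' this).1, (hzero y' this).2]
    · rw [integrable_indicator_iff measurableSet_ball]
      refine IntegrableOn.mono_set ?_ Metric.ball_subset_closedBall
      exact ContinuousOn.integrableOn_compact (isCompact_closedBall _ _)
        (Continuous.continuousOn (by fun_prop))
    · simp only
      by_cases hy' : ‖y'‖ < 1 / 3
      · rw [Set.indicator_of_mem (by simpa using hy')]
        have hK : flatPoint y' ∈ closedHalfBall d (1 / 3) :=
          ⟨by rw [norm_flatPoint]; exact hy'.le, (flatPoint_last y').ge⟩
        exact boundary_term_le hC0 hμ0 hτ0 hu hC hK.2 hK.1 (hT1 _ hK)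
      · rw [Set.indicator_of_notMem (by simpa using hy')]
        have : 29 / 100 < ‖y'‖ := lt_of_lt_of_le (by norm_num) (not_lt.1 hy')
        simp [(hzero y' this).1, (hzero y' this).2]
  have hfin : 109 * M ^ 2 * ∫ y' : Rn' d, (freq μ τ (flatPoint y')
            * ‖gradient (fun x => weight μ τ x * v x) (flatPoint y')‖ ^ 2
          + freq μ τ (flatPoint y') ^ 3 * (weight μ τ (flatPoint y') * v (flatPoint y')) ^ 2)
      ≤ 109 * M ^ 2 * (W4 * flatData u) := by gcongr
  rw [hW3] at hright
  linarith

end core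

/-! ### Combining Carleman and Caccioppoli. -/

lemma pow_four_le_exp {x : ℝ} (hx : 0 ≤ x) : x ^ 4 ≤ 24 * Real.exp x := by
  have := Real.pow_div_factorial_le_exp x hx 4
  norm_num [Nat.factorial] at this
  linarith

/-- Collecting the terms of the Carleman and the Caccioppoli estimates. -/
lemma collect_terms {I U G D L C₁ C₂ C₃ C₄ S τ φ₁ φ₂ : ℝ} (hS : 1 ≤ S) (hSτ : S ≤ τ)
    (hφ : φ₂ < φ₁) (hφ₁ : 0 < φ₁) (hφ₁' : φ₁ ≤ 1) (hφ₂ : 0 < φ₂)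
    (hC₁ : 0 ≤ C₁) (hC₂ : 0 ≤ C₂) (hC₃ : 0 ≤ C₃) (hC₄ : 0 ≤ C₄)
    (hU : 0 ≤ U) (hG : 0 ≤ G) (hD : 0 ≤ D)
    (h1 : Real.exp (2 * (τ * φ₁)) * I ≤ C₁ * Real.exp (2 * τ) * G
      + C₂ * S ^ 2 * Real.exp (2 * (τ * φ₂)) * (U + L) + C₃ * (τ ^ 3 * Real.exp (2 * τ)) * D)
    (h2 : L ≤ C₄ * (S ^ 2 * U + G + D)) :
    I ≤ (C₁ + C₂ * (1 + C₄) + C₃) * (24 / (φ₁ - φ₂) ^ 4)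
      * (Real.exp (-(φ₁ - φ₂) * τ) * U + Real.exp (3 * τ) * (G + D)) := by
  have hτ1 : 1 ≤ τ := hS.trans hSτ
  have hg : 0 < φ₁ - φ₂ := by linarith
  have hS4 : S ^ 2 ≤ τ ^ 4 := (pow_le_pow_left₀ (by linarith) hSτ 2).trans
    (pow_le_pow_right₀ hτ1 (by norm_num))
  have hτ34 : τ ^ 3 ≤ τ ^ 4 := pow_le_pow_right₀ hτ1 (by norm_num)
  have h1τ : 1 ≤ τ ^ 4 := one_le_pow₀ hτ1
  have hexp : Real.exp (2 * (τ * φ₂)) ≤ Real.exp (2 * τ) := by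
    gcongr
    nlinarith
  -- One factor S² comes from the commutator and another from Caccioppoli's inequality, hence the
  -- fourth power of τ.
  have hSS : S ^ 2 * (U + L) ≤ τ ^ 4 * (1 + C₄) * (U + G + D) := by
    have e1 : U + L ≤ (1 + C₄) * (S ^ 2 * (U + G + D)) := by
      have hS2 : 1 ≤ S ^ 2 := one_le_pow₀ hS
      have b1 : U ≤ S ^ 2 * U := le_mul_of_one_le_left hU hS2
      have b2 : G ≤ S ^ 2 * G := le_mul_of_one_le_left hG hS2
      have b3 : D ≤ S ^ 2 * D := le_mul_of_one_le_left hD hS2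
      have b4 : C₄ * (S ^ 2 * U + G + D) ≤ C₄ * (S ^ 2 * (U + G + D)) := by
        gcongr; linarith
      linarith
    calc S ^ 2 * (U + L) ≤ S ^ 2 * ((1 + C₄) * (S ^ 2 * (U + G + D))) := by gcongr
      _ = S ^ 4 * (1 + C₄) * (U + G + D) := by ring
      _ ≤ τ ^ 4 * (1 + C₄) * (U + G + D) := by gcongr
  set Z := C₁ + C₂ * (1 + C₄) + C₃ with hZ
  have hZ0 : 0 ≤ Z := by positivity
  have h3 : Real.exp (2 * (τ * φ₁)) * I
      ≤ Z * τ ^ 4 * (Real.exp (2 * (τ * φ₂)) * U + Real.exp (2 * τ) * (G + D)) := by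
    have a1 : C₁ * Real.exp (2 * τ) * G ≤ C₁ * (τ ^ 4 * (Real.exp (2 * τ) * (G + D))) := by
      calc C₁ * Real.exp (2 * τ) * G = C₁ * (1 * (Real.exp (2 * τ) * (G + 0))) := by ring
        _ ≤ _ := by gcongr
    have a2 : C₂ * S ^ 2 * Real.exp (2 * (τ * φ₂)) * (U + L) ≤ C₂ * (1 + C₄) * (τ ^ 4 *
        (Real.exp (2 * (τ * φ₂)) * U + Real.exp (2 * τ) * (G + D))) := by
      calc C₂ * S ^ 2 * Real.exp (2 * (τ * φ₂)) * (U + L)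
          = C₂ * Real.exp (2 * (τ * φ₂)) * (S ^ 2 * (U + L)) := by ring
        _ ≤ C₂ * Real.exp (2 * (τ * φ₂)) * (τ ^ 4 * (1 + C₄) * (U + G + D)) := by gcongr
        _ = C₂ * (1 + C₄) * (τ ^ 4 * (Real.exp (2 * (τ * φ₂)) * U
              + Real.exp (2 * (τ * φ₂)) * (G + D))) := by ring
        _ ≤ _ := by gcongr
    have a3 : C₃ * (τ ^ 3 * Real.exp (2 * τ)) * D
        ≤ C₃ * (τ ^ 4 * (Real.exp (2 * τ) * (G + D))) := by
      calc C₃ * (τ ^ 3 * Real.exp (2 * τ)) * D = C₃ * (τ ^ 3 * (Real.exp (2 * τ) * (0 + D))) := by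
            ring
        _ ≤ _ := by gcongr
    have a4 : C₁ * (τ ^ 4 * (Real.exp (2 * τ) * (G + D))) ≤ C₁ * (τ ^ 4 *
        (Real.exp (2 * (τ * φ₂)) * U + Real.exp (2 * τ) * (G + D))) := by
      gcongr; exact le_add_of_nonneg_left (by positivity)
    have a5 : C₃ * (τ ^ 4 * (Real.exp (2 * τ) * (G + D))) ≤ C₃ * (τ ^ 4 *
        (Real.exp (2 * (τ * φ₂)) * U + Real.exp (2 * τ) * (G + D))) := by
      gcongr; exact le_add_of_nonneg_left (by positivity)
    rw [hZ]
    linarith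
  -- The weights differ by a factor e^{-2(φ₁-φ₂)τ}; half of that gain is spent on absorbing the
  -- power of τ.
  have hτ4 : τ ^ 4 ≤ 24 / (φ₁ - φ₂) ^ 4 * Real.exp ((φ₁ - φ₂) * τ) := by
    have := pow_four_le_exp (x := (φ₁ - φ₂) * τ) (by positivity)
    rw [mul_pow] at this
    rw [div_mul_eq_mul_div, le_div_iff₀ (by positivity)]
    linarith
  have hE : I = Real.exp (-(2 * (τ * φ₁))) * (Real.exp (2 * (τ * φ₁)) * I) := by
    rw [← mul_assoc, ← Real.exp_add]; simp
  rw [hE]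
  calc _ ≤ Real.exp (-(2 * (τ * φ₁)))
        * (Z * τ ^ 4 * (Real.exp (2 * (τ * φ₂)) * U + Real.exp (2 * τ) * (G + D))) := by gcongr
    _ ≤ Real.exp (-(2 * (τ * φ₁))) * (Z * (24 / (φ₁ - φ₂) ^ 4 * Real.exp ((φ₁ - φ₂) * τ))
          * (Real.exp (2 * (τ * φ₂)) * U + Real.exp (2 * τ) * (G + D))) := by gcongr
    _ = Z * (24 / (φ₁ - φ₂) ^ 4) *
          (Real.exp (-(2 * (τ * φ₁))) * Real.exp ((φ₁ - φ₂) * τ) * Real.exp (2 * (τ * φ₂)) * U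
          + Real.exp (-(2 * (τ * φ₁))) * Real.exp ((φ₁ - φ₂) * τ) * Real.exp (2 * τ) * (G + D)) := by
        ring
    _ = Z * (24 / (φ₁ - φ₂) ^ 4) * (Real.exp (-(φ₁ - φ₂) * τ) * U
          + Real.exp (-(2 * (τ * φ₁)) + (φ₁ - φ₂) * τ + 2 * τ) * (G + D)) := by
        rw [← Real.exp_add, ← Real.exp_add, ← Real.exp_add]
        congr 4
        ring
    _ ≤ _ := by
        gcongr
        nlinarith

/-- Quantitative uniqueness from Cauchy data for smooth functions, before optimizing in `τ`. -/
theorem core_estimate {d : ℕ} {θ M B : ℝ} (hθ : 0 < θ) (hB : 0 ≤ B) (hM : 1 ≤ M) :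
    ∃ C g : ℝ, 0 < C ∧ 0 < g ∧
      ∀ (S : ℝ) (A : Rn d → Rn d →L[ℝ] Rn d) (b : Rn d → Rn d) (c u : Rn d → ℝ),
      1 ≤ S → ContDiff ℝ 1 A → ContDiff ℝ 1 b → ContDiff ℝ 1 c → ContDiff ℝ 2 u →
      (∀ y ∈ closedHalfBall d (1 / 3), CoefBounds θ M B S A b c y) →
      ∀ τ, C * S ≤ τ →
      ∫ y in halfBall d (1 / 256), u y ^ 2
        ≤ C * (Real.exp (-g * τ) * (∫ y in halfBall d (1 / 3), u y ^ 2)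
          + Real.exp (3 * τ) * ((∫ y in halfBall d (1 / 3), opL A b c u y ^ 2) + flatData u)) := by
  obtain ⟨C4, hC4, hcac⟩ := caccioppoli (d := d) hθ hB hM
  obtain ⟨Cχ, hCχ0, hCχ⟩ := exists_cutoff_bound d
  set μ : ℝ := 1 + 2000 * (d + 1) ^ 2 * M ^ 2 / θ ^ 2 with hμdef
  have hμ : 1 ≤ μ := le_add_of_nonneg_right (by positivity)
  have hμM : 2000 * (d + 1) ^ 2 * M ^ 2 ≤ θ ^ 2 * μ := by
    have : θ ^ 2 * μ = θ ^ 2 + 2000 * (d + 1) ^ 2 * M ^ 2 := by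
      rw [hμdef]; field_simp
    nlinarith [sq_nonneg θ]
  set φ₁ := Real.exp (μ * -(1 / 100))
  set φ₂ := Real.exp (μ * -(1 / 16))
  have hφ : φ₂ < φ₁ := Real.exp_lt_exp.2 (by linarith)
  have hφ₁ : φ₁ ≤ 1 := Real.exp_le_one_iff.2 (by linarith)
  set C₂ := 144 * (B + (d + 1) * M) ^ 2 * Cχ ^ 2 with hC₂
  set C₃ := 109 * M ^ 2 * (μ ^ 3 * (2 * (Cχ + 3) ^ 2 + 1)) with hC₃
  set Z := (12 + C₂ * (1 + C4) + C₃) * (24 / (φ₁ - φ₂) ^ 4) with hZ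
  have hg : 0 < φ₁ - φ₂ := by linarith
  have hZ0 : 0 ≤ Z := by positivity
  set C0 := (B + μ + 1) * Real.exp μ with hC0
  have hC01 : 1 ≤ C0 := by
    have : 1 ≤ Real.exp μ := Real.one_le_exp (by linarith)
    rw [hC0]
    nlinarith
  -- A single constant serves twice: `Z` bounds the right-hand side and `C0` is the threshold for τ.
  refine ⟨Z + C0, φ₁ - φ₂, by positivity, hg, ?_⟩
  intro S A b c u hS hA hb hc hu hbd τ hτ
  have hτ' : (B + μ + 1) * Real.exp μ * S ≤ τ := by
    refine le_trans ?_ hτ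
    gcongr
    exact le_add_of_nonneg_left hZ0
  have hSτ : S ≤ τ := le_trans (le_mul_of_one_le_left (by linarith) hC01) hτ'
  have hcar := carleman_cutoff hθ hB hS hM hμ hμM hτ' hCχ0 hCχ hA hb hc hu hbd
  have hca := hcac S A b c u hS hA hb.continuous hc.continuous hu hbd
  have hU0 : 0 ≤ ∫ y in halfBall d (1 / 3), u y ^ 2 := integral_nonneg fun y => sq_nonneg _
  have hG0 : 0 ≤ ∫ y in halfBall d (1 / 3), opL A b c u y ^ 2 := integral_nonneg fun y => sq_nonneg _
  have hD0 : 0 ≤ flatData u := integral_nonneg fun y => by positivity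
  have := collect_terms (C₁ := 12) (C₂ := C₂) (C₃ := C₃) hS hSτ hφ (Real.exp_pos _) hφ₁
    (Real.exp_pos _) (by norm_num) (by positivity) (by positivity) hC4.le hU0 hG0 hD0
    (hcar.trans_eq (by rw [hC₂, hC₃]; ring)) hca
  refine this.trans ?_
  gcongr
  linarith

/-! ### Mollification of bounded functions with bounded weak derivatives. -/

section mollify

open scoped Convolution

variable {d : ℕ}

/-- The convolution of `f` with a normalized bump function. -/
noncomputable def mollify (φ : ContDiffBump (0 : Rn d)) (f : Rn d → ℝ) : Rn d → ℝ :=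
  φ.normed volume ⋆[ContinuousLinearMap.lsmul ℝ ℝ, volume] f

lemma mollify_apply (φ : ContDiffBump (0 : Rn d)) (f : Rn d → ℝ) (y : Rn d) :
    mollify φ f y = ∫ t, φ.normed volume (y - t) * f t :=
  convolution_lsmul_swap

lemma contDiff_mollify (φ : ContDiffBump (0 : Rn d)) {f : Rn d → ℝ} (hf : LocallyIntegrable f) :
    ContDiff ℝ 1 (mollify φ f) :=
  φ.hasCompactSupport_normed.contDiff_convolution_left (n := 1) _ φ.contDiff_normed hf

lemma integral_normed_sub (φ : ContDiffBump (0 : Rn d)) (y : Rn d) :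
    ∫ t, φ.normed volume (y - t) = 1 := by
  rw [integral_sub_left_eq_self (fun t => φ.normed volume t) volume y, φ.integral_normed]

lemma integrable_normed_sub (φ : ContDiffBump (0 : Rn d)) (y : Rn d) :
    Integrable fun t => φ.normed volume (y - t) :=
  φ.integrable_normed.comp_sub_left y

lemma abs_integral_normed_mul_le (φ : ContDiffBump (0 : Rn d)) {f : Rn d → ℝ} {N : ℝ}
    (hN : ∀ᵐ t, |f t| ≤ N) (y : Rn d) : |∫ t, φ.normed volume (y - t) * f t| ≤ N := by
  calc |∫ t, φ.normed volume (y - t) * f t| ≤ ∫ t, φ.normed volume (y - t) * N := by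
        rw [← Real.norm_eq_abs]
        refine norm_integral_le_of_norm_le ((integrable_normed_sub φ y).mul_const N) ?_
        filter_upwards [hN] with t ht
        rw [Real.norm_eq_abs, abs_mul, abs_of_nonneg (φ.nonneg_normed _)]
        gcongr
        exact φ.nonneg_normed _
    _ = N := by rw [integral_mul_const, integral_normed_sub, one_mul]

lemma fderiv_mollify_apply (φ : ContDiffBump (0 : Rn d)) {f : Rn d → ℝ} (hf : LocallyIntegrable f)
    (y v : Rn d) : fderiv ℝ (mollify φ f) y v
      = ∫ t, f t * fderiv ℝ (φ.normed volume) (y - t) v := by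
  have hφ : ContDiff ℝ 1 (φ.normed volume) := φ.contDiff_normed (n := 1)
  have h1 : mollify φ f
      = f ⋆[(ContinuousLinearMap.lsmul ℝ ℝ).flip, volume] (φ.normed volume) := by
    rw [mollify, ← convolution_flip]
  rw [h1, (φ.hasCompactSupport_normed.hasFDerivAt_convolution_right _ hf hφ y).fderiv,
    convolution_precompR_apply _ hf (φ.hasCompactSupport_normed.fderiv ℝ)
      (hφ.continuous_fderiv one_ne_zero)]
  simp [convolution_def, mul_comm]

lemma ae_abs_indicator_le {U : Set (Rn d)} (hU : MeasurableSet U) {f : Rn d → ℝ} {N : ℝ}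
    (hN : 0 ≤ N) (h : eLpNorm f ∞ (volume.restrict U) ≤ ENNReal.ofReal N) :
    ∀ᵐ t, |U.indicator f t| ≤ N := by
  have h1 : ∀ᵐ t ∂(volume.restrict U), |f t| ≤ N := by
    rw [eLpNorm_exponent_top] at h
    filter_upwards [ae_le_eLpNormEssSup (f := f) (μ := volume.restrict U)] with t ht
    have := ht.trans h
    rwa [← ofReal_norm, ENNReal.ofReal_le_ofReal_iff hN] at this
  rw [ae_restrict_iff' hU] at h1
  filter_upwards [h1] with t ht
  by_cases htU : t ∈ U
  · simpa [htU] using ht htU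
  · simpa [htU] using hN

lemma locallyIntegrable_indicator {U : Set (Rn d)} (hU : MeasurableSet U) {f : Rn d → ℝ} {N : ℝ}
    (hN : 0 ≤ N) (hf : AEStronglyMeasurable f (volume.restrict U))
    (h : eLpNorm f ∞ (volume.restrict U) ≤ ENNReal.ofReal N) :
    LocallyIntegrable (U.indicator f) := by
  have hm : AEStronglyMeasurable (U.indicator f) := (aestronglyMeasurable_indicator_iff hU).2 hf
  exact (memLp_top_of_bound hm N (ae_abs_indicator_le hU hN h)).locallyIntegrable le_top

lemma norm_le_of_abs_single_le {L : Rn d →L[ℝ] ℝ} {N : ℝ}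
    (h : ∀ i, |L (EuclideanSpace.single i 1)| ≤ N) : ‖L‖ ≤ (d + 1) * N := by
  have hN : 0 ≤ N := (abs_nonneg _).trans (h 0)
  refine L.opNorm_le_bound (by positivity) fun x => ?_
  have hx : x = ∑ k, x k • EuclideanSpace.single k (1 : ℝ) := by
    ext i
    simp [Finset.sum_apply, Pi.single_apply]
  calc ‖L x‖ = ‖∑ k, x k * L (EuclideanSpace.single k 1)‖ := by
        conv_lhs => rw [hx]
        simp
    _ ≤ ∑ k, ‖x k * L (EuclideanSpace.single k 1)‖ := norm_sum_le _ _
    _ ≤ ∑ _k : Fin (d + 1), ‖x‖ * N := by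
        gcongr with k
        rw [norm_mul]
        gcongr
        · exact PiLp.norm_apply_le x k
        · exact h k
    _ = (d + 1) * N * ‖x‖ := by simp; ring

/-- A mollified `W^{1,∞}` function has the expected `C¹` bounds away from the boundary. -/
lemma norm_fderiv_mollify_le {U : Set (Rn d)} (hU : MeasurableSet U) {f : Rn d → ℝ} {N : ℝ}
    (hN : 0 ≤ N) (hf : W1InftyNormLE U f N) (φ : ContDiffBump (0 : Rn d)) {y : Rn d}
    (hy : Metric.closedBall y φ.rOut ⊆ U) :
    ‖fderiv ℝ (mollify φ (U.indicator f)) y‖ ≤ (d + 1) * N := by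
  obtain ⟨hf1, hf2, hf3⟩ := hf
  have hloc := locallyIntegrable_indicator hU hN hf1.1 hf2
  refine norm_le_of_abs_single_le fun i => ?_
  obtain ⟨g, hg1, hg2, hg3⟩ := hf3 i
  set Φ : Rn d → ℝ := fun t => φ.normed volume (y - t) with hΦ
  have hφ : ContDiff ℝ ∞ (φ.normed volume : Rn d → ℝ) := φ.contDiff_normed
  have hΦC : ContDiff ℝ ∞ Φ := hφ.comp (contDiff_const.sub contDiff_id)
  have hΦ0 : ∀ t ∉ Metric.closedBall y φ.rOut, Φ t = 0 := by
    intro t ht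
    have : y - t ∉ Function.support (φ.normed volume) := by
      rw [φ.support_normed_eq]
      intro h
      apply ht
      rw [mem_ball_zero_iff] at h
      rw [Metric.mem_closedBall, dist_eq_norm, norm_sub_rev]
      exact h.le
    simpa [hΦ] using this
  have hΦs : tsupport Φ ⊆ Metric.closedBall y φ.rOut := by
    refine closure_minimal (fun t ht => ?_) Metric.isClosed_closedBall
    by_contra h
    exact ht (hΦ0 t h)
  have hΦc : HasCompactSupport Φ := HasCompactSupport.intro (isCompact_closedBall y φ.rOut) hΦ0
  -- The reflected bump centred at y is an admissible test function because the ball lies in U. The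
  -- sign from differentiating in t instead of y cancels the sign in the weak derivative, so the
  -- derivative of the mollification is the mollification of g.
  have hw := hg1 Φ hΦC hΦc (hΦs.trans hy)
  have hd : ∀ t, partialD i Φ t
      = -(fderiv ℝ (φ.normed volume) (y - t) (EuclideanSpace.single i 1)) := by
    intro t
    have h1 : HasFDerivAt (fun t : Rn d => y - t) (-ContinuousLinearMap.id ℝ (Rn d)) t :=
      (hasFDerivAt_id t).const_sub y
    have h2 := ((hφ.differentiable (by simp) (y - t)).hasFDerivAt).comp t h1
    have h3 : fderiv ℝ Φ t = _ := h2.fderiv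
    rw [partialD, h3]
    simp
  have key : fderiv ℝ (mollify φ (U.indicator f)) y (EuclideanSpace.single i 1)
      = ∫ t, φ.normed volume (y - t) * U.indicator g t := by
    rw [fderiv_mollify_apply φ hloc]
    have e1 : (∫ t, U.indicator f t * fderiv ℝ (φ.normed volume) (y - t)
        (EuclideanSpace.single i 1)) = -∫ t in U, f t * partialD i Φ t := by
      rw [← integral_indicator hU, ← integral_neg]
      congr 1 with t
      by_cases ht : t ∈ U <;> simp [ht, hd]
    have e2 : (∫ t, φ.normed volume (y - t) * U.indicator g t) = ∫ t in U, g t * Φ t := by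
      rw [← integral_indicator hU]
      congr 1 with t
      by_cases ht : t ∈ U <;> simp [ht, hΦ, mul_comm]
    rw [e1, e2, hw, neg_neg]
  rw [key]
  exact abs_integral_normed_mul_le φ (ae_abs_indicator_le hU hN hg3) y

/-- A sequence of bump functions shrinking to a point. -/
noncomputable def bumpSeq (d : ℕ) (k : ℕ) : ContDiffBump (0 : Rn d) :=
  ⟨1 / (2 * (k + 1)), 1 / (k + 1), by positivity, by
    rw [div_lt_div_iff₀ (by positivity) (by positivity)]
    have : (0 : ℝ) < k + 1 := by positivity
    linarith⟩

lemma tendsto_bumpSeq_rOut : Filter.Tendsto (fun k => (bumpSeq d k).rOut) Filter.atTop (nhds 0) :=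
  tendsto_one_div_add_atTop_nhds_zero_nat

lemma ae_tendsto_mollify {f : Rn d → ℝ} (hf : LocallyIntegrable f) :
    ∀ᵐ y, Filter.Tendsto (fun k => mollify (bumpSeq d k) f y) Filter.atTop (nhds (f y)) := by
  refine ContDiffBump.ae_convolution_tendsto_right_of_locallyIntegrable (K := 2)
    tendsto_bumpSeq_rOut (Filter.Eventually.of_forall fun k => ?_) hf
  simp only [bumpSeq]
  rw [mul_one_div, div_le_div_iff₀ (by positivity) (by positivity)]
  linarith

end mollify

/-! ### The coefficients as operator fields, and extension to the whole space. -/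

section coefficients

variable {d : ℕ}

lemma norm_sum_smul_le {ι V : Type*} [Fintype ι] [NormedAddCommGroup V] [NormedSpace ℝ V]
    {f : ι → ℝ} {v : ι → V} {N : ℝ} (hv : ∀ i, ‖v i‖ ≤ 1) (hf : ∀ i, |f i| ≤ N) :
    ‖∑ i, f i • v i‖ ≤ Fintype.card ι * N := by
  calc ‖∑ i, f i • v i‖ ≤ ∑ i, ‖f i • v i‖ := norm_sum_le _ _
    _ ≤ ∑ _i : ι, N := by
        gcongr with i
        rw [norm_smul]
        exact (mul_le_of_le_one_right (norm_nonneg _) (hv i)).trans (hf i)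
    _ = Fintype.card ι * N := by simp

lemma norm_fderiv_sum_smul_le {ι V : Type*} [Fintype ι] [NormedAddCommGroup V] [NormedSpace ℝ V]
    {f : ι → Rn d → ℝ} {v : ι → V} {N : ℝ} {y : Rn d} (hv : ∀ i, ‖v i‖ ≤ 1)
    (hd : ∀ i, DifferentiableAt ℝ (f i) y) (hf : ∀ i, ‖fderiv ℝ (f i) y‖ ≤ N) :
    ‖fderiv ℝ (fun x => ∑ i, f i x • v i) y‖ ≤ Fintype.card ι * N := by
  have h : HasFDerivAt (fun x => ∑ i, f i x • v i) (∑ i, (fderiv ℝ (f i) y).smulRight (v i)) y :=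
    HasFDerivAt.fun_sum fun i _ => (hd i).hasFDerivAt.smul_const (v i)
  rw [h.fderiv]
  calc ‖∑ i, (fderiv ℝ (f i) y).smulRight (v i)‖
      ≤ ∑ i, ‖(fderiv ℝ (f i) y).smulRight (v i)‖ := norm_sum_le _ _
    _ ≤ ∑ _i : ι, N := by
        gcongr with i
        rw [ContinuousLinearMap.norm_smulRight_apply]
        exact (mul_le_of_le_one_right (norm_nonneg _) (hv i)).trans (hf i)
    _ = Fintype.card ι * N := by simp

/-- The elementary matrices, as endomorphisms. -/
noncomputable def matUnit (s : Fin (d + 1) × Fin (d + 1)) : Rn d →L[ℝ] Rn d :=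
  (innerSL ℝ (EuclideanSpace.single s.2 (1 : ℝ))).smulRight (EuclideanSpace.single s.1 (1 : ℝ))

lemma norm_matUnit_le (s : Fin (d + 1) × Fin (d + 1)) : ‖matUnit s‖ ≤ 1 := by
  rw [matUnit, ContinuousLinearMap.norm_smulRight_apply, innerSL_apply_norm]
  simp

/-- The symmetrized coefficient matrix as a field of endomorphisms. -/
noncomputable def coefMat (a : Fin (d + 1) → Fin (d + 1) → Rn d → ℝ) (y : Rn d) :
    Rn d →L[ℝ] Rn d :=
  ∑ s : Fin (d + 1) × Fin (d + 1), ((a s.1 s.2 y + a s.2 s.1 y) / 2) • matUnit s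

/-- The vector field with given components. -/
noncomputable def coefVec (b : Fin (d + 1) → Rn d → ℝ) (y : Rn d) : Rn d :=
  ∑ i, b i y • EuclideanSpace.single i (1 : ℝ)

lemma inner_coefVec (b : Fin (d + 1) → Rn d → ℝ) (y p : Rn d) :
    ⟪coefVec b y, p⟫_ℝ = ∑ i, b i y * p i := by
  simp [coefVec, sum_inner, real_inner_smul_left, EuclideanSpace.inner_single_left]

variable {a : Fin (d + 1) → Fin (d + 1) → Rn d → ℝ}

lemma inner_coefMat (y x z : Rn d) :
    ⟪coefMat a y x, z⟫_ℝ = ∑ i, ∑ j, (a i j y + a j i y) / 2 * x j * z i := by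
  simp only [coefMat, sum_apply, sum_inner, Fintype.sum_prod_type]
  refine Finset.sum_congr rfl fun i _ => Finset.sum_congr rfl fun j _ => ?_
  simp [matUnit, real_inner_smul_left, EuclideanSpace.inner_single_left]
  ring

lemma coefMat_symm (y x z : Rn d) : ⟪coefMat a y x, z⟫_ℝ = ⟪x, coefMat a y z⟫_ℝ := by
  rw [real_inner_comm (coefMat a y z), inner_coefMat, inner_coefMat, Finset.sum_comm]
  refine Finset.sum_congr rfl fun i _ => Finset.sum_congr rfl fun j _ => ?_
  ring

lemma sum_symmetrize {n : ℕ} (f h : Fin n → Fin n → ℝ) (hh : ∀ i j, h i j = h j i) :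
    ∑ i, ∑ j, (f i j + f j i) / 2 * h i j = ∑ i, ∑ j, f i j * h i j := by
  have h1 : ∑ i, ∑ j, f j i * h i j = ∑ i, ∑ j, f i j * h i j := by
    rw [Finset.sum_comm]
    refine Finset.sum_congr rfl fun i _ => Finset.sum_congr rfl fun j _ => ?_
    rw [hh]
  have h2 : ∑ i, ∑ j, (f i j + f j i) / 2 * h i j
      = (∑ i, ∑ j, f i j * h i j + ∑ i, ∑ j, f j i * h i j) / 2 := by
    rw [← Finset.sum_add_distrib, Finset.sum_div]
    refine Finset.sum_congr rfl fun i _ => ?_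
    rw [← Finset.sum_add_distrib, Finset.sum_div]
    refine Finset.sum_congr rfl fun j _ => ?_
    ring
  rw [h2, h1]
  ring

lemma inner_coefMat_self (y x : Rn d) : ⟪coefMat a y x, x⟫_ℝ = ∑ i, ∑ j, a i j y * x i * x j := by
  rw [inner_coefMat]
  have := sum_symmetrize (fun i j => a i j y) (fun i j => x i * x j) fun i j => mul_comm _ _
  simp only [← mul_assoc] at this
  rw [← this]
  refine Finset.sum_congr rfl fun i _ => Finset.sum_congr rfl fun j _ => ?_
  ring

/-- No symmetry of a_ij is assumed. Replacing the matrix by its symmetric part is harmless because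
it is only contracted with a symmetric Hessian, and the quadratic form is unchanged as well. -/
lemma tr_coefMat_comp (y : Rn d) {H : Rn d →L[ℝ] Rn d}
    (hH : ∀ x z, ⟪H x, z⟫_ℝ = ⟪x, H z⟫_ℝ) :
    tr ((coefMat a y).comp H) = ∑ i, ∑ j, a i j y
      * ⟪H (EuclideanSpace.single i 1), EuclideanSpace.single j 1⟫_ℝ := by
  rw [← sum_symmetrize (fun i j => a i j y) (fun i j =>
    ⟪H (EuclideanSpace.single i 1), EuclideanSpace.single j 1⟫_ℝ)
    fun i j => by rw [hH, real_inner_comm]]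
  have h1 : ∀ k, (coefMat a y).comp H (EuclideanSpace.single k 1) k
      = ∑ j, (a k j y + a j k y) / 2
        * ⟪H (EuclideanSpace.single k 1), EuclideanSpace.single j 1⟫_ℝ := by
    intro k
    have := inner_coefMat (a := a) y (H (EuclideanSpace.single k 1)) (EuclideanSpace.single k 1)
    rw [EuclideanSpace.inner_single_right] at this
    simp only [conj_trivial, one_mul] at this
    rw [ContinuousLinearMap.comp_apply, this, Finset.sum_eq_single k]
    · refine Finset.sum_congr rfl fun j _ => ?_
      simp [EuclideanSpace.inner_single_right]
    · intro i _ hik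
      simp [hik]
    · simp
  rw [tr]
  exact Finset.sum_congr rfl fun k _ => h1 k

lemma contDiffOn_coefMat {U : Set (Rn d)} {M : ℝ} (ha : ∀ i j, C1NormLE U (a i j) M) :
    ContDiffOn ℝ 1 (coefMat a) U :=
  ContDiffOn.sum fun s _ => ContDiffOn.smul
    (((ha s.1 s.2).1.add (ha s.2 s.1).1).div_const 2) contDiffOn_const

lemma norm_coefMat_le {U : Set (Rn d)} {M : ℝ} (ha : ∀ i j, C1NormLE U (a i j) M) {y : Rn d}
    (hy : y ∈ U) : ‖coefMat a y‖ ≤ (d + 1) ^ 2 * M := by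
  refine (norm_sum_smul_le norm_matUnit_le (N := M) fun s => ?_).trans_eq ?_
  · rw [abs_div, abs_two]
    have h1 := ((ha s.1 s.2).2 y hy).1
    have h2 := ((ha s.2 s.1).2 y hy).1
    have h3 := abs_add_le (a s.1 s.2 y) (a s.2 s.1 y)
    linarith
  · rw [Fintype.card_prod, Fintype.card_fin]
    push_cast
    ring

lemma norm_fderiv_coefMat_le {U : Set (Rn d)} (hU : IsOpen U) {M : ℝ}
    (ha : ∀ i j, C1NormLE U (a i j) M) {y : Rn d} (hy : y ∈ U) :
    ‖fderiv ℝ (coefMat a) y‖ ≤ (d + 1) ^ 2 * M := by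
  have hd : ∀ i j, DifferentiableAt ℝ (a i j) y := fun i j =>
    ((ha i j).1.differentiableOn one_ne_zero).differentiableAt (hU.mem_nhds hy)
  refine (norm_fderiv_sum_smul_le norm_matUnit_le (N := M) (fun s => ?_) fun s => ?_).trans_eq ?_
  · have := hd s.1 s.2
    have := hd s.2 s.1
    fun_prop
  · have h : HasFDerivAt (fun x => (a s.1 s.2 x + a s.2 s.1 x) / 2)
        ((2 : ℝ)⁻¹ • (fderiv ℝ (a s.1 s.2) y + fderiv ℝ (a s.2 s.1) y)) y := by
      simp only [div_eq_mul_inv]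
      exact ((hd _ _).hasFDerivAt.add (hd _ _).hasFDerivAt).mul_const _
    rw [h.fderiv, norm_smul, Real.norm_of_nonneg (by norm_num)]
    have h1 := ((ha s.1 s.2).2 y hy).2
    have h2 := ((ha s.2 s.1).2 y hy).2
    have h3 := norm_add_le (fderiv ℝ (a s.1 s.2) y) (fderiv ℝ (a s.2 s.1) y)
    linarith
  · rw [Fintype.card_prod, Fintype.card_fin]
    push_cast
    ring

/-- A smooth function near a closed set extends to the whole space. -/
lemma exists_contDiff_extension {V : Type*} [NormedAddCommGroup V] [NormedSpace ℝ V]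
    {U K : Set (Rn d)} (hU : IsOpen U) (hK : IsClosed K) (hKU : K ⊆ U) {n : ℕ∞} {F : Rn d → V}
    (hF : ContDiffOn ℝ n F U) : ∃ G : Rn d → V, ContDiff ℝ n G ∧ ∀ y ∈ K, G =ᶠ[nhds y] F := by
  obtain ⟨ζ, h0, h1, -⟩ := exists_contMDiffMap_zero_one_nhds_of_isClosed
    (modelWithCornersSelf ℝ (Rn d)) (n := n) hU.isClosed_compl hK
    (Set.disjoint_left.2 fun x hx hxK => hx (hKU hxK))
  refine ⟨fun x => ζ x • F x, ?_, fun y hy => ?_⟩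
  · rw [contDiff_iff_contDiffAt]
    intro x
    by_cases hx : x ∈ U
    · exact (ζ.contMDiff.contDiff.contDiffAt).smul (hF.contDiffAt (hU.mem_nhds hx))
    · have h2 : (fun x => ζ x • F x) =ᶠ[nhds x] fun _ => 0 := by
        filter_upwards [eventually_nhdsSet_iff_forall.1 h0 x hx] with z hz
        simp [hz]
      exact contDiffAt_const.congr_of_eventuallyEq h2
  · filter_upwards [eventually_nhdsSet_iff_forall.1 h1 y hy] with z hz
    simp [hz]

end coefficients

/-! ### The estimate on a translated half ball. -/

section shift

variable {d : ℕ}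

lemma W1InftyNormLE.mono {U : Set (Rn d)} {f : Rn d → ℝ} {N N' : ℝ} (h : W1InftyNormLE U f N)
    (hN : N ≤ N') : W1InftyNormLE U f N' := by
  obtain ⟨h1, h2, h3⟩ := h
  refine ⟨h1, h2.trans (ENNReal.ofReal_le_ofReal hN), fun i => ?_⟩
  obtain ⟨g, hg1, hg2, hg3⟩ := h3 i
  exact ⟨g, hg1, hg2, hg3.trans (ENNReal.ofReal_le_ofReal hN)⟩

lemma gradient_comp_add_right (u : Rn d → ℝ) (v y : Rn d) :
    gradient (fun x => u (x + v)) y = gradient u (y + v) := by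
  simp only [gradient, fderiv_comp_add_right]

lemma hess_comp_add_right (u : Rn d → ℝ) (v y : Rn d) :
    hess (fun x => u (x + v)) y = hess u (y + v) := by
  have h : gradient (fun x => u (x + v)) = fun x => gradient u (x + v) :=
    funext (gradient_comp_add_right u v)
  rw [hess, h, fderiv_comp_add_right, hess]

lemma opL_comp_add_right (A : Rn d → Rn d →L[ℝ] Rn d) (b : Rn d → Rn d) (c u : Rn d → ℝ)
    (v y : Rn d) : opL (fun x => A (x + v)) (fun x => b (x + v)) (fun x => c (x + v))
      (fun x => u (x + v)) y = opL A b c u (y + v) := by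
  simp only [opL, hess_comp_add_right, gradient_comp_add_right]

lemma gradient_apply_eq_partialD (u : Rn d → ℝ) (y : Rn d) (i : Fin (d + 1)) :
    gradient u y i = partialD i u y := by
  have h : ⟪gradient u y, EuclideanSpace.single i (1 : ℝ)⟫_ℝ
      = fderiv ℝ u y (EuclideanSpace.single i 1) := InnerProductSpace.toDual_symm_apply
  rw [partialD, ← h, EuclideanSpace.inner_single_right]
  simp

/-- The matrix enters only through its value at y, whereas the extension `G` has to agree with u
near y, since second derivatives are compared. -/
lemma opL_eq_ellipticOp {a : Fin (d + 1) → Fin (d + 1) → Rn d → ℝ} {b : Fin (d + 1) → Rn d → ℝ}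
    {c u G : Rn d → ℝ} {A : Rn d → Rn d →L[ℝ] Rn d} {y : Rn d} (hA : A y = coefMat a y)
    (hG : ContDiff ℝ 2 G) (hGu : G =ᶠ[nhds y] u) :
    opL A (coefVec b) c G y = ellipticOp a b c u y := by
  have h2 : ∀ i j, ⟪hess G y (EuclideanSpace.single i 1), EuclideanSpace.single j 1⟫_ℝ
      = partialD i (partialD j u) y := by
    intro i j
    have e1 : partialD j u =ᶠ[nhds y] fun x => fderiv ℝ G x (EuclideanSpace.single j 1) := by
      filter_upwards [hGu.fderiv (𝕜 := ℝ)] with x hx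
      rw [partialD, hx]
    have e2 : HasFDerivAt (fderiv ℝ G) (fderiv ℝ (fderiv ℝ G) y) y :=
      ((hG.fderiv_right (m := 1) (by norm_num)).differentiable one_ne_zero y).hasFDerivAt
    have e3 : fderiv ℝ (fun x => fderiv ℝ G x (EuclideanSpace.single j 1)) y
        = (fderiv ℝ (fderiv ℝ G) y).flip (EuclideanSpace.single j 1) := by
      rw [(e2.clm_apply (hasFDerivAt_const (EuclideanSpace.single j (1 : ℝ)) y)).fderiv]
      simp
    rw [inner_hess, partialD, e1.fderiv_eq, e3, ContinuousLinearMap.flip_apply]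
  have h1 : ∀ i, gradient G y i = partialD i u y := by
    intro i
    rw [gradient_apply_eq_partialD, partialD, hGu.fderiv_eq, partialD]
  simp only [opL, ellipticOp, hA, tr_coefMat_comp y (hess_symm hG y), inner_coefVec, h2, h1,
    hGu.self_of_nhds]

lemma halfBall_subset_closedHalfBall (r : ℝ) : halfBall d r ⊆ closedHalfBall d r :=
  fun _ hy => ⟨hy.1.le, hy.2.le⟩

lemma isCompact_closedHalfBall (r : ℝ) : IsCompact (closedHalfBall d r) := by
  have h : closedHalfBall d r = Metric.closedBall 0 r ∩ {y | 0 ≤ y (Fin.last d)} := by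
    ext y
    simp [closedHalfBall]
  rw [h]
  exact (isCompact_closedBall _ _).inter_right (isClosed_le continuous_const (by fun_prop))

lemma norm_smul_eN {δ : ℝ} (hδ : 0 ≤ δ) : ‖δ • eN d‖ = δ := by
  simp [eN, norm_smul, abs_of_nonneg hδ]

lemma add_smul_eN_last (y : Rn d) (δ : ℝ) : (y + δ • eN d) (Fin.last d) = y (Fin.last d) + δ := by
  simp [eN]

/-- The radii fit because 1/3 + 1/12 + 1/12 = 1/2, and a ball of radius below δ around a point at
height at least δ stays off the face. The case r = 0 is membership of the centre. -/
lemma closedBall_add_smul_eN_subset {δ r : ℝ} (hδ : 0 < δ) (hδ' : δ < 1 / 12) (hr : r < δ)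
    {y : Rn d} (hy : y ∈ closedHalfBall d (1 / 3)) :
    Metric.closedBall (y + δ • eN d) r ⊆ halfBall d (1 / 2) := by
  intro z hz
  rw [Metric.mem_closedBall, dist_eq_norm] at hz
  have h1 : z = (z - (y + δ • eN d)) + y + δ • eN d := by abel
  constructor
  · have h2 := norm_add₃_le (a := z - (y + δ • eN d)) (b := y) (c := δ • eN d)
    rw [← h1, norm_smul_eN hδ.le] at h2
    have := hy.1
    linarith
  · have h2 := (abs_le.1 ((PiLp.norm_apply_le (z - (y + δ • eN d)) (Fin.last d)).trans hz)).1
    have h3 : (z - (y + δ • eN d)) (Fin.last d) = z (Fin.last d) - (y (Fin.last d) + δ) := by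
      rw [PiLp.sub_apply, add_smul_eN_last]
    rw [h3] at h2
    have := hy.2
    linarith

/-- The estimate on a translate of the half ball, where the solution is smooth. -/
theorem shifted_estimate {θ M K : ℝ} (hθ : 0 < θ) (hK : 0 ≤ K) :
    ∃ C g : ℝ, 0 < C ∧ 0 < g ∧
      ∀ (S : ℝ) (a : Fin (d + 1) → Fin (d + 1) → Rn d → ℝ) (b : Fin (d + 1) → Rn d → ℝ)
        (c u : Rn d → ℝ), 1 ≤ S →
      UniformlyElliptic (halfBall d (1 / 2)) a θ →
      (∀ i j, C1NormLE (halfBall d (1 / 2)) (a i j) M) →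
      (∀ i, W1InftyNormLE (halfBall d (1 / 2)) (b i) (K * S)) →
      W1InftyNormLE (halfBall d (1 / 2)) c (K * S ^ 2) →
      ContDiffOn ℝ 2 u (halfBall d (1 / 2)) →
      (∀ᵐ y ∂(volume.restrict (halfBall d (1 / 2))), ellipticOp a b c u y = 0) →
      ∀ δ : ℝ, 0 < δ → δ < 1 / 12 → ∀ τ, C * S ≤ τ →
      ∫ y in halfBall d (1 / 256), u (y + δ • eN d) ^ 2
        ≤ C * (Real.exp (-g * τ) * (∫ y in halfBall d (1 / 3), u (y + δ • eN d) ^ 2)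
          + Real.exp (3 * τ) * ∫ y' in Metric.ball (0 : Rn' d) (1 / 3),
            (u (flatPoint y' + δ • eN d) ^ 2 + ‖fderiv ℝ u (flatPoint y' + δ • eN d)‖ ^ 2)) := by
  obtain ⟨C, g, hC, hg, hcore⟩ := core_estimate (d := d) (θ := θ) (M := max 1 ((d + 1) ^ 2 * M))
    (B := (d + 1) ^ 2 * K) hθ (by positivity) (le_max_left _ _)
  refine ⟨C, g, hC, hg, ?_⟩
  intro S a b c u hS hell ha hb hc hu heq δ hδ hδ' τ hτ
  set U : Set (Rn d) := halfBall d (1 / 2) with hUdef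
  set v : Rn d := δ • eN d with hv
  have hUo : IsOpen U := isOpen_halfBall d _
  have hUm : MeasurableSet U := hUo.measurableSet
  have hbN : 0 ≤ K * S := by positivity
  have hcN : 0 ≤ K * S ^ 2 := by positivity
  set Q : Set (Rn d) := closedHalfBall d (1 / 3) with hQ
  have hQc : IsCompact Q := isCompact_closedHalfBall _
  have hQU : ∀ y ∈ Q, y + v ∈ U := fun y hy =>
    closedBall_add_smul_eN_subset (δ := δ) (r := 0) hδ hδ' hδ hy
      (Metric.mem_closedBall_self le_rfl)
  have hKc : IsClosed ((fun y => y + v) '' Q) := (hQc.image (by fun_prop)).isClosed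
  have hKU : (fun y => y + v) '' Q ⊆ U := by
    rintro _ ⟨y, hy, rfl⟩
    exact hQU y hy
  -- Only b and c need mollifying: the matrix field and u are regular in the open half ball and are
  -- extended from a neighbourhood of the translated compact set.
  obtain ⟨A, hA, hAeq⟩ := exists_contDiff_extension hUo hKc hKU (n := 1) (contDiffOn_coefMat ha)
  obtain ⟨G, hG, hGeq⟩ := exists_contDiff_extension hUo hKc hKU (n := 2) hu
  replace hAeq : ∀ y ∈ Q, A =ᶠ[nhds (y + v)] coefMat a := fun y hy =>
    hAeq _ (Set.mem_image_of_mem _ hy)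
  replace hGeq : ∀ y ∈ Q, G =ᶠ[nhds (y + v)] u := fun y hy => hGeq _ (Set.mem_image_of_mem _ hy)
  have hbl : ∀ i, LocallyIntegrable (U.indicator (b i)) := fun i =>
    locallyIntegrable_indicator hUm hbN (hb i).1.1 (hb i).2.1
  have hcl : LocallyIntegrable (U.indicator c) :=
    locallyIntegrable_indicator hUm hcN hc.1.1 hc.2.1
  set bk : ℕ → Fin (d + 1) → Rn d → ℝ := fun k i => mollify (bumpSeq d k) (U.indicator (b i))
    with hbk
  set ck : ℕ → Rn d → ℝ := fun k => mollify (bumpSeq d k) (U.indicator c) with hck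
  have hbkC : ∀ k i, ContDiff ℝ 1 (bk k i) := fun k i => contDiff_mollify _ (hbl i)
  have hckC : ∀ k, ContDiff ℝ 1 (ck k) := fun k => contDiff_mollify _ hcl
  have hbvC : ∀ k, ContDiff ℝ 1 (coefVec (bk k)) := fun k =>
    ContDiff.sum fun i _ => (hbkC k i).smul contDiff_const
  have hbkN : ∀ k i y, |bk k i y| ≤ K * S := fun k i y => by
    rw [hbk]; simp only [mollify_apply]
    exact abs_integral_normed_mul_le _ (ae_abs_indicator_le hUm hbN (hb i).2.1) y
  have hckN : ∀ k y, |ck k y| ≤ K * S ^ 2 := fun k y => by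
    rw [hck]; simp only [mollify_apply]
    exact abs_integral_normed_mul_le _ (ae_abs_indicator_le hUm hcN hc.2.1) y
  have hd1 : (1 : ℝ) ≤ d + 1 := by simp
  have hbvN : ∀ k y, ‖coefVec (bk k) y‖ ≤ (d + 1) ^ 2 * K * S := by
    intro k y
    refine (norm_sum_smul_le (N := K * S) (fun i => by simp) fun i => hbkN k i y).trans ?_
    rw [Fintype.card_fin]
    push_cast
    have : (d + 1 : ℝ) ≤ (d + 1) ^ 2 := le_self_pow₀ hd1 two_ne_zero
    calc (d + 1) * (K * S) ≤ (d + 1) ^ 2 * (K * S) := by gcongr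
      _ = _ := by ring
  have hckN' : ∀ k y, |ck k y| ≤ (d + 1) ^ 2 * K * S ^ 2 := by
    intro k y
    refine (hckN k y).trans ?_
    rw [mul_assoc]
    exact le_mul_of_one_le_left hcN (one_le_pow₀ hd1)
  have hball : ∀ᶠ k in Filter.atTop, ∀ y ∈ Q,
      Metric.closedBall (y + v) (bumpSeq d k).rOut ⊆ U := by
    filter_upwards [(tendsto_bumpSeq_rOut (d := d)).eventually_lt_const hδ] with k hk y hy
    exact closedBall_add_smul_eN_subset hδ hδ' hk hy
  have hcoef : ∀ᶠ k in Filter.atTop, ∀ y ∈ Q, CoefBounds θ (max 1 ((d + 1) ^ 2 * M))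
      ((d + 1) ^ 2 * K) S (fun x => A (x + v)) (fun x => coefVec (bk k) (x + v))
      (fun x => ck k (x + v)) y := by
    filter_upwards [hball] with k hk y hy
    refine ⟨?_, ?_, ?_, ?_, hbvN k _, ?_, hckN' k _, ?_⟩
    · rw [(hAeq y hy).self_of_nhds]
      exact (norm_coefMat_le ha (hQU y hy)).trans (le_max_right _ _)
    · rw [fderiv_comp_add_right, (hAeq y hy).fderiv_eq]
      exact (norm_fderiv_coefMat_le hUo ha (hQU y hy)).trans (le_max_right _ _)
    · rw [(hAeq y hy).self_of_nhds]
      exact coefMat_symm _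
    · intro x
      rw [(hAeq y hy).self_of_nhds, inner_coefMat_self]
      exact hell _ (hQU y hy) x
    · rw [fderiv_comp_add_right]
      refine (norm_fderiv_sum_smul_le (N := (d + 1) * (K * S)) (fun i => by simp)
        (fun i => (hbkC k i).differentiable one_ne_zero _) fun i =>
          norm_fderiv_mollify_le hUm hbN (hb i) _ (hk y hy)).trans_eq ?_
      rw [Fintype.card_fin]
      push_cast
      ring
    · rw [fderiv_comp_add_right]
      refine (norm_fderiv_mollify_le hUm hcN hc _ (hk y hy)).trans ?_
      have : (d + 1 : ℝ) ≤ (d + 1) ^ 2 := le_self_pow₀ hd1 two_ne_zero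
      calc (d + 1) * (K * S ^ 2) ≤ (d + 1) ^ 2 * (K * S ^ 2) := by gcongr
        _ = _ := by ring
  set w : Rn d → ℝ := fun x => G (x + v) with hw
  have hwC : ContDiff ℝ 2 w := hG.comp (contDiff_id.add contDiff_const)
  set F : ℕ → Rn d → ℝ := fun k => opL (fun x => A (x + v)) (fun x => coefVec (bk k) (x + v))
      (fun x => ck k (x + v)) w with hF
  have hFc : ∀ k, Continuous (F k) := fun k =>
    continuous_opL (hA.continuous.comp (by fun_prop)) ((hbvC k).continuous.comp (by fun_prop))
      ((hckC k).continuous.comp (by fun_prop)) hwC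
  have hH : MeasurableSet (halfBall d (1 / 3)) := (isOpen_halfBall d _).measurableSet
  have hHQ : halfBall d (1 / 3) ⊆ Q := halfBall_subset_closedHalfBall _
  have hfin : volume (halfBall d (1 / 3)) ≠ ⊤ :=
    ((measure_mono hHQ).trans_lt hQc.measure_lt_top).ne
  -- The derivatives of u are fixed and only b and c vary with `k`, so almost everywhere convergence
  -- of the mollified coefficients forces the residual to the value of the original operator on u,
  -- which is 0. The almost everywhere statements are pulled back along the translation.
  have hlim : ∀ᵐ y ∂(volume.restrict (halfBall d (1 / 3))),
      Filter.Tendsto (fun k => F k y ^ 2) Filter.atTop (nhds 0) := by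
    have q := (measurePreserving_add_right (volume : Measure (Rn d)) v).quasiMeasurePreserving
    have e1 := q.ae ((ae_restrict_iff' hUm).1 heq)
    have e2 := q.ae (ae_all_iff.2 fun i => ae_tendsto_mollify (hbl i))
    have e3 := q.ae (ae_tendsto_mollify hcl)
    rw [ae_restrict_iff' hH]
    filter_upwards [e1, e2, e3] with y h1 h2 h3 hy
    have hyQ := hHQ hy
    have hyU := hQU y hyQ
    have hop : ∀ k, F k y = ellipticOp a (bk k) (ck k) u (y + v) := fun k => by
      rw [hF]
      simp only
      rw [hw, opL_comp_add_right A (coefVec (bk k)) (ck k) G v y]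
      exact opL_eq_ellipticOp (hAeq y hyQ).self_of_nhds hG (hGeq y hyQ)
    have hbt : ∀ i, Filter.Tendsto (fun k => bk k i (y + v)) Filter.atTop (nhds (b i (y + v))) :=
      fun i => by
        have := h2 i
        rwa [Set.indicator_of_mem hyU] at this
    have hct : Filter.Tendsto (fun k => ck k (y + v)) Filter.atTop (nhds (c (y + v))) := by
      rwa [Set.indicator_of_mem hyU] at h3
    have : Filter.Tendsto (fun k => F k y) Filter.atTop (nhds 0) := by
      rw [← h1 hyU]
      simp only [hop, ellipticOp]
      exact (tendsto_const_nhds.add (tendsto_finsetSum _ fun i _ =>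
        (hbt i).mul tendsto_const_nhds)).add (hct.mul tendsto_const_nhds)
    simpa using this.pow 2
  have hgrad := hwC.gradient_contDiff (m := 1) (by norm_num)
  obtain ⟨N1, hN1⟩ := hQc.exists_bound_of_continuousOn (f := fun y =>
    tr ((A (y + v)).comp (hess w y))) (continuous_tr ((hA.continuous.comp (by fun_prop)).clm_comp
      (hgrad.continuous_fderiv one_ne_zero))).continuousOn
  obtain ⟨N2, hN2⟩ := hQc.exists_bound_of_continuousOn hgrad.continuous.continuousOn
  obtain ⟨N3, hN3⟩ := hQc.exists_bound_of_continuousOn hwC.continuous.continuousOn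
  set N : ℝ := N1 + (d + 1) ^ 2 * K * S * N2 + (d + 1) ^ 2 * K * S ^ 2 * N3 with hN
  -- The bound is uniform in `k` because mollifying does not increase the sup norm; it provides the
  -- dominating constant.
  have hbound : ∀ k, ∀ y ∈ Q, |F k y| ≤ N := by
    intro k y hy
    have t1 : |-tr ((A (y + v)).comp (hess w y))| ≤ N1 := by
      rw [abs_neg]
      exact hN1 y hy
    have t2 : |⟪coefVec (bk k) (y + v), gradient w y⟫_ℝ| ≤ (d + 1) ^ 2 * K * S * N2 :=
      (abs_real_inner_le_norm _ _).trans
        (mul_le_mul (hbvN k _) (hN2 y hy) (norm_nonneg _) (by positivity))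
    have t3 : |ck k (y + v) * w y| ≤ (d + 1) ^ 2 * K * S ^ 2 * N3 := by
      rw [abs_mul]
      exact mul_le_mul (hckN' k _) (hN3 y hy) (abs_nonneg _) (by positivity)
    exact (abs_add_le _ _).trans (add_le_add ((abs_add_le _ _).trans (add_le_add t1 t2)) t3)
  have hL : Filter.Tendsto (fun k => ∫ y in halfBall d (1 / 3), F k y ^ 2) Filter.atTop
      (nhds 0) := by
    have := tendsto_integral_of_dominated_convergence (μ := volume.restrict (halfBall d (1 / 3)))
      (F := fun k y => F k y ^ 2) (f := fun _ => 0) (fun _ => N ^ 2)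
      (fun k => ((hFc k).pow 2).aestronglyMeasurable)
      (integrableOn_const hfin) (fun k => by
        filter_upwards [ae_restrict_mem hH] with y hy
        rw [Real.norm_eq_abs, abs_pow]
        have := hbound k y (hHQ hy)
        gcongr) hlim
    simpa using this
  have hest : ∀ᶠ k in Filter.atTop, ∫ y in halfBall d (1 / 256), w y ^ 2
      ≤ C * (Real.exp (-g * τ) * (∫ y in halfBall d (1 / 3), w y ^ 2)
        + Real.exp (3 * τ) * ((∫ y in halfBall d (1 / 3), F k y ^ 2) + flatData w)) := by
    filter_upwards [hcoef] with k hk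
    exact hcore S _ _ _ w hS (hA.comp (contDiff_id.add contDiff_const))
      ((hbvC k).comp (contDiff_id.add contDiff_const))
      ((hckC k).comp (contDiff_id.add contDiff_const)) hwC hk τ hτ
  have hmain := ge_of_tendsto (((hL.add_const (flatData w)).const_mul (Real.exp (3 * τ))
    |>.const_add (Real.exp (-g * τ) * (∫ y in halfBall d (1 / 3), w y ^ 2))).const_mul C) hest
  rw [zero_add] at hmain
  have hwu : ∀ y ∈ Q, w y = u (y + v) := fun y hy => (hGeq y hy).self_of_nhds
  have i1 : ∫ y in halfBall d (1 / 256), w y ^ 2 = ∫ y in halfBall d (1 / 256), u (y + v) ^ 2 :=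
    setIntegral_congr_fun (isOpen_halfBall d _).measurableSet fun y hy => by
      rw [hwu y ⟨hy.1.le.trans (by norm_num), hy.2.le⟩]
  have i2 : ∫ y in halfBall d (1 / 3), w y ^ 2 = ∫ y in halfBall d (1 / 3), u (y + v) ^ 2 :=
    setIntegral_congr_fun hH fun y hy => by
      rw [hwu y (hHQ hy)]
  have i3 : flatData w = ∫ y' in Metric.ball (0 : Rn' d) (1 / 3),
      (u (flatPoint y' + v) ^ 2 + ‖fderiv ℝ u (flatPoint y' + v)‖ ^ 2) :=
    setIntegral_congr_fun measurableSet_ball fun y' hy' => by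
      have hyQ : flatPoint y' ∈ Q :=
        ⟨by rw [norm_flatPoint]; exact (mem_ball_zero_iff.1 hy').le, (flatPoint_last y').ge⟩
      rw [hwu _ hyQ, hw, gradient_comp_add_right, norm_gradient, (hGeq _ hyQ).fderiv_eq]
  rwa [i1, i2, i3] at hmain

end shift

/-! ### Letting the translation tend to zero. -/

section limit

variable {d : ℕ}

lemma halfBall_subset_flatHalfBall (r : ℝ) : halfBall d r ⊆ flatHalfBall d r :=
  fun _ hy => ⟨hy.1, hy.2.le⟩

lemma flatHalfBall_mem_nhds {r : ℝ} {y : Rn d} (hy : y ∈ halfBall d r) :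
    flatHalfBall d r ∈ nhds y :=
  Filter.mem_of_superset ((isOpen_halfBall d r).mem_nhds hy) (halfBall_subset_flatHalfBall r)

lemma uniqueDiffOn_flatHalfBall {r : ℝ} (hr : 0 < r) : UniqueDiffOn ℝ (flatHalfBall d r) := by
  have h : flatHalfBall d r = Metric.ball 0 r ∩ {y | 0 ≤ y (Fin.last d)} := by
    ext y
    simp [flatHalfBall]
  refine uniqueDiffOn_convex ?_ ⟨(r / 2) • eN d, ?_⟩
  · rw [h]
    refine (convex_ball _ _).inter fun x hx y hy s t hs ht _ => ?_
    have h1 : 0 ≤ x (Fin.last d) := hx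
    have h2 : 0 ≤ y (Fin.last d) := hy
    have h3 : 0 ≤ s * x (Fin.last d) + t * y (Fin.last d) := by positivity
    simpa using h3
  · refine mem_interior_iff_mem_nhds.2 (flatHalfBall_mem_nhds ⟨?_, ?_⟩)
    · rw [norm_smul_eN (by positivity)]
      linarith
    · simpa [eN] using hr

lemma add_smul_eN_mem_closedHalfBall {δ : ℝ} (hδ : 0 ≤ δ) (hδ' : δ ≤ 1 / 12) {y : Rn d}
    (hy : y ∈ closedHalfBall d (1 / 3)) : y + δ • eN d ∈ closedHalfBall d (5 / 12) := by
  constructor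
  · have := norm_add_le y (δ • eN d)
    rw [norm_smul_eN hδ] at this
    have := hy.1
    linarith
  · rw [add_smul_eN_last]
    have := hy.2
    linarith

lemma closedHalfBall_subset_flatHalfBall {r s : ℝ} (h : r < s) :
    closedHalfBall d r ⊆ flatHalfBall d s :=
  fun _ hy => ⟨hy.1.trans_lt h, hy.2⟩

/-- Dominated convergence: for 0 ≤ δ ≤ 1/12 all points stay in the compact half ball of radius 5/12,
where h is bounded. The map `p` is the identity for solid integrals and `flatPoint` for face
integrals. -/
lemma tendsto_setIntegral_add_smul_eN {X : Type*} [TopologicalSpace X] [MeasurableSpace X]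
    [OpensMeasurableSpace X] [SecondCountableTopology X]
    {μ : Measure X} {s : Set X} (hs : MeasurableSet s)
    (hμ : μ s ≠ ⊤) {p : X → Rn d} (hp : Continuous p)
    (hps : ∀ x ∈ s, p x ∈ closedHalfBall d (1 / 3)) {h : Rn d → ℝ}
    (hh : ContinuousOn h (flatHalfBall d (1 / 2))) :
    Filter.Tendsto (fun δ : ℝ => ∫ x in s, h (p x + δ • eN d) ∂μ) (nhdsWithin 0 (Set.Ioi 0))
      (nhds (∫ x in s, h (p x) ∂μ)) := by
  obtain ⟨N, hN⟩ := (isCompact_closedHalfBall (d := d) (5 / 12)).exists_bound_of_continuousOn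
    (hh.mono (closedHalfBall_subset_flatHalfBall (by norm_num)))
  have hδ : ∀ᶠ δ : ℝ in nhdsWithin 0 (Set.Ioi 0), 0 ≤ δ ∧ δ ≤ 1 / 12 := by
    filter_upwards [Ioo_mem_nhdsGT (show (0 : ℝ) < 1 / 12 by norm_num)] with δ hδ
    exact ⟨hδ.1.le, hδ.2.le⟩
  have hmem : ∀ δ : ℝ, 0 ≤ δ ∧ δ ≤ 1 / 12 → ∀ x ∈ s, p x + δ • eN d ∈ closedHalfBall d (5 / 12) :=
    fun δ h x hx => add_smul_eN_mem_closedHalfBall h.1 h.2 (hps x hx)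
  have hsub : closedHalfBall d (5 / 12) ⊆ flatHalfBall d (1 / 2) :=
    closedHalfBall_subset_flatHalfBall (by norm_num)
  refine tendsto_integral_filter_of_dominated_convergence (fun _ => N) ?_ ?_
    (integrableOn_const hμ) ?_
  · filter_upwards [hδ] with δ hδ
    refine ContinuousOn.aestronglyMeasurable ?_ hs
    exact hh.comp (by fun_prop) fun x hx => hsub (hmem δ hδ x hx)
  · filter_upwards [hδ] with δ hδ
    filter_upwards [ae_restrict_mem hs] with x hx
    exact hN _ (hmem δ hδ x hx)
  · filter_upwards [ae_restrict_mem hs] with x hx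
    have h0 : p x ∈ flatHalfBall d (1 / 2) :=
      closedHalfBall_subset_flatHalfBall (by norm_num) (hps x hx)
    refine Filter.Tendsto.comp (hh _ h0) (tendsto_nhdsWithin_iff.2 ⟨?_, ?_⟩)
    · have : Continuous fun δ : ℝ => p x + δ • eN d := by fun_prop
      have := this.tendsto 0
      rw [zero_smul, add_zero] at this
      exact this.mono_left nhdsWithin_le_nhds
    · filter_upwards [hδ] with δ hδ
      exact hsub (hmem δ hδ x hx)

/-- The square of the Cauchy data of a function that is smooth up to the flat face. -/
noncomputable def faceData (u : Rn d → ℝ) : ℝ :=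
  ∫ y' in Metric.ball (0 : Rn' d) (1 / 3),
    (u (flatPoint y') ^ 2 + ‖fderivWithin ℝ u (flatHalfBall d (1 / 2)) (flatPoint y')‖ ^ 2)

lemma setIntegral_shift_le {u : Rn d → ℝ} (hu : MemLp u 2 (volume.restrict (halfBall d (1 / 2))))
    {δ : ℝ} (hδ : 0 < δ) (hδ' : δ < 1 / 12) :
    ∫ y in halfBall d (1 / 3), u (y + δ • eN d) ^ 2 ≤ ∫ y in halfBall d (1 / 2), u y ^ 2 := by
  have hm := measurePreserving_add_right (volume : Measure (Rn d)) (δ • eN d)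
  have he := measurableEmbedding_addRight (δ • eN d)
  have hint : IntegrableOn (fun y => u y ^ 2) (halfBall d (1 / 2)) := hu.integrable_sq
  have hint' := (hm.integrableOn_comp_preimage he).2 hint
  rw [← hm.setIntegral_preimage_emb he (fun y => u y ^ 2)]
  refine setIntegral_mono_set hint' (Filter.Eventually.of_forall fun y => sq_nonneg _)
    (LE.le.eventuallyLE fun y hy => ?_)
  exact closedBall_add_smul_eN_subset (r := 0) hδ hδ' hδ (halfBall_subset_closedHalfBall _ hy)
    (Metric.mem_closedBall_self le_rfl)

/-- The estimate with a free parameter, up to the flat face. -/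
theorem face_estimate {θ M K : ℝ} (hθ : 0 < θ) (hK : 0 ≤ K) :
    ∃ C g : ℝ, 0 < C ∧ 0 < g ∧
      ∀ (S : ℝ) (a : Fin (d + 1) → Fin (d + 1) → Rn d → ℝ) (b : Fin (d + 1) → Rn d → ℝ)
        (c u : Rn d → ℝ), 1 ≤ S →
      UniformlyElliptic (halfBall d (1 / 2)) a θ →
      (∀ i j, C1NormLE (halfBall d (1 / 2)) (a i j) M) →
      (∀ i, W1InftyNormLE (halfBall d (1 / 2)) (b i) (K * S)) →
      W1InftyNormLE (halfBall d (1 / 2)) c (K * S ^ 2) →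
      ContDiffOn ℝ 2 u (flatHalfBall d (1 / 2)) →
      MemLp u 2 (volume.restrict (halfBall d (1 / 2))) →
      (∀ᵐ y ∂(volume.restrict (halfBall d (1 / 2))), ellipticOp a b c u y = 0) →
      ∀ τ, C * S ≤ τ →
      ∫ y in halfBall d (1 / 256), u y ^ 2
        ≤ C * (Real.exp (-g * τ) * (∫ y in halfBall d (1 / 2), u y ^ 2)
          + Real.exp (3 * τ) * faceData u) := by
  obtain ⟨C, g, hC, hg, hshift⟩ := shifted_estimate (d := d) (M := M) hθ hK
  refine ⟨C, g, hC, hg, ?_⟩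
  intro S a b c u hS hell ha hb hc hu hu2 heq τ hτ
  -- The one-sided derivative is continuous up to the face and agrees with the ordinary one at the
  -- shifted points, so the shifted data converge to `faceData`.
  have hfd : ContinuousOn (fderivWithin ℝ u (flatHalfBall d (1 / 2))) (flatHalfBall d (1 / 2)) :=
    hu.continuousOn_fderivWithin (uniqueDiffOn_flatHalfBall (by norm_num)) (by norm_num)
  have hfin : volume (halfBall d (1 / 256)) ≠ ⊤ :=
    ((measure_mono (halfBall_subset_closedHalfBall _)).trans_lt
      (isCompact_closedHalfBall _).measure_lt_top).ne
  have hl := tendsto_setIntegral_add_smul_eN (d := d)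
    (isOpen_halfBall d (1 / 256)).measurableSet hfin continuous_id
    (fun y hy => ⟨hy.1.le.trans (by norm_num), hy.2.le⟩) (hu.continuousOn.pow 2)
  have hr := tendsto_setIntegral_add_smul_eN (d := d) (μ := volume)
    (s := Metric.ball (0 : Rn' d) (1 / 3)) measurableSet_ball
    measure_ball_lt_top.ne continuous_flatPoint
    (fun y' hy' => ⟨by rw [norm_flatPoint]; exact (mem_ball_zero_iff.1 hy').le,
      (flatPoint_last y').ge⟩) ((hu.continuousOn.pow 2).add (hfd.norm.pow 2))
  refine le_of_tendsto_of_tendsto hl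
    (((hr.const_mul (Real.exp (3 * τ))).const_add _).const_mul C) ?_
  filter_upwards [Ioo_mem_nhdsGT (show (0 : ℝ) < 1 / 12 by norm_num)] with δ hδ
  refine (hshift S a b c u hS hell ha hb hc (hu.mono (halfBall_subset_flatHalfBall _)) heq δ hδ.1
    hδ.2 τ hτ).trans ?_
  gcongr C * (?_ + ?_)
  · gcongr
    exact setIntegral_shift_le hu2 hδ.1 hδ.2
  · refine le_of_eq ?_
    congr 1
    refine setIntegral_congr_fun measurableSet_ball fun y' hy' => ?_
    simp only [Pi.add_apply, Pi.pow_apply]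
    rw [fderivWithin_of_mem_nhds (flatHalfBall_mem_nhds ?_)]
    exact closedBall_add_smul_eN_subset (r := 0) hδ.1 hδ.2 hδ.1
      ⟨by rw [norm_flatPoint]; exact (mem_ball_zero_iff.1 hy').le, (flatPoint_last y').ge⟩
      (Metric.mem_closedBall_self le_rfl)

end limit

/-! ### Comparison with the Cauchy data and choice of the parameter. -/

section conclusion

variable {d : ℕ}

/-- Split a vector into its orthogonal tangential and normal parts and apply Cauchy–Schwarz in the
plane. -/
lemma sq_norm_le_tangential_add_normal (L : Rn d →L[ℝ] ℝ) :
    ‖L‖ ^ 2 ≤ ‖L.comp (flatEmb d).toContinuousLinearMap‖ ^ 2 + L (eN d) ^ 2 := by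
  set p : ℝ := ‖L.comp (flatEmb d).toContinuousLinearMap‖ with hp
  set q : ℝ := L (eN d) with hq
  have h : ‖L‖ ≤ √(p ^ 2 + q ^ 2) := by
    refine L.opNorm_le_bound (Real.sqrt_nonneg _) fun x => ?_
    set x' : Rn' d := WithLp.toLp 2 fun i => x i.castSucc with hx'
    set t : ℝ := x (Fin.last d) with ht
    have hx : x = flatEmb d x' + t • eN d := by
      ext i
      refine Fin.lastCases ?_ (fun j => ?_) i
      · simp [flatEmb, flatPoint, eN, ht]
      · simp [flatEmb, flatPoint, eN, hx', Fin.castSucc_ne_last]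
    have hn : ‖x‖ ^ 2 = ‖x'‖ ^ 2 + t ^ 2 := by
      rw [EuclideanSpace.real_norm_sq_eq, EuclideanSpace.real_norm_sq_eq, Fin.sum_univ_castSucc]
    have h1 : ‖L x‖ ≤ p * ‖x'‖ + |q| * |t| := by
      have e : L x = L.comp (flatEmb d).toContinuousLinearMap x' + t * q := by
        conv_lhs => rw [hx]
        simp [hq]
      rw [e]
      refine (norm_add_le _ _).trans (add_le_add (ContinuousLinearMap.le_opNorm _ _) ?_)
      rw [Real.norm_eq_abs, abs_mul, mul_comm]
    refine h1.trans (abs_le_of_sq_le_sq' ?_ (by positivity)).2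
    rw [mul_pow, Real.sq_sqrt (by positivity), hn, ← sq_abs q, ← sq_abs t]
    linarith [sq_nonneg (p * |t| - |q| * ‖x'‖), add_sq (p * ‖x'‖) (|q| * |t|),
      sub_sq (p * |t|) (|q| * ‖x'‖)]
  calc ‖L‖ ^ 2 ≤ √(p ^ 2 + q ^ 2) ^ 2 := by gcongr
    _ = p ^ 2 + q ^ 2 := Real.sq_sqrt (by positivity)

lemma fderiv_comp_flatPoint {u : Rn d → ℝ} {r : ℝ}
    (hu : DifferentiableOn ℝ u (flatHalfBall d r)) {y' : Rn' d} (hy' : ‖y'‖ < r) :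
    fderiv ℝ (fun x' => u (flatPoint x')) y'
      = (fderivWithin ℝ u (flatHalfBall d r) (flatPoint y')).comp
        (flatEmb d).toContinuousLinearMap := by
  have hmem : ∀ x' : Rn' d, ‖x'‖ < r → flatPoint x' ∈ flatHalfBall d r := fun x' hx' =>
    ⟨by rwa [norm_flatPoint], (flatPoint_last x').ge⟩
  have h1 := (hu _ (hmem y' hy')).hasFDerivWithinAt
  have h2 : HasFDerivWithinAt (flatPoint (d := d)) (flatEmb d).toContinuousLinearMap
      (Metric.ball 0 r) y' :=
    (flatEmb d).toContinuousLinearMap.hasFDerivAt.hasFDerivWithinAt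
  have h3 := h1.comp y' h2 fun x' hx' => hmem x' (mem_ball_zero_iff.1 hx')
  exact (h3.hasFDerivAt (Metric.isOpen_ball.mem_nhds (mem_ball_zero_iff.2 hy'))).fderiv

lemma eLpNorm_two_sq {X E : Type*} [MeasurableSpace X] [NormedAddCommGroup E] (f : X → E)
    (μ : Measure X) : eLpNorm f 2 μ ^ 2 = ∫⁻ x, ‖f x‖ₑ ^ 2 ∂μ := by
  have := eLpNorm_nnreal_pow_eq_lintegral (f := f) (μ := μ) (p := 2) two_ne_zero
  simpa using this

/-- On the face the tangential part of the one-sided derivative is the derivative of the trace and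
the normal part is ∂u/∂ν up to sign. The sum of the two squared norms is then at most the square of
their sum. -/
lemma ofReal_faceData_le {u : Rn d → ℝ} (hu : ContDiffOn ℝ 1 u (flatHalfBall d (1 / 2))) :
    ENNReal.ofReal (faceData u) ≤ cauchyData (1 / 2) (1 / 3) u ^ 2 := by
  set μ : Measure (Rn' d) := volume.restrict (Metric.ball 0 (1 / 3)) with hμ
  set g : Rn' d → ℝ := fun y' => u (flatPoint y') with hg
  have hball : ∀ y' ∈ Metric.ball (0 : Rn' d) (1 / 3), ‖y'‖ < 1 / 2 := fun y' hy' =>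
    (mem_ball_zero_iff.1 hy').trans (by norm_num)
  have hgc : ContinuousOn g (Metric.ball (0 : Rn' d) (1 / 3)) :=
    hu.continuousOn.comp continuous_flatPoint.continuousOn fun y' hy' =>
      ⟨by rw [norm_flatPoint]; exact hball y' hy', (flatPoint_last y').ge⟩
  have hgm : AEMeasurable (fun y' => ‖g y'‖ₑ ^ 2) μ :=
    ((hgc.aestronglyMeasurable measurableSet_ball).enorm.pow_const 2)
  have hfm : AEMeasurable (fun y' => ‖fderiv ℝ g y'‖ₑ ^ 2) μ :=
    ((measurable_fderiv ℝ g).enorm.pow_const 2).aemeasurable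
  have hsm : AEMeasurable (fun y' => ‖g y'‖ₑ ^ 2 + ‖fderiv ℝ g y'‖ₑ ^ 2) μ := hgm.add hfm
  have h1 : ENNReal.ofReal (faceData u) ≤ ∫⁻ y', (‖g y'‖ₑ ^ 2 + ‖fderiv ℝ g y'‖ₑ ^ 2
      + ‖normalD (1 / 2) u y'‖ₑ ^ 2) ∂μ := by
    refine (ENNReal.ofReal_le_ofReal ((le_abs_self _).trans_eq
      (Real.norm_eq_abs _).symm)).trans ?_
    rw [ofReal_norm]
    refine (enorm_integral_le_lintegral_enorm _).trans (lintegral_mono_ae ?_)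
    filter_upwards [ae_restrict_mem measurableSet_ball] with y' hy'
    have e1 := sq_norm_le_tangential_add_normal
      (fderivWithin ℝ u (flatHalfBall d (1 / 2)) (flatPoint y'))
    rw [← fderiv_comp_flatPoint (hu.differentiableOn one_ne_zero) (hball y' hy')] at e1
    have e2 : ‖normalD (1 / 2) u y'‖ ^ 2
        = fderivWithin ℝ u (flatHalfBall d (1 / 2)) (flatPoint y') (eN d) ^ 2 := by
      rw [normalD, norm_neg, Real.norm_eq_abs, sq_abs, eN]
    rw [← e2] at e1
    rw [← ofReal_norm, ← ofReal_norm, ← ofReal_norm, ← ofReal_norm,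
      ← ENNReal.ofReal_pow (norm_nonneg _), ← ENNReal.ofReal_pow (norm_nonneg _), ← ENNReal.ofReal_pow (norm_nonneg _),
      ← ENNReal.ofReal_add (by positivity) (by positivity),
      ← ENNReal.ofReal_add (by positivity) (by positivity)]
    refine ENNReal.ofReal_le_ofReal ?_
    rw [Real.norm_of_nonneg (by positivity), Real.norm_eq_abs (g y'), sq_abs, add_assoc]
    exact add_le_add le_rfl e1
  refine h1.trans ?_
  rw [lintegral_add_left' hsm, lintegral_add_left' hgm, ← eLpNorm_two_sq,
    ← eLpNorm_two_sq, ← eLpNorm_two_sq]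
  have h2 : eLpNorm g 2 μ ^ 2 + eLpNorm (fderiv ℝ g) 2 μ ^ 2 = ballH1 (1 / 3) g ^ 2 := by
    have h3 : ∀ x : ℝ≥0∞, (x ^ (1 / 2 : ℝ)) ^ 2 = x := fun x => by
      rw [← ENNReal.rpow_natCast, ← ENNReal.rpow_mul]
      norm_num
    rw [ballH1, h3]
  rw [h2, cauchyData, add_sq]
  gcongr
  exact le_self_add

/-- Optimization of the free parameter. -/
lemma le_of_forall_exp_le {I U D C g T : ℝ} (hU : 0 ≤ U) (hD : 0 ≤ D) (hC : 0 < C) (hg : 0 < g)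
    (hIU : I ≤ U)
    (h : ∀ τ, T ≤ τ → I ≤ C * (Real.exp (-g * τ) * U + Real.exp (3 * τ) * D)) (hT : 0 ≤ T) :
    I ≤ (1 + 2 * C) * Real.exp (g * T) * (U ^ (3 / (3 + g)) * D ^ (1 - 3 / (3 + g))) := by
  have hκ : 1 - 3 / (3 + g) = g / (3 + g) := by
    field_simp
    ring
  rw [hκ]
  have hrhs : 0 ≤ (1 + 2 * C) * Real.exp (g * T) * (U ^ (3 / (3 + g)) * D ^ (g / (3 + g))) := by
    positivity
  rcases hU.eq_or_lt with hU0 | hU0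
  · exact (hIU.trans_eq hU0.symm).trans hrhs
  rcases hD.eq_or_lt with hD0 | hD0
  -- Zero data: only the decaying exponential is left, and τ → ∞ gives I ≤ 0.
  · refine le_trans ?_ hrhs
    have hlim : Filter.Tendsto (fun τ : ℝ => C * (Real.exp (-g * τ) * U + Real.exp (3 * τ) * D))
        Filter.atTop (nhds 0) := by
      have h1 : Filter.Tendsto (fun τ : ℝ => Real.exp (-g * τ)) Filter.atTop (nhds 0) :=
        Real.tendsto_exp_atBot.comp
          (Filter.tendsto_id.const_mul_atTop_of_neg (neg_lt_zero.2 hg))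
      simpa [← hD0] using (h1.mul_const U).const_mul C
    exact ge_of_tendsto hlim (Filter.eventually_atTop.2 ⟨T, h⟩)
  have hprod : 0 < U ^ (3 / (3 + g)) * D ^ (g / (3 + g)) := by positivity
  have hexp : 1 ≤ Real.exp (g * T) := Real.one_le_exp (by positivity)
  -- The value of τ at which e^{-gτ} U = e^{3τ} D. If it lies below the threshold T, then U is
  -- already at most e^{gT} times the claimed product, and I ≤ U suffices.
  set s : ℝ := (Real.log U - Real.log D) / (3 + g) with hs
  have hform : U ^ (3 / (3 + g)) * D ^ (g / (3 + g))
      = Real.exp ((3 * Real.log U + g * Real.log D) / (3 + g)) := by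
    rw [Real.rpow_def_of_pos hU0, Real.rpow_def_of_pos hD0, ← Real.exp_add]
    congr 1
    ring
  rcases le_or_gt T s with hTs | hTs
  · have e1 : Real.exp (-g * s) * U = U ^ (3 / (3 + g)) * D ^ (g / (3 + g)) := by
      rw [hform]
      conv_lhs => rw [← Real.exp_log hU0, ← Real.exp_add]
      congr 1
      rw [hs]
      field_simp
      ring
    have e2 : Real.exp (3 * s) * D = U ^ (3 / (3 + g)) * D ^ (g / (3 + g)) := by
      rw [hform]
      conv_lhs => rw [← Real.exp_log hD0, ← Real.exp_add]
      congr 1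
      rw [hs]
      field_simp
      ring
    have h1 := h s hTs
    rw [e1, e2] at h1
    set P := U ^ (3 / (3 + g)) * D ^ (g / (3 + g))
    calc I ≤ (2 * C) * 1 * P := by linarith
      _ ≤ (1 + 2 * C) * Real.exp (g * T) * P := by gcongr; linarith
  · have h1 : U ≤ Real.exp (g * T) * (U ^ (3 / (3 + g)) * D ^ (g / (3 + g))) := by
      rw [hform, ← Real.exp_add]
      conv_lhs => rw [← Real.exp_log hU0]
      refine Real.exp_le_exp.2 ?_
      have h2 : g * s ≤ g * T := by gcongr
      have h3 : Real.log U = g * s + (3 * Real.log U + g * Real.log D) / (3 + g) := by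
        rw [hs]
        field_simp
        ring
      linarith
    refine hIU.trans (h1.trans ?_)
    rw [mul_assoc]
    exact le_mul_of_one_le_left (by positivity) (by linarith)

lemma halfBallL2_eq {u : Rn d → ℝ} {r : ℝ} (hu : MemLp u 2 (volume.restrict (halfBall d r))) :
    halfBallL2 r u = ENNReal.ofReal (√(∫ y in halfBall d r, u y ^ 2)) := by
  rw [halfBallL2, hu.eLpNorm_eq_integral_rpow_norm two_ne_zero ENNReal.ofNat_ne_top,
    Real.sqrt_eq_rpow]
  simp

/-- Here the alternative |α| ≥ 1 or |λ| ≥ 1 is used: it makes S at least 1, so that the constant in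
|α| + 1 is absorbed. -/
lemma lower_order_bounds {α lam K : ℝ} (hK : 0 ≤ K) (h : 1 ≤ |α| ∨ 1 ≤ |lam|) :
    1 ≤ |α| + √|lam| ∧ K * (|α| + 1) ≤ 2 * K * (|α| + √|lam|) ∧
      K * (α ^ 2 + |lam|) ≤ 2 * K * (|α| + √|lam|) ^ 2 := by
  have h0 := abs_nonneg α
  have h1 := Real.sqrt_nonneg |lam|
  have hS : 1 ≤ |α| + √|lam| := by
    rcases h with h | h
    · linarith
    · have := Real.one_le_sqrt.2 h
      linarith
  refine ⟨hS, ?_, ?_⟩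
  · have : |α| + 1 ≤ 2 * (|α| + √|lam|) := by linarith
    calc K * (|α| + 1) ≤ K * (2 * (|α| + √|lam|)) := by gcongr
      _ = _ := by ring
  · have h2 : α ^ 2 + |lam| = |α| ^ 2 + √|lam| ^ 2 := by
      rw [sq_abs, Real.sq_sqrt (abs_nonneg _)]
    have h3 : |α| ^ 2 + √|lam| ^ 2 ≤ 2 * (|α| + √|lam|) ^ 2 := by
      have := mul_nonneg h0 h1
      linarith [add_sq |α| (√|lam|), sq_nonneg |α|, sq_nonneg (√|lam|)]
    rw [h2]
    calc K * (|α| ^ 2 + √|lam| ^ 2) ≤ K * (2 * (|α| + √|lam|) ^ 2) := by gcongr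
      _ = _ := by ring

end conclusion

theorem lemma3 (d : ℕ) (hd : 1 ≤ d) (θ M K : ℝ) (hθ : 0 < θ) (hM : 0 < M) (hK : 0 < K) :
    ∃ C : ℝ, 0 < C ∧ ∃ β : ℝ, 0 < β ∧ ∃ κ : ℝ, 0 < κ ∧ κ < 1 ∧
      ∀ α lam : ℝ, (1 ≤ |α| ∨ 1 ≤ |lam|) →
      ∀ (a : Fin (d + 1) → Fin (d + 1) → Rn d → ℝ) (b : Fin (d + 1) → Rn d → ℝ)
        (c : Rn d → ℝ),
        UniformlyElliptic (halfBall d (1 / 2)) a θ →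
        (∀ i j, C1NormLE (halfBall d (1 / 2)) (a i j) M) →
        (∀ i, W1InftyNormLE (halfBall d (1 / 2)) (b i) (K * (|α| + 1))) →
        W1InftyNormLE (halfBall d (1 / 2)) c (K * (α ^ 2 + |lam|)) →
      ∀ u : Rn d → ℝ,
        ContDiffOn ℝ ∞ u (flatHalfBall d (1 / 2)) →
        MemLp u 2 (volume.restrict (halfBall d (1 / 2))) →
        (∀ᵐ y ∂(volume.restrict (halfBall d (1 / 2))), ellipticOp a b c u y = 0) →
        (∀ ε : ℝ, 0 < ε → cauchyData (1 / 2) (1 / 3) u ≤ ENNReal.ofReal ε →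
          halfBallL2 (1 / 2) u ≤ 1 →
          halfBallL2 (1 / 256) u
            ≤ ENNReal.ofReal (Real.exp (C * (|α| + √|lam|)) * ε ^ β)) ∧
        halfBallL2 (1 / 256) u
          ≤ ENNReal.ofReal (Real.exp (C * (|α| + √|lam|)))
            * halfBallL2 (1 / 2) u ^ κ * cauchyData (1 / 2) (1 / 3) u ^ (1 - κ) := by
  obtain ⟨C, g, hC, hg, hest⟩ := face_estimate (d := d) (M := M) (K := 2 * K) hθ (by positivity)
  have hκ1 : 3 / (3 + g) < 1 := (div_lt_one (by positivity)).2 (by linarith)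
  -- In the exponent, 2C absorbs the factor 1 + 2C through 1 + x ≤ e^x and S ≥ 1, and gC comes from
  -- the threshold τ ≥ C S; the division by 2 is the square root. The choice β = 1 - κ makes the
  -- smallness statement a special case of the interpolation inequality.
  refine ⟨(2 + g) * C / 2, by positivity, 1 - 3 / (3 + g), sub_pos.2 hκ1, 3 / (3 + g),
    by positivity, hκ1, ?_⟩
  intro α lam hαl a b c hell ha hb hc u hu hu2 heq
  obtain ⟨hS, hKb, hKc⟩ := lower_order_bounds hK.le hαl
  set S : ℝ := |α| + √|lam| with hSdef
  set κ : ℝ := 3 / (3 + g) with hκ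
  have hκ0 : 0 < κ := by positivity
  have hmain := hest S a b c u hS hell ha (fun i => (hb i).mono hKb) (hc.mono hKc)
    (hu.of_le (WithTop.coe_le_coe.2 le_top)) hu2 heq
  set U : ℝ := ∫ y in halfBall d (1 / 2), u y ^ 2 with hU
  have hsub : halfBall d (1 / 256) ⊆ halfBall d (1 / 2) :=
    fun y hy => ⟨hy.1.trans (by norm_num), hy.2⟩
  have hU0 : 0 ≤ U := integral_nonneg fun y => sq_nonneg _
  have hD0 : 0 ≤ faceData u := integral_nonneg fun y => by positivity
  have hIU : ∫ y in halfBall d (1 / 256), u y ^ 2 ≤ U :=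
    setIntegral_mono_set hu2.integrable_sq (Filter.Eventually.of_forall fun y => sq_nonneg _)
      hsub.eventuallyLE
  have hI := le_of_forall_exp_le hU0 hD0 hC hg hIU hmain (by positivity)
  rw [← hκ] at hI
  have hconst : (1 + 2 * C) * Real.exp (g * (C * S)) ≤ Real.exp ((2 + g) * C / 2 * S) ^ 2 := by
    have h1 : 1 + 2 * C ≤ Real.exp (2 * C * S) := by
      have h2 : 2 * C * 1 ≤ 2 * C * S := by gcongr
      linarith [Real.add_one_le_exp (2 * C * S)]
    calc (1 + 2 * C) * Real.exp (g * (C * S))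
        ≤ Real.exp (2 * C * S) * Real.exp (g * (C * S)) := by gcongr
      _ = Real.exp ((2 + g) * C / 2 * S) ^ 2 := by
        rw [← Real.exp_add, ← Real.exp_nat_mul]
        congr 1
        push_cast
        ring
  have hsqrt : √(∫ y in halfBall d (1 / 256), u y ^ 2)
      ≤ Real.exp ((2 + g) * C / 2 * S) * √U ^ κ * √(faceData u) ^ (1 - κ) := by
    refine Real.sqrt_le_iff.2 ⟨by positivity, hI.trans ?_⟩
    have e : ∀ x r : ℝ, 0 ≤ x → (√x ^ r) ^ 2 = x ^ r := fun x r hx => by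
      rw [← Real.rpow_natCast, ← Real.rpow_mul (Real.sqrt_nonneg _), mul_comm,
        Real.rpow_mul (Real.sqrt_nonneg _), Real.rpow_natCast, Real.sq_sqrt hx]
    rw [mul_pow, mul_pow, e U κ hU0, e _ (1 - κ) hD0, mul_assoc (_ ^ 2)]
    gcongr
  have hdata : ENNReal.ofReal √(faceData u) ≤ cauchyData (1 / 2) (1 / 3) u := by
    rw [← ENNReal.pow_le_pow_left_iff two_ne_zero, ← ENNReal.ofReal_pow (Real.sqrt_nonneg _),
      Real.sq_sqrt hD0]
    exact ofReal_faceData_le (hu.of_le (by exact_mod_cast le_top))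
  have hfinal : halfBallL2 (1 / 256) u
      ≤ ENNReal.ofReal (Real.exp ((2 + g) * C / 2 * S))
        * halfBallL2 (1 / 2) u ^ κ * cauchyData (1 / 2) (1 / 3) u ^ (1 - κ) := by
    rw [halfBallL2_eq (hu2.mono_measure (Measure.restrict_mono hsub le_rfl)), halfBallL2_eq hu2]
    refine (ENNReal.ofReal_le_ofReal hsqrt).trans ?_
    rw [ENNReal.ofReal_mul (by positivity), ENNReal.ofReal_mul (by positivity),
      ← ENNReal.ofReal_rpow_of_nonneg (Real.sqrt_nonneg _) hκ0.le,
      ← ENNReal.ofReal_rpow_of_nonneg (Real.sqrt_nonneg _) (sub_pos.2 hκ1).le]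
    gcongr
  refine ⟨fun ε hε hdε hu1 => hfinal.trans ?_, hfinal⟩
  have hβ := (sub_pos.2 hκ1).le
  rw [ENNReal.ofReal_mul (Real.exp_nonneg _), ← ENNReal.ofReal_rpow_of_nonneg hε.le hβ]
  calc ENNReal.ofReal (Real.exp ((2 + g) * C / 2 * S))
        * halfBallL2 (1 / 2) u ^ κ * cauchyData (1 / 2) (1 / 3) u ^ (1 - κ)
      ≤ ENNReal.ofReal (Real.exp ((2 + g) * C / 2 * S)) * 1 ^ κ
        * ENNReal.ofReal ε ^ (1 - κ) := by gcongr
    _ = _ := by rw [ENNReal.one_rpow, mul_one]
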